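/- Let $b\in C^1_c(\mathbb R)$ and $f^0=f^0(x,v_1,v_2)\in C^1_c(\mathbb R^3)$ satisfy the neutrality condition $\int_{\mathbb R}\int_{\mathbb R^2} f^0(x,v)\,dv\,dx=\int_{\mathbb R} b(x)\,dx$, and let $E_2^0,B^0:\mathbb R\to\mathbb R$ be initial fields. The 1.5D Vlasov--Maxwell system for $f(t,x,v_1,v_2)$, $E_1(t,x)$, $E_2(t,x)$, $B(t,x)$ ($t\ge 0$, $x\in\mathbb R$, $v=(v_1,v_2)\in\mathbb R^2$) is $$\begin{gathered}\partial_t f+v_1\partial_x f+(E_1+v_2B)\,\partial_{v_1}f+(E_2-v_1B)\,\partial_{v_2}f=0,\\ \rho=\int_{\mathbb R^2} f\,dv-b,\qquad j_i=\int_{\mathbb R^2} v_i f\,dv\quad(i=1,2),\\ \partial_xE_1=\rho,\qquad \partial_tE_1=-j_1,\qquad \partial_tE_2=-\partial_xB-j_2,\qquad \partial_tB=-\partial_xE_2,\end{gathered}$$ with $f(0,\cdot)=f^0$, $E_2(0,\cdot)=E_2^0$, $B(0,\cdot)=B^0$. A global $C^1$ solution is a quadruple $(f,E_1,E_2,B)$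 with $f\in C^1([0,\infty)\times\mathbb R^3)$ and $E_1,E_2,B\in C^1([0,\infty)\times\mathbb R)$ that satisfies these equations for all $t\ge0$, takes the initial data, has velocity support bounded locally uniformly in time (for every $T>0$ there is $R$ such that $f(t,x,v)=0$ whenever $0\le t\le T$, $x\in\mathbb R$ and $\max(|v_1|,|v_2|)>R$), and satisfies $E_1(t,x)\to0$ as $|x|\to\infty$ for each $t\ge 0$. Theorem. Suppose $f^0(x,v_1,v_2)=f^0(x,v_1,-v_2)$ for all $x,v_1,v_2\in\mathbb R$ and $E_2^0=B^0=0$. Then there is exactly one global $C^1$ solution $(f,E_1,E_2,B)$ of the 1.5D Vlasov--Maxwell system with these data, and it satisfies $f(t,x,v_1,v_2)=f(t,x,v_1,-v_2)$ for all $t\ge0$ and $x,v_1,v_2\in\mathbb R$. Moreover $E_2(t,x)=B(t,x)=0$ for all $t\ge0$, $x\in\mathbb R$, and $f$ satisfies the one-dimensional Vlasov--Poisson system in $(t,x,v_1)$ with $v_2$ as a parameter: $$\partial_t f+v_1\partial_x f+E_1\partial_{v_1}f=0,\qquad \partial_xE_1=\int_{\mathbb R^2} f\,dv-b,\qquad \partial_tE_1=-\int_{\mathbb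 R^2} v_1f\,dv.$$ -/

import Mathlib

open MeasureTheory Filter Topology Set

noncomputable section

namespace OneAndHalfVM

/-- Net charge density `ρ(t,x) = ∫ f(t,x,v) dv - b(x)`, with `v = (v₁, v₂) ∈ ℝ²`. -/
def chargeDensity (b : ℝ → ℝ) (f : ℝ → ℝ → ℝ → ℝ → ℝ) (t x : ℝ) : ℝ :=
  (∫ v : ℝ × ℝ, f t x v.1 v.2) - b x

/-- First component of the current density, `j₁(t,x) = ∫ v₁ f(t,x,v) dv`. -/
def current₁ (f : ℝ → ℝ → ℝ → ℝ → ℝ) (t x : ℝ) : ℝ :=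
  ∫ v : ℝ × ℝ, v.1 * f t x v.1 v.2

/-- Second component of the current density, `j₂(t,x) = ∫ v₂ f(t,x,v) dv`. -/
def current₂ (f : ℝ → ℝ → ℝ → ℝ → ℝ) (t x : ℝ) : ℝ :=
  ∫ v : ℝ × ℝ, v.2 * f t x v.1 v.2

/-- Partial derivative in time on the half line `t ≥ 0` (one-sided at `t = 0`). -/
def timeDeriv (g : ℝ → ℝ) (t : ℝ) : ℝ := derivWithin g (Ici 0) t

/-- `f ∈ C¹([0,∞) × ℝ³)`, up to the boundary `t = 0`; values at `t < 0` play no role. -/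
def IsC1Density (f : ℝ → ℝ → ℝ → ℝ → ℝ) : Prop :=
  ContDiffOn ℝ 1 (fun p : ℝ × ℝ × ℝ × ℝ => f p.1 p.2.1 p.2.2.1 p.2.2.2) (Ici 0 ×ˢ univ)

/-- `F ∈ C¹([0,∞) × ℝ)`, up to the boundary `t = 0`. -/
def IsC1Field (F : ℝ → ℝ → ℝ) : Prop :=
  ContDiffOn ℝ 1 (fun p : ℝ × ℝ => F p.1 p.2) (Ici 0 ×ˢ univ)

/-- The velocity support of `f` is bounded, uniformly in `x` and in `t ∈ [0,T]`, for every `T`. -/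
def HasBoundedVelocities (f : ℝ → ℝ → ℝ → ℝ → ℝ) : Prop :=
  ∀ T : ℝ, ∃ R : ℝ, ∀ t ∈ Icc 0 T, ∀ x v₁ v₂ : ℝ, f t x v₁ v₂ ≠ 0 → |v₁| ≤ R ∧ |v₂| ≤ R

/-- `f⁰ ∈ C¹_c(ℝ³)` as a function of `(x, v₁, v₂)`. -/
structure IsC1cDatum (f0 : ℝ → ℝ → ℝ → ℝ) : Prop where
  contDiff : ContDiff ℝ 1 (fun p : ℝ × ℝ × ℝ => f0 p.1 p.2.1 p.2.2)
  compact : HasCompactSupport (fun p : ℝ × ℝ × ℝ => f0 p.1 p.2.1 p.2.2)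

/-- Global neutrality: `∬ f⁰(x,v) dv dx = ∫ b(x) dx`. -/
def IsNeutral (b : ℝ → ℝ) (f0 : ℝ → ℝ → ℝ → ℝ) : Prop :=
  ∫ p : ℝ × ℝ × ℝ, f0 p.1 p.2.1 p.2.2 = ∫ x, b x

/-- `(f, E₁, E₂, B)` is a global classical solution of the 1.5D Vlasov–Maxwell system with
background `b` and initial data `f⁰, E₂⁰, B⁰`. The field `E₁` is determined by `∂ₓ E₁ = ρ` and
`∂ₜ E₁ = -j₁` up to one constant only, which is fixed by the decay of `E₁` at spatial infinity. -/
structure IsGlobalVMSolution (b : ℝ → ℝ) (f0 : ℝ → ℝ → ℝ → ℝ) (E20 B0 : ℝ → ℝ)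
    (f : ℝ → ℝ → ℝ → ℝ → ℝ) (E₁ E₂ B : ℝ → ℝ → ℝ) : Prop where
  regular_f : IsC1Density f
  regular_E₁ : IsC1Field E₁
  regular_E₂ : IsC1Field E₂
  regular_B : IsC1Field B
  velocities : HasBoundedVelocities f
  vlasov : ∀ t ≥ 0, ∀ x v₁ v₂ : ℝ,
    timeDeriv (fun s => f s x v₁ v₂) t + v₁ * deriv (fun y => f t y v₁ v₂) x
      + (E₁ t x + v₂ * B t x) * deriv (fun w => f t x w v₂) v₁
      + (E₂ t x - v₁ * B t x) * deriv (fun w => f t x v₁ w) v₂ = 0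
  gauss : ∀ t ≥ 0, ∀ x : ℝ, deriv (fun y => E₁ t y) x = chargeDensity b f t x
  ampere₁ : ∀ t ≥ 0, ∀ x : ℝ, timeDeriv (fun s => E₁ s x) t = - current₁ f t x
  ampere₂ : ∀ t ≥ 0, ∀ x : ℝ,
    timeDeriv (fun s => E₂ s x) t = - deriv (fun y => B t y) x - current₂ f t x
  faraday : ∀ t ≥ 0, ∀ x : ℝ, timeDeriv (fun s => B s x) t = - deriv (fun y => E₂ t y) x
  decay : ∀ t ≥ 0, Tendsto (E₁ t) (cocompact ℝ) (𝓝 0)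
  initial_f : ∀ x v₁ v₂ : ℝ, f 0 x v₁ v₂ = f0 x v₁ v₂
  initial_E₂ : ∀ x : ℝ, E₂ 0 x = E20 x
  initial_B : ∀ x : ℝ, B 0 x = B0 x

/-- `(f, E₁)` satisfies the equations of the one-dimensional Vlasov–Poisson system in
`(t, x, v₁)` for `t ≥ 0`, with `v₂` as a parameter. -/
structure SatisfiesVlasovPoisson (b : ℝ → ℝ)
    (f : ℝ → ℝ → ℝ → ℝ → ℝ) (E₁ : ℝ → ℝ → ℝ) : Prop where
  vlasov : ∀ v₂ : ℝ, ∀ t ≥ 0, ∀ x v₁ : ℝ,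
    timeDeriv (fun s => f s x v₁ v₂) t + v₁ * deriv (fun y => f t y v₁ v₂) x
      + E₁ t x * deriv (fun w => f t x w v₂) v₁ = 0
  gauss : ∀ t ≥ 0, ∀ x : ℝ, deriv (fun y => E₁ t y) x = chargeDensity b f t x
  ampere : ∀ t ≥ 0, ∀ x : ℝ, timeDeriv (fun s => E₁ s x) t = - current₁ f t x

end OneAndHalfVM

end

/-!
The symmetry `v₂ ↦ -v₂` reduces the theorem to two independent facts: the one-dimensional
Vlasov–Poisson system, with `v₂` as a parameter, has a global `C¹` solution that is even in `v₂`,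
and global `C¹` solutions of the 1.5D Vlasov–Maxwell system are unique. Indeed evenness gives
`j₂ = 0`, so that `E₂ = B = 0` is consistent with the equations of the transverse fields.

*Existence.* For a prescribed force `K(t,x)` the system `X' = V`, `V' = K(t,X)` has a backward flow
which is `C¹` in all variables; differentiability follows from Carathéodory's criterion, the slopes
being solutions of a linear equation whose coefficient is the Hadamard slope of `K`
(`IsForce.exists_backwardFlow`). The datum carried along the flow is a `C¹` density, and its charge
is conserved. A bounded cutoff is applied to the field, and the map sending a density to the density
carried by its own cut-off field is iterated: by the maximum principle for transport equations
(`nonpos_of_deriv_nonpos_at_max`) the iteration contracts in an exponentially weighted norm, and the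
limit is a fixed point (`IsVPData.exists_selfConsistent`). The level of the cutoff is never reached:
a nonnegative datum dominating `|f⁰|` and carried by the same flow keeps its mass, which bounds the
field (`abs_efield_le_of_dominated`). The field is taken as the integral of the charge from `-∞`; it
vanishes to the left of the support, and by neutrality and conservation of charge also to the right.
The velocity `v₂` is constant along the flow, which preserves evenness.

*Uniqueness* (`IsGlobalVMSolution.unique`). Velocities are bounded on bounded time intervals, so the
spatial support of `f` spreads at finite speed (`IsGlobalVMSolution.eq_zero_of_mem_vacuum`). For two
solutions, the decay of `E₁` controls the difference of the fields `E₁` by that of the densities, the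
representation of `E₂ ± B` along light rays does the same for the transverse fields, and the maximum
principle controls the difference of the densities by that of the fields, with a factor `1/2` in an
exponentially weighted norm (`IsGlobalVMSolution.abs_sub_le_half`). Iterating these bounds shows that
the difference vanishes.
-/

noncomputable section

namespace OneAndHalfVM

/-! ### Ordinary differential equations depending on parameters -/

/-- A sequence of continuous maps whose increments decay geometrically, locally uniformly, converges
to a continuous map. -/
lemma exists_continuous_limit_of_geometric {α E : Type*} [TopologicalSpace α] [MetricSpace E]
    [CompleteSpace E] {u : ℕ → α → E} (hu : ∀ n, Continuous (u n))
    (h : ∀ a, ∃ U ∈ 𝓝 a, ∃ C : ℝ, ∀ x ∈ U, ∀ n, dist (u n x) (u (n + 1) x) ≤ C * (1 / 2) ^ n) :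
    ∃ g : α → E, Continuous g ∧ ∀ a, Tendsto (fun n => u n a) atTop (𝓝 (g a)) := by
  have hlim : ∀ a, ∃ y, Tendsto (fun n => u n a) atTop (𝓝 y) := by
    intro a
    obtain ⟨U, hU, C, hC⟩ := h a
    exact cauchySeq_tendsto_of_complete
      (cauchySeq_of_le_geometric (1 / 2) C (by norm_num) (hC a (mem_of_mem_nhds hU)))
  choose g hg using hlim
  refine ⟨g, ?_, hg⟩
  have hloc : TendstoLocallyUniformly u g atTop := by
    rw [Metric.tendstoLocallyUniformly_iff]
    intro ε hε a
    obtain ⟨U, hU, C, hC⟩ := h a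
    refine ⟨U, hU, ?_⟩
    have h0 : Tendsto (fun n : ℕ => C * (1 / 2 : ℝ) ^ n / (1 - 1 / 2)) atTop (𝓝 0) := by
      have := ((tendsto_pow_atTop_nhds_zero_of_lt_one (r := (1 / 2 : ℝ)) (by norm_num)
        (by norm_num)).const_mul C).div_const (1 - 1 / 2)
      simpa using this
    filter_upwards [h0.eventually_lt_const hε] with n hn y hy
    rw [dist_comm]
    exact (dist_le_of_le_geometric_of_tendsto (1 / 2) C (by norm_num) (hC y hy) (hg y) n).trans_lt
      hn
  exact hloc.continuous (Eventually.of_forall hu).frequently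

/-- An integral against a forcing of size `exp (2c|r|)` gains a factor `1/2` in the exponentially
weighted norm. -/
lemma norm_intervalIntegral_le_half_exp {E : Type*} [NormedAddCommGroup E] [NormedSpace ℝ E]
    {g : ℝ → E} {c D s : ℝ} (hD : 0 ≤ D)
    (h : ∀ r ∈ uIcc 0 s, ‖g r‖ ≤ c * (D * Real.exp (2 * c * |r|))) :
    ‖∫ r in (0 : ℝ)..s, g r‖ ≤ D * Real.exp (2 * c * |s|) / 2 := by
  have key : ∀ (g : ℝ → E) (s : ℝ), 0 ≤ s →
      (∀ r ∈ Icc 0 s, ‖g r‖ ≤ c * (D * Real.exp (2 * c * r))) →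
      ‖∫ r in (0 : ℝ)..s, g r‖ ≤ D * Real.exp (2 * c * s) / 2 := by
    intro g s hs hg
    have hd : ∀ r ∈ uIcc 0 s, HasDerivAt (fun r => D * Real.exp (2 * c * r) / 2)
        (c * (D * Real.exp (2 * c * r))) r := by
      intro r _
      have h1 : HasDerivAt (fun r : ℝ => 2 * c * r) (2 * c) r := by
        simpa using (hasDerivAt_id r).const_mul (2 * c)
      exact ((h1.exp.const_mul D).div_const 2).congr_deriv (by ring)
    have hi : IntervalIntegrable (fun r => c * (D * Real.exp (2 * c * r))) volume 0 s :=
      Continuous.intervalIntegrable (by fun_prop) _ _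
    have hint := intervalIntegral.integral_eq_sub_of_hasDerivAt hd hi
    calc ‖∫ r in (0 : ℝ)..s, g r‖ ≤ ∫ r in (0 : ℝ)..s, c * (D * Real.exp (2 * c * r)) :=
          intervalIntegral.norm_integral_le_of_norm_le hs
            (ae_of_all _ fun r hr => hg r ⟨hr.1.le, hr.2⟩) hi
      _ ≤ D * Real.exp (2 * c * s) / 2 := by
          rw [hint]; simp only [mul_zero, Real.exp_zero]; linarith
  rcases le_total 0 s with hs | hs
  · rw [abs_of_nonneg hs]
    refine key g s hs fun r hr => ?_
    have := h r (by rwa [uIcc_of_le hs])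
    rwa [abs_of_nonneg hr.1] at this
  · rw [abs_of_nonpos hs]
    have h2 := key (fun r => g (-r)) (-s) (by linarith) fun r hr => by
      have := h (-r) (by rw [uIcc_of_ge hs]; constructor <;> linarith [hr.1, hr.2])
      rwa [abs_neg, abs_of_nonneg hr.1] at this
    rw [intervalIntegral.integral_comp_neg, neg_zero, neg_neg, intervalIntegral.integral_symm,
      norm_neg] at h2
    exact h2

/-- Global solutions of `y' = F(s, p, y)`, `y(0) = y₀(p)`, for a jointly continuous right-hand side
that is Lipschitz in `y` with a continuous constant: they exist and are jointly continuous in time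
and the parameter. -/
theorem exists_continuous_ode_solution {P E : Type*} [TopologicalSpace P]
    [WeaklyLocallyCompactSpace P] [FirstCountableTopology P] [NormedAddCommGroup E]
    [NormedSpace ℝ E] [CompleteSpace E]
    {F : ℝ → P → E → E} {l : ℝ → P → ℝ} {y₀ : P → E}
    (hF : Continuous fun q : ℝ × P × E => F q.1 q.2.1 q.2.2)
    (hl : Continuous fun q : ℝ × P => l q.1 q.2)
    (hLip : ∀ s p y y', ‖F s p y - F s p y'‖ ≤ l s p * ‖y - y'‖) (hy₀ : Continuous y₀) :
    ∃ Y : ℝ → P → E, (Continuous fun q : ℝ × P => Y q.1 q.2) ∧ (∀ p, Y 0 p = y₀ p) ∧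
      ∀ s p, HasDerivAt (fun r => Y r p) (F s p (Y s p)) s := by
  -- Picard iterates
  let A : ℕ → ℝ × P → E := fun n => Nat.rec (fun q => y₀ q.2)
    (fun _ a q => y₀ q.2 + ∫ r in (0 : ℝ)..q.1, F r q.2 (a (r, q.2))) n
  have hA1 : ∀ n q, A (n + 1) q = y₀ q.2 + ∫ r in (0 : ℝ)..q.1, F r q.2 (A n (r, q.2)) :=
    fun n q => rfl
  have hcomp : ∀ a : ℝ × P → E, Continuous a → Continuous fun q : P × ℝ => F q.2 q.1 (a (q.2, q.1)) :=
    fun a ha => hF.comp (continuous_snd.prodMk (continuous_fst.prodMk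
      (ha.comp (continuous_snd.prodMk continuous_fst))))
  have hAc : ∀ n, Continuous (A n) := by
    intro n
    induction n with
    | zero => exact hy₀.comp continuous_snd
    | succ n ih =>
      have h1 : Continuous fun q : P × ℝ => ∫ r in (0 : ℝ)..q.2, F r q.1 (A n (r, q.1)) :=
        intervalIntegral.continuous_parametric_primitive_of_continuous
          (f := fun p r => F r p (A n (r, p))) (hcomp _ ih)
      exact (hy₀.comp continuous_snd).add (h1.comp (continuous_snd.prodMk continuous_fst))
  -- geometric convergence, uniformly on `[-T, T] × C` with `C` compact
  have hgeo : ∀ (T : ℝ) (C : Set P), IsCompact C → ∃ D Λ : ℝ, 0 ≤ D ∧ 0 ≤ Λ ∧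
      (∀ s ∈ Icc (-T) T, ∀ p ∈ C, l s p ≤ Λ) ∧
      ∀ n, ∀ s ∈ Icc (-T) T, ∀ p ∈ C,
        ‖A n (s, p) - A (n + 1) (s, p)‖ ≤ D * (1 / 2) ^ n * Real.exp (2 * Λ * |s|) := by
    intro T C hC
    obtain ⟨Λ, hΛ⟩ := (isCompact_Icc (a := -T) (b := T)).prod hC |>.exists_bound_of_continuousOn
      hl.continuousOn
    obtain ⟨D, hD⟩ := (isCompact_Icc (a := -T) (b := T)).prod hC |>.exists_bound_of_continuousOn
      ((hAc 0).sub (hAc 1)).continuousOn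
    have hl' : ∀ s ∈ Icc (-T) T, ∀ p ∈ C, l s p ≤ max Λ 0 := fun s hs p hp =>
      ((le_abs_self _).trans (hΛ (s, p) ⟨hs, hp⟩)).trans (le_max_left _ _)
    refine ⟨max D 0, max Λ 0, le_max_right _ _, le_max_right _ _, hl', ?_⟩
    intro n
    induction n with
    | zero =>
      intro s hs p hp
      have h1 := (hD (s, p) ⟨hs, hp⟩).trans (le_max_left D 0)
      have h2 : (1 : ℝ) ≤ Real.exp (2 * max Λ 0 * |s|) := Real.one_le_exp (by positivity)
      simp only [pow_zero, mul_one]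
      exact h1.trans (le_mul_of_one_le_right (le_max_right _ _) h2)
    | succ n ih =>
      intro s hs p hp
      have hi : ∀ n, IntervalIntegrable (fun r => F r p (A n (r, p))) volume 0 s := fun n =>
        ((hcomp _ (hAc n)).comp (continuous_const.prodMk continuous_id)).intervalIntegrable _ _
      rw [hA1, hA1 (n + 1), add_sub_add_left_eq_sub]
      dsimp only
      rw [← intervalIntegral.integral_sub (hi n) (hi (n + 1))]
      have hsub : uIcc 0 s ⊆ Icc (-T) T := by
        have : (0 : ℝ) ∈ Icc (-T) T := by
          have := hs.1.trans hs.2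
          constructor <;> linarith
        exact ordConnected_Icc.uIcc_subset this hs
      refine (norm_intervalIntegral_le_half_exp (c := max Λ 0) (D := max D 0 * (1 / 2) ^ n)
        (by positivity) fun r hr => ?_).trans (le_of_eq (by ring))
      refine (hLip _ _ _ _).trans ?_
      exact mul_le_mul (hl' r (hsub hr) p hp) (ih r (hsub hr) p hp) (norm_nonneg _)
        (le_max_right _ _)
  have hgeo' : ∀ (T : ℝ) (C : Set P), IsCompact C → ∃ D Λ : ℝ, 0 ≤ Λ ∧
      (∀ s ∈ Icc (-T) T, ∀ p ∈ C, l s p ≤ Λ) ∧ ∀ s ∈ Icc (-T) T, ∀ p ∈ C, ∀ n,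
        dist (A n (s, p)) (A (n + 1) (s, p)) ≤ D * (1 / 2) ^ n := by
    intro T C hC
    obtain ⟨D, Λ, hD, hΛ, hl', h⟩ := hgeo T C hC
    refine ⟨D * Real.exp (2 * Λ * T), Λ, hΛ, hl', fun s hs p hp n => ?_⟩
    rw [dist_eq_norm]
    refine (h n s hs p hp).trans ?_
    rw [mul_right_comm]
    gcongr
    exact abs_le.2 hs
  obtain ⟨g, hgc, hg⟩ := exists_continuous_limit_of_geometric hAc (by
    rintro ⟨s, p⟩
    obtain ⟨C, hC, hCp⟩ := exists_compact_mem_nhds p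
    obtain ⟨D, Λ, -, -, h⟩ := hgeo' (|s| + 1) C hC
    refine ⟨Icc (-(|s| + 1)) (|s| + 1) ×ˢ C, prod_mem_nhds (Icc_mem_nhds ?_ ?_) hCp, D, ?_⟩
    · linarith [neg_abs_le s]
    · linarith [le_abs_self s]
    · rintro ⟨r, q⟩ ⟨hr, hq⟩ n
      exact h r hr q hq n)
  have hint : ∀ s p, g (s, p) = y₀ p + ∫ r in (0 : ℝ)..s, F r p (g (r, p)) := by
    intro s p
    refine tendsto_nhds_unique ((hg (s, p)).comp (tendsto_add_atTop_nat 1)) ?_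
    obtain ⟨D, Λ, hΛ, hl', h⟩ := hgeo' |s| {p} isCompact_singleton
    have hsub : uIcc 0 s ⊆ Icc (-|s|) |s| :=
      ordConnected_Icc.uIcc_subset (by simp) ⟨neg_abs_le s, le_abs_self s⟩
    have hi : ∀ a : ℝ × P → E, Continuous a →
        IntervalIntegrable (fun r => F r p (a (r, p))) volume 0 s := fun a ha =>
      ((hcomp _ ha).comp (continuous_const.prodMk continuous_id)).intervalIntegrable _ _
    refine Tendsto.const_add _ ?_
    rw [tendsto_iff_norm_sub_tendsto_zero]
    refine squeeze_zero (fun _ => norm_nonneg _) (g := fun n : ℕ =>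
      Λ * (D * (1 / 2) ^ n / (1 - 1 / 2)) * |s - 0|) (fun n => ?_) ?_
    · rw [← intervalIntegral.integral_sub (hi _ (hAc n)) (hi _ hgc)]
      refine intervalIntegral.norm_integral_le_of_norm_le_const fun r hr => ?_
      have hr' := hsub (uIoc_subset_uIcc hr)
      refine (hLip _ _ _ _).trans (mul_le_mul (hl' r hr' p rfl) ?_ (norm_nonneg _) hΛ)
      rw [← dist_eq_norm]
      exact dist_le_of_le_geometric_of_tendsto (1 / 2) D (by norm_num) (h r hr' p rfl)
        (hg (r, p)) n
    · have := (((tendsto_pow_atTop_nhds_zero_of_lt_one (r := (1 / 2 : ℝ)) (by norm_num)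
        (by norm_num)).const_mul D).div_const (1 - 1 / 2)).const_mul Λ |>.mul_const |s - 0|
      simpa using this
  refine ⟨fun s p => g (s, p), hgc, fun p => (hint 0 p).trans (by simp), fun s p => ?_⟩
  have hc : Continuous fun r => F r p (g (r, p)) :=
    (hcomp _ hgc).comp (continuous_const.prodMk continuous_id)
  have := (intervalIntegral.integral_hasDerivAt_right (hc.intervalIntegrable 0 s)
    (hc.stronglyMeasurableAtFilter _ _) hc.continuousAt).const_add (y₀ p)
  exact this.congr_of_eventuallyEq (Eventually.of_forall fun r => hint r p)

/-- Uniqueness of global solutions, for a Lipschitz constant that is locally bounded in time. -/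
theorem ode_solution_unique_of_continuous_lipschitz {E : Type*} [NormedAddCommGroup E]
    [NormedSpace ℝ E] {F : ℝ → E → E} {l : ℝ → ℝ} (hl : Continuous l)
    (hLip : ∀ s y y', ‖F s y - F s y'‖ ≤ l s * ‖y - y'‖) {y z : ℝ → E}
    (hy : ∀ s, HasDerivAt y (F s (y s)) s) (hz : ∀ s, HasDerivAt z (F s (z s)) s) {s₀ : ℝ}
    (h : y s₀ = z s₀) : y = z := by
  ext s
  set T := |s| + |s₀| + 1
  obtain ⟨Λ, hΛ⟩ := (isCompact_Icc (a := -T) (b := T)).exists_bound_of_continuousOn hl.continuousOn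
  have h1 : s ∈ Icc (-T) T := by
    constructor <;> linarith [neg_abs_le s, le_abs_self s, abs_nonneg s₀]
  have h0 : s₀ ∈ Ioo (-T) T := by
    constructor <;> linarith [neg_abs_le s₀, le_abs_self s₀, abs_nonneg s]
  refine ODE_solution_unique_of_mem_Icc (v := F) (s := fun _ => univ) (K := Λ.toNNReal)
    (fun t ht => ?_) h0 (fun t _ => (hy t).continuousAt.continuousWithinAt) (fun t _ => hy t)
    (fun _ _ => trivial) (fun t _ => (hz t).continuousAt.continuousWithinAt) (fun t _ => hz t)
    (fun _ _ => trivial) h h1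
  refine LipschitzOnWith.of_dist_le_mul fun a _ b _ => ?_
  rw [dist_eq_norm, dist_eq_norm]
  refine (hLip _ _ _).trans (mul_le_mul_of_nonneg_right ?_ (norm_nonneg _))
  exact ((le_abs_self _).trans (hΛ t (Ioo_subset_Icc_self ht))).trans (Real.le_coe_toNNReal Λ)

/-! ### Smoothness of the characteristic flow -/

/-- Carathéodory's criterion: a map whose increments factor through a continuous family of linear
maps is continuously differentiable. -/
lemma contDiff_one_of_continuous_slope {E F : Type*} [NormedAddCommGroup E] [NormedSpace ℝ E]
    [NormedAddCommGroup F] [NormedSpace ℝ F] {u : E → F} {S : E × E → E →L[ℝ] F}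
    (hS : Continuous S) (h : ∀ p q, u p - u q = S (p, q) (p - q)) : ContDiff ℝ 1 u := by
  have hd : ∀ q, HasFDerivAt u (S (q, q)) q := by
    intro q
    rw [hasFDerivAt_iff_isLittleO]
    rw [Asymptotics.isLittleO_iff]
    intro c hc
    have h1 : Tendsto (fun p => S (p, q) - S (q, q)) (𝓝 q) (𝓝 0) := by
      have : Continuous fun p => S (p, q) - S (q, q) := by fun_prop
      simpa using this.tendsto q
    filter_upwards [(tendsto_zero_iff_norm_tendsto_zero.1 h1).eventually_lt_const hc] with p hp
    rw [h, ← sub_apply]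
    exact ((S (p, q) - S (q, q)).le_opNorm _).trans (by gcongr)
  refine contDiff_one_iff_fderiv.2 ⟨fun q => (hd q).differentiableAt, ?_⟩
  have : fderiv ℝ u = fun q => S (q, q) := funext fun q => (hd q).fderiv
  rw [this]
  fun_prop

/-- The slope `∫₀¹ ∂ₓG(t, x₂ + θ(x₁ - x₂)) dθ` of `G(t, ·)` between `x₂` and `x₁`, where `G'` stands
for `∂ₓG`. -/
def hadamardSlope (G' : ℝ → ℝ → ℝ) (t x₁ x₂ : ℝ) : ℝ :=
  ∫ θ in (0 : ℝ)..1, G' t (x₂ + θ * (x₁ - x₂))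

lemma continuous_hadamardSlope {G' : ℝ → ℝ → ℝ} (h : Continuous fun q : ℝ × ℝ => G' q.1 q.2) :
    Continuous fun q : ℝ × ℝ × ℝ => hadamardSlope G' q.1 q.2.1 q.2.2 := by
  refine intervalIntegral.continuous_parametric_intervalIntegral_of_continuous'
    (f := fun (q : ℝ × ℝ × ℝ) θ => G' q.1 (q.2.2 + θ * (q.2.1 - q.2.2))) ?_ 0 1
  exact h.comp (f := fun z : (ℝ × ℝ × ℝ) × ℝ => (z.1.1, z.1.2.2 + z.2 * (z.1.2.1 - z.1.2.2)))
    (by fun_prop)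

lemma hadamardSlope_mul {G G' : ℝ → ℝ → ℝ} {t : ℝ} (hG' : Continuous (G' t))
    (h : ∀ x, HasDerivAt (G t) (G' t x) x) (x₁ x₂ : ℝ) :
    G t x₁ - G t x₂ = hadamardSlope G' t x₁ x₂ * (x₁ - x₂) := by
  have hd : ∀ θ ∈ uIcc (0 : ℝ) 1, HasDerivAt (fun θ => G t (x₂ + θ * (x₁ - x₂)))
      (G' t (x₂ + θ * (x₁ - x₂)) * (x₁ - x₂)) θ := by
    intro θ _
    have h1 : HasDerivAt (fun θ : ℝ => x₂ + θ * (x₁ - x₂)) (x₁ - x₂) θ := by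
      simpa using ((hasDerivAt_id θ).mul_const (x₁ - x₂)).const_add x₂
    exact (h _).comp θ h1
  have := intervalIntegral.integral_eq_sub_of_hasDerivAt hd
    (Continuous.intervalIntegrable (by fun_prop) _ _)
  rw [hadamardSlope, ← intervalIntegral.integral_mul_const, this]
  simp

/-- A force field `K(t, x)` that is bounded by `M` and continuously differentiable in `x`, with
`∂ₓK = K'` bounded by `L(t)`. No differentiability in `t` is required. -/
structure IsForce (K K' : ℝ → ℝ → ℝ) (M : ℝ) (L : ℝ → ℝ) : Prop where
  cont : Continuous fun q : ℝ × ℝ => K q.1 q.2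
  cont' : Continuous fun q : ℝ × ℝ => K' q.1 q.2
  hasDerivAt : ∀ t x, HasDerivAt (K t) (K' t x) x
  bound : ∀ t x, |K t x| ≤ M
  bound' : ∀ t x, |K' t x| ≤ L t
  contL : Continuous L

section Characteristics

variable {K K' : ℝ → ℝ → ℝ} {M : ℝ} {L : ℝ → ℝ}

lemma IsForce.lipschitz (h : IsForce K K' M L) (t x₁ x₂ : ℝ) :
    |K t x₁ - K t x₂| ≤ L t * |x₁ - x₂| :=
  convex_univ.norm_image_sub_le_of_norm_hasDerivWithin_le (f := K t)
    (fun x _ => (h.hasDerivAt t x).hasDerivWithinAt) (fun x _ => h.bound' t x)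
    (mem_univ x₂) (mem_univ x₁)

lemma IsForce.L_nonneg (h : IsForce K K' M L) (t : ℝ) : 0 ≤ L t :=
  (abs_nonneg _).trans (h.bound' t 0)

/-- The phase-space vector field `(x, v) ↦ (v, K(t, x))`. -/
def phaseField (K : ℝ → ℝ → ℝ) (t : ℝ) (y : ℝ × ℝ) : ℝ × ℝ := (y.2, K t y.1)

lemma norm_linear_phase_le {a b : ℝ} {y : ℝ × ℝ} (hb : |b| ≤ a * |y.1|) (ha : 0 ≤ a) :
    ‖((y.2, b) : ℝ × ℝ)‖ ≤ (1 + a) * ‖y‖ := by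
  have h1 : |y.1| ≤ ‖y‖ := norm_fst_le y
  have h2 : |y.2| ≤ ‖y‖ := norm_snd_le y
  refine norm_prod_le_iff.2 ⟨?_, ?_⟩
  · simp only [Real.norm_eq_abs]; nlinarith [norm_nonneg y]
  · simp only [Real.norm_eq_abs]; nlinarith [norm_nonneg y]

lemma IsForce.phaseField_lipschitz (h : IsForce K K' M L) (t : ℝ) (y y' : ℝ × ℝ) :
    ‖phaseField K t y - phaseField K t y'‖ ≤ (1 + L t) * ‖y - y'‖ :=
  norm_linear_phase_le (y := y - y') (h.lipschitz t y.1 y'.1) (h.L_nonneg t)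

lemma IsForce.continuous_phaseField (h : IsForce K K' M L) :
    Continuous fun q : ℝ × ℝ × ℝ => phaseField K q.1 q.2 :=
  Continuous.prodMk (by fun_prop) (h.cont.comp (f := fun q : ℝ × ℝ × ℝ => (q.1, q.2.1))
    (by fun_prop))

/-- `Y s (t, z)` is the position at time `t + s` of the characteristic through `z` at time `t`. -/
structure IsCharacteristicFlow (K : ℝ → ℝ → ℝ) (Y : ℝ → ℝ × ℝ × ℝ → ℝ × ℝ) : Prop where
  cont : Continuous fun q : ℝ × ℝ × ℝ × ℝ => Y q.1 q.2
  zero : ∀ p, Y 0 p = p.2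
  hasDerivAt : ∀ s p, HasDerivAt (fun r => Y r p) (phaseField K (p.1 + s) (Y s p)) s

lemma IsForce.exists_characteristicFlow (h : IsForce K K' M L) :
    ∃ Y, IsCharacteristicFlow K Y := by
  obtain ⟨Y, h1, h2, h3⟩ := exists_continuous_ode_solution
    (F := fun s (p : ℝ × ℝ × ℝ) y => phaseField K (p.1 + s) y)
    (l := fun s (p : ℝ × ℝ × ℝ) => 1 + L (p.1 + s)) (y₀ := fun p => p.2)
    (h.continuous_phaseField.comp (f := fun q : ℝ × (ℝ × ℝ × ℝ) × ℝ × ℝ => (q.2.1.1 + q.1, q.2.2))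
      (by fun_prop))
    (continuous_const.add (h.contL.comp (by fun_prop)))
    (fun s p y y' => h.phaseField_lipschitz _ y y') continuous_snd
  exact ⟨Y, h1, h2, h3⟩

variable {Y : ℝ → ℝ × ℝ × ℝ → ℝ × ℝ}

lemma IsCharacteristicFlow.add (hY : IsCharacteristicFlow K Y) (h : IsForce K K' M L)
    (s r t : ℝ) (z : ℝ × ℝ) : Y s (t + r, Y r (t, z)) = Y (s + r) (t, z) := by
  have key := ode_solution_unique_of_continuous_lipschitz
    (F := fun s y => phaseField K (t + r + s) y) (l := fun s => 1 + L (t + r + s))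
    (continuous_const.add (h.contL.comp (by fun_prop)))
    (fun s y y' => h.phaseField_lipschitz _ y y')
    (y := fun s => Y s (t + r, Y r (t, z))) (z := fun s => Y (s + r) (t, z))
    (fun s => hY.hasDerivAt s _) (fun s => by
      have := (hY.hasDerivAt (s + r) (t, z)).comp_add_const s r
      refine this.congr_deriv ?_
      dsimp only
      congr 1
      ring) (s₀ := 0) (by simp [hY.zero])
  exact congrFun key s

/-- Differences of characteristics solve a linear equation with continuous coefficients, hence
depend on the initial points through a continuous matrix. -/
lemma IsCharacteristicFlow.exists_slopes (hY : IsCharacteristicFlow K Y) (h : IsForce K K' M L) :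
    ∃ S₁ S₂ : ℝ × ℝ × (ℝ × ℝ) × (ℝ × ℝ) → ℝ × ℝ, Continuous S₁ ∧ Continuous S₂ ∧
      ∀ s t z₁ z₂, Y s (t, z₁) - Y s (t, z₂) =
        (z₁.1 - z₂.1) • S₁ (s, t, z₁, z₂) + (z₁.2 - z₂.2) • S₂ (s, t, z₁, z₂) := by
  -- `∂ₓK` averaged over the segment between the two characteristics, the coefficient of the linear
  -- equation for their difference
  let a : ℝ → ℝ × (ℝ × ℝ) × (ℝ × ℝ) → ℝ := fun s p =>
    hadamardSlope K' (p.1 + s) (Y s (p.1, p.2.1)).1 (Y s (p.1, p.2.2)).1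
  have ha : Continuous fun q : ℝ × ℝ × (ℝ × ℝ) × (ℝ × ℝ) => a q.1 q.2 := by
    refine (continuous_hadamardSlope h.cont').comp
      (Continuous.prodMk (by fun_prop) (Continuous.prodMk ?_ ?_))
    · exact (hY.cont.comp (f := fun q : ℝ × ℝ × (ℝ × ℝ) × (ℝ × ℝ) => (q.1, q.2.1, q.2.2.1))
        (by fun_prop)).fst
    · exact (hY.cont.comp (f := fun q : ℝ × ℝ × (ℝ × ℝ) × (ℝ × ℝ) => (q.1, q.2.1, q.2.2.2))
        (by fun_prop)).fst
  let F : ℝ → ℝ × (ℝ × ℝ) × (ℝ × ℝ) → ℝ × ℝ → ℝ × ℝ := fun s p y => (y.2, a s p * y.1)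
  have hF : Continuous fun q : ℝ × (ℝ × (ℝ × ℝ) × (ℝ × ℝ)) × ℝ × ℝ => F q.1 q.2.1 q.2.2 := by
    have : Continuous fun q : ℝ × (ℝ × (ℝ × ℝ) × (ℝ × ℝ)) × ℝ × ℝ => a q.1 q.2.1 :=
      ha.comp (f := fun q : ℝ × (ℝ × (ℝ × ℝ) × (ℝ × ℝ)) × ℝ × ℝ => (q.1, q.2.1)) (by fun_prop)
    exact Continuous.prodMk (by fun_prop) (by fun_prop)
  have hl : Continuous fun q : ℝ × ℝ × (ℝ × ℝ) × (ℝ × ℝ) => 1 + |a q.1 q.2| := by fun_prop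
  have hLip : ∀ s p y y', ‖F s p y - F s p y'‖ ≤ (1 + |a s p|) * ‖y - y'‖ := fun s p y y' =>
    norm_linear_phase_le (y := y - y')
      (by rw [show (F s p y).2 - (F s p y').2 = a s p * (y - y').1 by simp [F]; ring, abs_mul])
      (abs_nonneg _)
  obtain ⟨S₁, c₁, i₁, d₁⟩ := exists_continuous_ode_solution hF hl hLip
    (y₀ := fun _ => ((1 : ℝ), (0 : ℝ))) continuous_const
  obtain ⟨S₂, c₂, i₂, d₂⟩ := exists_continuous_ode_solution hF hl hLip
    (y₀ := fun _ => ((0 : ℝ), (1 : ℝ))) continuous_const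
  refine ⟨fun q => S₁ q.1 q.2, fun q => S₂ q.1 q.2, c₁, c₂, fun s t z₁ z₂ => ?_⟩
  have key := ode_solution_unique_of_continuous_lipschitz
    (F := fun s y => F s (t, z₁, z₂) y) (l := fun s => 1 + |a s (t, z₁, z₂)|)
    (hl.comp (f := fun s : ℝ => (s, t, z₁, z₂)) (by fun_prop)) (fun s y y' => hLip s _ y y')
    (y := fun s => Y s (t, z₁) - Y s (t, z₂))
    (z := fun s => (z₁.1 - z₂.1) • S₁ s (t, z₁, z₂) + (z₁.2 - z₂.2) • S₂ s (t, z₁, z₂))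
    (fun s => by
      refine ((hY.hasDerivAt s (t, z₁)).sub (hY.hasDerivAt s (t, z₂))).congr_deriv ?_
      have hc : Continuous (K' (t + s)) :=
        h.cont'.comp (f := fun x : ℝ => (t + s, x)) (by fun_prop)
      refine Prod.ext rfl ?_
      exact hadamardSlope_mul hc (h.hasDerivAt (t + s)) _ _)
    (fun s => by
      refine (((d₁ s (t, z₁, z₂)).const_smul (z₁.1 - z₂.1)).add
        ((d₂ s (t, z₁, z₂)).const_smul (z₁.2 - z₂.2))).congr_deriv ?_
      refine Prod.ext ?_ ?_
      · simp [F]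
      · simp [F]; ring)
    (s₀ := 0) (by
      rw [hY.zero, hY.zero, i₁, i₂]
      ext <;> simp)
  exact congrFun key s

lemma IsCharacteristicFlow.hasDerivAt_backward (hY : IsCharacteristicFlow K Y) (t : ℝ)
    (z : ℝ × ℝ) (σ : ℝ) :
    HasDerivAt (fun σ => Y (-σ) (t, z)) (-phaseField K (t - σ) (Y (-σ) (t, z))) σ := by
  have := (hY.hasDerivAt (-σ) (t, z)).scomp σ (hasDerivAt_neg σ)
  refine this.congr_deriv ?_
  simp [sub_eq_add_neg]

/-- The backward map `(t, z) ↦ Z(0; t, z)` is continuously differentiable in all variables. -/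
lemma IsCharacteristicFlow.contDiff_backward (hY : IsCharacteristicFlow K Y)
    (h : IsForce K K' M L) : ContDiff ℝ 1 fun p : ℝ × ℝ × ℝ => Y (-p.1) p := by
  obtain ⟨S₁, S₂, c₁, c₂, hS⟩ := hY.exists_slopes h
  -- the mean velocity along the characteristic through `p`, between the times `p.1` and `q.1`
  let G : (ℝ × ℝ × ℝ) × (ℝ × ℝ × ℝ) → ℝ × ℝ := fun w =>
    ∫ θ in (0 : ℝ)..1, phaseField K (w.1.1 + θ * (w.2.1 - w.1.1)) (Y (θ * (w.2.1 - w.1.1)) w.1)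
  have hint : Continuous fun q : ((ℝ × ℝ × ℝ) × (ℝ × ℝ × ℝ)) × ℝ =>
      phaseField K (q.1.1.1 + q.2 * (q.1.2.1 - q.1.1.1)) (Y (q.2 * (q.1.2.1 - q.1.1.1)) q.1.1) := by
    refine h.continuous_phaseField.comp (Continuous.prodMk (by fun_prop) ?_)
    exact hY.cont.comp (f := fun q : ((ℝ × ℝ × ℝ) × (ℝ × ℝ × ℝ)) × ℝ =>
      (q.2 * (q.1.2.1 - q.1.1.1), q.1.1)) (by fun_prop)
  have hG : Continuous G :=
    intervalIntegral.continuous_parametric_intervalIntegral_of_continuous'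
      (f := fun (w : (ℝ × ℝ × ℝ) × (ℝ × ℝ × ℝ)) θ =>
        phaseField K (w.1.1 + θ * (w.2.1 - w.1.1)) (Y (θ * (w.2.1 - w.1.1)) w.1)) hint 0 1
  have hGY : ∀ p q : ℝ × ℝ × ℝ, Y (q.1 - p.1) p - p.2 = (q.1 - p.1) • G (p, q) := by
    intro p q
    have hd : ∀ θ ∈ uIcc (0 : ℝ) 1, HasDerivAt (fun θ => Y (θ * (q.1 - p.1)) p)
        ((q.1 - p.1) • phaseField K (p.1 + θ * (q.1 - p.1)) (Y (θ * (q.1 - p.1)) p)) θ := by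
      intro θ _
      exact (hY.hasDerivAt (θ * (q.1 - p.1)) p).scomp θ
        (by simpa using (hasDerivAt_id θ).mul_const (q.1 - p.1))
    have hc : Continuous fun θ : ℝ =>
        phaseField K (p.1 + θ * (q.1 - p.1)) (Y (θ * (q.1 - p.1)) p) :=
      hint.comp (f := fun θ : ℝ => ((p, q), θ)) (by fun_prop)
    have := intervalIntegral.integral_eq_sub_of_hasDerivAt hd
      ((hc.const_smul (q.1 - p.1)).intervalIntegrable _ _)
    rw [intervalIntegral.integral_smul] at this
    simp only [one_mul, zero_mul, hY.zero] at this
    exact this.symm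
  -- the characteristic through `p` is compared at time `q.1` with the one through `q`: the flow
  -- property reduces an increment in time to an increment in phase space
  let W : (ℝ × ℝ × ℝ) × (ℝ × ℝ × ℝ) → ℝ × ℝ × (ℝ × ℝ) × (ℝ × ℝ) := fun w =>
    (-w.2.1, w.2.1, Y (w.2.1 - w.1.1) w.1, w.2.2)
  have hW : Continuous W := by
    refine Continuous.prodMk (by fun_prop) (Continuous.prodMk (by fun_prop)
      (Continuous.prodMk ?_ (by fun_prop)))
    exact hY.cont.comp (f := fun w : (ℝ × ℝ × ℝ) × (ℝ × ℝ × ℝ) => (w.2.1 - w.1.1, w.1))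
      (by fun_prop)
  let R := ContinuousLinearMap.smulRightL ℝ (ℝ × ℝ × ℝ) (ℝ × ℝ)
  let π₀ : ℝ × ℝ × ℝ →L[ℝ] ℝ := ContinuousLinearMap.fst ℝ ℝ (ℝ × ℝ)
  let π₁ : ℝ × ℝ × ℝ →L[ℝ] ℝ :=
    (ContinuousLinearMap.fst ℝ ℝ ℝ).comp (ContinuousLinearMap.snd ℝ ℝ (ℝ × ℝ))
  let π₂ : ℝ × ℝ × ℝ →L[ℝ] ℝ :=
    (ContinuousLinearMap.snd ℝ ℝ ℝ).comp (ContinuousLinearMap.snd ℝ ℝ (ℝ × ℝ))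
  refine contDiff_one_of_continuous_slope (S := fun w =>
    R π₀ (-((G w).1 • S₁ (W w) + (G w).2 • S₂ (W w))) + R π₁ (S₁ (W w)) + R π₂ (S₂ (W w))) ?_ ?_
  · have h1 : Continuous fun w => S₁ (W w) := c₁.comp hW
    have h2 : Continuous fun w => S₂ (W w) := c₂.comp hW
    fun_prop
  · intro p q
    have e1 : Y (-p.1) p = Y (-q.1) (q.1, Y (q.1 - p.1) p) := by
      have := hY.add h (-q.1) (q.1 - p.1) p.1 p.2
      simp only [add_sub_cancel] at this
      rw [this]
      congr 1
      ring
    have e2 := hS (-q.1) q.1 (Y (q.1 - p.1) p) q.2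
    have e3 := hGY p q
    have e4 : Y (q.1 - p.1) p = p.2 + (q.1 - p.1) • G (p, q) := by rw [← e3]; abel
    rw [e1, show Y (-q.1) q = Y (-q.1) (q.1, q.2) from rfl, e2]
    change _ • S₁ (W (p, q)) + _ • S₂ (W (p, q)) = _
    rw [e4]
    simp only [R, π₀, π₁, π₂, add_apply,
      ContinuousLinearMap.smulRightL_apply_apply, ContinuousLinearMap.smulRight_apply,
      ContinuousLinearMap.comp_apply, ContinuousLinearMap.coe_fst', ContinuousLinearMap.coe_snd',
      Prod.fst_sub, Prod.snd_sub, Prod.fst_add, Prod.snd_add, Prod.smul_fst, Prod.smul_snd,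
      smul_eq_mul]
    module

lemma hasDerivAt_fst_comp {y : ℝ → ℝ × ℝ} {y' : ℝ × ℝ} {s : ℝ} (h : HasDerivAt y y' s) :
    HasDerivAt (fun r => (y r).1) y'.1 s :=
  (ContinuousLinearMap.fst ℝ ℝ ℝ).hasFDerivAt.comp_hasDerivAt s h

lemma hasDerivAt_snd_comp {y : ℝ → ℝ × ℝ} {y' : ℝ × ℝ} {s : ℝ} (h : HasDerivAt y y' s) :
    HasDerivAt (fun r => (y r).2) y'.2 s :=
  (ContinuousLinearMap.snd ℝ ℝ ℝ).hasFDerivAt.comp_hasDerivAt s h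

/-- The properties of the map `Φ(t, z)` that follows the characteristics of `(v, K(t, x))` from
time `t` back to time `0`. -/
structure IsBackwardFlow (K : ℝ → ℝ → ℝ) (M : ℝ) (L : ℝ → ℝ) (Φ : ℝ × ℝ × ℝ → ℝ × ℝ) : Prop where
  contDiff : ContDiff ℝ 1 Φ
  zero : ∀ z, Φ (0, z) = z
  transport : ∀ t x v, fderiv ℝ Φ (t, x, v) (1, v, K t x) = 0
  velocity : ∀ t x v, |(Φ (t, x, v)).2 - v| ≤ M * |t|
  position : ∀ t x v, |(Φ (t, x, v)).1 - x| ≤ (|v| + M * |t|) * |t|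
  lipschitz : ∀ T Λ : ℝ, (∀ t ∈ Icc 0 T, 1 + L t ≤ Λ) → ∀ t ∈ Icc 0 T, ∀ z z',
    dist (Φ (t, z)) (Φ (t, z')) ≤ dist z z' * Real.exp (Λ * t)

theorem IsForce.exists_backwardFlow (h : IsForce K K' M L) : ∃ Φ, IsBackwardFlow K M L Φ := by
  obtain ⟨Y, hY⟩ := h.exists_characteristicFlow
  have hM : 0 ≤ M := (abs_nonneg _).trans (h.bound 0 0)
  have hC := hY.contDiff_backward h
  have hvel : ∀ s t x v, |(Y s (t, x, v)).2 - v| ≤ M * |s| := by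
    intro s t x v
    have := convex_univ.norm_image_sub_le_of_norm_hasDerivWithin_le
      (f := fun s => (Y s (t, x, v)).2) (C := M)
      (fun r _ => (hasDerivAt_snd_comp (hY.hasDerivAt r (t, x, v))).hasDerivWithinAt)
      (fun r _ => h.bound _ _) (mem_univ 0) (mem_univ s)
    simpa [hY.zero] using this
  refine ⟨fun p => Y (-p.1) p, hC, fun z => by simp [hY.zero], ?_, ?_, ?_, ?_⟩
  · intro t x v
    have h1 : HasDerivAt (fun s : ℝ => (t + s, Y s (t, x, v))) ((1 : ℝ), v, K t x) 0 := by
      have h2 := hY.hasDerivAt 0 (t, x, v)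
      simp only [hY.zero, phaseField, add_zero] at h2
      exact ((hasDerivAt_id (0 : ℝ)).const_add t).prodMk h2
    have h3 : HasFDerivAt (fun p : ℝ × ℝ × ℝ => Y (-p.1) p)
        (fderiv ℝ (fun p : ℝ × ℝ × ℝ => Y (-p.1) p) (t, x, v))
        ((fun s : ℝ => (t + s, Y s (t, x, v))) 0) := by
      simp only [add_zero, hY.zero]
      exact (hC.differentiable one_ne_zero _).hasFDerivAt
    have h4 := h3.comp_hasDerivAt 0 h1
    have h5 : (fun p : ℝ × ℝ × ℝ => Y (-p.1) p) ∘ (fun s : ℝ => (t + s, Y s (t, x, v))) =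
        fun _ => Y (-t) (t, x, v) := by
      funext s
      simp only [Function.comp_apply]
      rw [hY.add h (-(t + s)) s t (x, v)]
      congr 1
      ring
    rw [h5] at h4
    exact h4.unique (hasDerivAt_const _ _)
  · intro t x v
    simpa using hvel (-t) t x v
  · intro t x v
    have := (convex_uIcc 0 (-t)).norm_image_sub_le_of_norm_hasDerivWithin_le
      (f := fun s => (Y s (t, x, v)).1) (C := |v| + M * |t|)
      (fun r _ => (hasDerivAt_fst_comp (hY.hasDerivAt r (t, x, v))).hasDerivWithinAt)
      (fun r hr => by
        have h1 := hvel r t x v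
        have h2 : |r| ≤ |t| := by
          have := abs_sub_left_of_mem_uIcc hr
          simpa using this
        have h3 : |(Y r (t, x, v)).2| ≤ |v| + |(Y r (t, x, v)).2 - v| := by
          have := abs_add_le v ((Y r (t, x, v)).2 - v)
          simpa using this
        have h4 : M * |r| ≤ M * |t| := by gcongr
        simp only [phaseField, Real.norm_eq_abs]
        linarith) left_mem_uIcc right_mem_uIcc
    simpa [hY.zero] using this
  · intro T Λ hΛ t ht z z'
    have := dist_le_of_trajectories_ODE_of_mem (K := Λ.toNNReal) (s := fun _ => univ)
      (v := fun σ y => -phaseField K (t - σ) y) (f := fun σ => Y (-σ) (t, z))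
      (g := fun σ => Y (-σ) (t, z')) (a := 0) (b := t) (δ := dist z z')
      (fun σ hσ => LipschitzOnWith.of_dist_le_mul fun y _ y' _ => by
        rw [dist_neg_neg, dist_eq_norm, dist_eq_norm]
        refine (h.phaseField_lipschitz _ y y').trans (mul_le_mul_of_nonneg_right ?_ (norm_nonneg _))
        exact (hΛ _ ⟨by linarith [hσ.2], by linarith [hσ.1, ht.2]⟩).trans (Real.le_coe_toNNReal _))
      (fun σ _ => (hY.hasDerivAt_backward t z σ).continuousAt.continuousWithinAt)
      (fun σ _ => (hY.hasDerivAt_backward t z σ).hasDerivWithinAt) (fun _ _ => trivial)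
      (fun σ _ => (hY.hasDerivAt_backward t z' σ).continuousAt.continuousWithinAt)
      (fun σ _ => (hY.hasDerivAt_backward t z' σ).hasDerivWithinAt) (fun _ _ => trivial)
      (by simp [hY.zero]) t ⟨ht.1, le_rfl⟩
    have hΛ0 : 0 ≤ Λ := by linarith [hΛ t ht, h.L_nonneg t]
    simpa [Real.coe_toNNReal _ hΛ0] using this

end Characteristics

/-! ### Integrals with locally uniform compact support -/

/-- `g(x, ·)` has compact support, locally uniformly in the parameter `x`. -/
def HasLocallyCompactSupport {X Y : Type*} [TopologicalSpace X] [TopologicalSpace Y]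
    (g : X → Y → ℝ) : Prop :=
  ∀ x₀, ∃ U ∈ 𝓝 x₀, ∃ k : Set Y, IsCompact k ∧ ∀ x ∈ U, ∀ y ∉ k, g x y = 0

section Parametric

variable {X Y : Type*} [TopologicalSpace X] [TopologicalSpace Y] [MeasurableSpace Y]
  [BorelSpace Y] {μ : Measure Y} [IsFiniteMeasureOnCompacts μ]

lemma HasLocallyCompactSupport.integrable [T2Space Y] {g : X → Y → ℝ}
    (hs : HasLocallyCompactSupport g) (x : X) (hg : Continuous (g x)) : Integrable (g x) μ := by
  obtain ⟨U, hU, k, hk, h⟩ := hs x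
  exact hg.integrable_of_hasCompactSupport
    (HasCompactSupport.intro hk fun y hy => h x (mem_of_mem_nhds hU) y hy)

lemma HasLocallyCompactSupport.continuous_integral {g : X → Y → ℝ}
    (hs : HasLocallyCompactSupport g) (hg : Continuous fun q : X × Y => g q.1 q.2) :
    Continuous fun x => ∫ y, g x y ∂μ := by
  rw [continuous_iff_continuousAt]
  intro x
  obtain ⟨U, hU, k, hk, h⟩ := hs x
  exact (continuousOn_integral_of_compact_support hk (f := g) (s := U) hg.continuousOn
    fun p y hp hy => h p hp y hy).continuousAt hU

lemma HasLocallyCompactSupport.hasDerivAt_integral [T2Space Y] [SecondCountableTopology Y]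
    {g g' : ℝ → Y → ℝ}
    (hs : HasLocallyCompactSupport g) (hg : Continuous fun q : ℝ × Y => g q.1 q.2)
    (hg' : Continuous fun q : ℝ × Y => g' q.1 q.2)
    (hd : ∀ s y, HasDerivAt (fun r => g r y) (g' s y) s) (s : ℝ) :
    HasDerivAt (fun r => ∫ y, g r y ∂μ) (∫ y, g' s y ∂μ) s := by
  obtain ⟨U, hU, k, hk, h⟩ := hs s
  obtain ⟨ε, hε, hball⟩ := Metric.mem_nhds_iff.1 hU
  have hsub : Metric.closedBall s (ε / 2) ⊆ Metric.ball s ε :=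
    Metric.closedBall_subset_ball (by linarith)
  have hzero : ∀ r ∈ Metric.ball s ε, ∀ y ∉ k, g' r y = 0 := by
    intro r hr y hy
    have h1 : (fun r => g r y) =ᶠ[𝓝 r] fun _ => 0 := by
      filter_upwards [Metric.isOpen_ball.mem_nhds hr] with r' hr'
      exact h r' (hball hr') y hy
    exact (hd r y).unique ((hasDerivAt_const r (0 : ℝ)).congr_of_eventuallyEq h1)
  obtain ⟨C, hC⟩ := ((isCompact_closedBall s (ε / 2)).prod hk).exists_bound_of_continuousOn
    hg'.continuousOn
  refine (hasDerivAt_integral_of_dominated_loc_of_deriv_le (F := g) (F' := g')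
    (bound := k.indicator fun _ => C) (s := Metric.closedBall s (ε / 2))
    (Metric.closedBall_mem_nhds s (by linarith))
    (Eventually.of_forall fun r => Continuous.aestronglyMeasurable (by fun_prop))
    (hs.integrable s (by fun_prop)) (Continuous.aestronglyMeasurable (by fun_prop))
    (ae_of_all _ fun y r hr => ?_) ?_ (ae_of_all _ fun y r _ => hd r y)).2
  · by_cases hy : y ∈ k
    · rw [indicator_of_mem hy]
      exact hC (r, y) ⟨hr, hy⟩
    · rw [indicator_of_notMem hy, hzero r (hsub hr) y hy, norm_zero]
  · rw [integrable_indicator_iff hk.measurableSet]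
    exact integrableOn_const hk.measure_lt_top.ne

end Parametric

/-- Continuous partial derivatives make a function `C¹`: the increment is split along a path parallel
to the axes, and each part is a Hadamard slope. -/
lemma contDiff_one_of_continuous_partials {G Gt Gx : ℝ → ℝ → ℝ}
    (ht : Continuous fun q : ℝ × ℝ => Gt q.1 q.2) (hx : Continuous fun q : ℝ × ℝ => Gx q.1 q.2)
    (dt : ∀ t x, HasDerivAt (fun s => G s x) (Gt t x) t)
    (dx : ∀ t x, HasDerivAt (G t) (Gx t x) x) :
    ContDiff ℝ 1 fun q : ℝ × ℝ => G q.1 q.2 := by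
  let R := ContinuousLinearMap.smulRightL ℝ (ℝ × ℝ) ℝ
  refine contDiff_one_of_continuous_slope (S := fun w =>
    R (ContinuousLinearMap.fst ℝ ℝ ℝ) (hadamardSlope (fun x t => Gt t x) w.2.2 w.1.1 w.2.1) +
      R (ContinuousLinearMap.snd ℝ ℝ ℝ) (hadamardSlope Gx w.1.1 w.1.2 w.2.2)) ?_ ?_
  · have h1 : Continuous fun w : (ℝ × ℝ) × (ℝ × ℝ) =>
        hadamardSlope (fun x t => Gt t x) w.2.2 w.1.1 w.2.1 :=
      (continuous_hadamardSlope (G' := fun x t => Gt t x) (ht.comp continuous_swap)).comp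
        (f := fun w : (ℝ × ℝ) × (ℝ × ℝ) => (w.2.2, w.1.1, w.2.1)) (by fun_prop)
    have h2 : Continuous fun w : (ℝ × ℝ) × (ℝ × ℝ) => hadamardSlope Gx w.1.1 w.1.2 w.2.2 :=
      (continuous_hadamardSlope hx).comp
        (f := fun w : (ℝ × ℝ) × (ℝ × ℝ) => (w.1.1, w.1.2, w.2.2)) (by fun_prop)
    fun_prop
  · rintro ⟨t₁, x₁⟩ ⟨t₂, x₂⟩
    have c1 : Continuous (Gx t₁) := hx.comp (f := fun x : ℝ => (t₁, x)) (by fun_prop)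
    have c2 : Continuous fun t => Gt t x₂ := ht.comp (f := fun t : ℝ => (t, x₂)) (by fun_prop)
    have e1 := hadamardSlope_mul c1 (dx t₁) x₁ x₂
    have e2 := hadamardSlope_mul (G := fun x t => G t x) (G' := fun x t => Gt t x) c2
      (fun t => dt t x₂) t₁ t₂
    simp only [R, add_apply, ContinuousLinearMap.smulRightL_apply_apply,
      ContinuousLinearMap.smulRight_apply, ContinuousLinearMap.coe_fst',
      ContinuousLinearMap.coe_snd', Prod.fst_sub, Prod.snd_sub, smul_eq_mul]
    linarith

/-! ### Charge, current and electric field of a confined density -/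

/-- At time `t`, the density `f` is supported in the cube of half-width `r(t)` in phase space. -/
def IsConfined (r : ℝ → ℝ) (f : ℝ → ℝ → ℝ → ℝ → ℝ) : Prop :=
  ∀ t x v₁ v₂, f t x v₁ v₂ ≠ 0 → |x| ≤ r t ∧ |v₁| ≤ r t ∧ |v₂| ≤ r t

/-- Joint continuity of a density in `(t, x, v₁, v₂)`. -/
def IsContDensity (f : ℝ → ℝ → ℝ → ℝ → ℝ) : Prop :=
  Continuous fun p : ℝ × ℝ × ℝ × ℝ => f p.1 p.2.1 p.2.2.1 p.2.2.2

/-- The background `b` is supported in `[-r(t), r(t)]` for all `t`. -/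
def IsConfinedBackground (r : ℝ → ℝ) (b : ℝ → ℝ) : Prop := ∀ t y, b y ≠ 0 → |y| ≤ r t

/-- The field `∫_{-∞}^x ρ(t, y) dy`, which solves `∂ₓE = ρ` and vanishes at `-∞`. -/
def efield (b : ℝ → ℝ) (f : ℝ → ℝ → ℝ → ℝ → ℝ) (t x : ℝ) : ℝ :=
  ∫ y in Iic x, chargeDensity b f t y

section Confined

variable {r : ℝ → ℝ} {b : ℝ → ℝ} {f g : ℝ → ℝ → ℝ → ℝ → ℝ}

lemma notMem_closedBall_prod {v : ℝ × ℝ} {R : ℝ} (h : v ∉ Metric.closedBall (0 : ℝ × ℝ) R) :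
    ¬(|v.1| ≤ R ∧ |v.2| ≤ R) := by
  intro h'
  apply h
  rw [mem_closedBall_zero_iff]
  exact norm_prod_le_iff.2 h'

lemma IsConfined.locallyCompactSupport (hf : IsConfined r f) (hr : Continuous r)
    (w : ℝ × ℝ → ℝ) :
    HasLocallyCompactSupport fun (q : ℝ × ℝ) (v : ℝ × ℝ) => w v * f q.1 q.2 v.1 v.2 := by
  intro q
  refine ⟨{p | r p.1 < r q.1 + 1}, (hr.comp continuous_fst).continuousAt.eventually_lt
    continuousAt_const (by simp), Metric.closedBall 0 (r q.1 + 1), isCompact_closedBall _ _, ?_⟩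
  intro p hp v hv
  by_contra hne
  have := hf _ _ _ _ (right_ne_zero_of_mul hne)
  have hp' : r p.1 < r q.1 + 1 := hp
  exact notMem_closedBall_prod hv ⟨by linarith, by linarith⟩

lemma HasLocallyCompactSupport.comp {X X' Y : Type*} [TopologicalSpace X] [TopologicalSpace X']
    [TopologicalSpace Y] {g : X → Y → ℝ} (h : HasLocallyCompactSupport g) {φ : X' → X}
    (hφ : Continuous φ) : HasLocallyCompactSupport fun x y => g (φ x) y := by
  intro x
  obtain ⟨U, hU, k, hk, h⟩ := h (φ x)
  exact ⟨φ ⁻¹' U, hφ.continuousAt hU, k, hk, fun x hx y hy => h _ hx y hy⟩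

lemma IsConfined.locallyCompactSupport_one (hf : IsConfined r f) (hr : Continuous r) :
    HasLocallyCompactSupport fun (q : ℝ × ℝ) (v : ℝ × ℝ) => f q.1 q.2 v.1 v.2 := by
  simpa using hf.locallyCompactSupport hr fun _ => 1

lemma IsContDensity.comp {X : Type*} [TopologicalSpace X] (hc : IsContDensity f)
    {φ₀ φ₁ φ₂ φ₃ : X → ℝ} (h₀ : Continuous φ₀) (h₁ : Continuous φ₁) (h₂ : Continuous φ₂)
    (h₃ : Continuous φ₃) : Continuous fun x => f (φ₀ x) (φ₁ x) (φ₂ x) (φ₃ x) :=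
  Continuous.comp (g := fun p : ℝ × ℝ × ℝ × ℝ => f p.1 p.2.1 p.2.2.1 p.2.2.2) hc
    (h₀.prodMk (h₁.prodMk (h₂.prodMk h₃)))

lemma continuous_chargeDensity (hb : Continuous b) (hr : Continuous r) (hf : IsConfined r f)
    (hc : IsContDensity f) : Continuous fun q : ℝ × ℝ => chargeDensity b f q.1 q.2 :=
  ((hf.locallyCompactSupport_one hr).continuous_integral
    (hc.comp (by fun_prop) (by fun_prop) (by fun_prop) (by fun_prop))).sub (hb.comp continuous_snd)

lemma continuous_current₁ (hr : Continuous r) (hf : IsConfined r f) (hc : IsContDensity f) :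
    Continuous fun q : ℝ × ℝ => current₁ f q.1 q.2 :=
  (hf.locallyCompactSupport hr fun v => v.1).continuous_integral
    (Continuous.mul (by fun_prop)
      (hc.comp (by fun_prop) (by fun_prop) (by fun_prop) (by fun_prop)))

lemma IsConfined.eq_zero (hf : IsConfined r f) {t x v₁ v₂ : ℝ} (h : r t < |x|) :
    f t x v₁ v₂ = 0 := by
  by_contra hne
  exact absurd (hf _ _ _ _ hne).1 (not_le.2 h)

lemma chargeDensity_eq_zero (hf : IsConfined r f) (hb : IsConfinedBackground r b) {t x : ℝ}
    (h : r t < |x|) : chargeDensity b f t x = 0 := by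
  have : b x = 0 := by
    by_contra hne
    exact absurd (hb t x hne) (not_le.2 h)
  simp [chargeDensity, hf.eq_zero h, this]

lemma current₁_eq_zero (hf : IsConfined r f) {t x : ℝ} (h : r t < |x|) : current₁ f t x = 0 := by
  simp [current₁, hf.eq_zero h]

lemma integrable_chargeDensity (hbc : Continuous b) (hb : IsConfinedBackground r b)
    (hr : Continuous r) (hf : IsConfined r f) (hc : IsContDensity f) (t : ℝ) :
    Integrable (chargeDensity b f t) := by
  have h1 : Continuous (chargeDensity b f t) :=
    (continuous_chargeDensity hbc hr hf hc).comp (f := fun x : ℝ => (t, x)) (by fun_prop)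
  refine h1.integrable_of_hasCompactSupport
    (HasCompactSupport.intro (isCompact_Icc (a := -r t) (b := r t)) fun x hx => ?_)
  refine chargeDensity_eq_zero hf hb ?_
  by_contra h
  exact hx (abs_le.1 (not_lt.1 h))

lemma efield_eq_intervalIntegral (hbc : Continuous b) (hb : IsConfinedBackground r b)
    (hr : Continuous r) (hf : IsConfined r f) (hc : IsContDensity f) {t N : ℝ} (hN : r t < N)
    (x : ℝ) : efield b f t x = ∫ y in (-N)..x, chargeDensity b f t y := by
  have hi := integrable_chargeDensity hbc hb hr hf hc t
  have h0 : ∫ y in Iic (-N), chargeDensity b f t y = 0 := by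
    refine setIntegral_eq_zero_of_forall_eq_zero fun y hy => chargeDensity_eq_zero hf hb ?_
    have : -y ≤ |y| := neg_le_abs y
    have : y ≤ -N := hy
    linarith
  have := intervalIntegral.integral_Iic_sub_Iic (hi.integrableOn (s := Iic (-N)))
    (hi.integrableOn (s := Iic x))
  rw [h0, sub_zero] at this
  exact this

lemma continuous_efield (hbc : Continuous b) (hb : IsConfinedBackground r b)
    (hr : Continuous r) (hf : IsConfined r f) (hc : IsContDensity f) :
    Continuous fun q : ℝ × ℝ => efield b f q.1 q.2 := by
  rw [continuous_iff_continuousAt]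
  intro q
  have h1 : Continuous fun p : ℝ × ℝ => ∫ y in (-(r q.1 + 1))..p.2, chargeDensity b f p.1 y :=
    intervalIntegral.continuous_parametric_intervalIntegral_of_continuous
      (f := fun (p : ℝ × ℝ) y => chargeDensity b f p.1 y)
      ((continuous_chargeDensity hbc hr hf hc).comp
        (f := fun z : (ℝ × ℝ) × ℝ => (z.1.1, z.2)) (by fun_prop)) continuous_snd
  refine h1.continuousAt.congr ?_
  filter_upwards [(hr.comp continuous_fst).continuousAt.eventually_lt
    (continuousAt_const (y := r q.1 + 1)) (by simp)] with p hp
  exact (efield_eq_intervalIntegral hbc hb hr hf hc hp p.2).symm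

lemma hasDerivAt_efield (hbc : Continuous b) (hb : IsConfinedBackground r b)
    (hr : Continuous r) (hf : IsConfined r f) (hc : IsContDensity f) (t x : ℝ) :
    HasDerivAt (efield b f t) (chargeDensity b f t x) x := by
  have h1 : Continuous (chargeDensity b f t) :=
    (continuous_chargeDensity hbc hr hf hc).comp (f := fun x : ℝ => (t, x)) (by fun_prop)
  have h2 := intervalIntegral.integral_hasDerivAt_right (h1.intervalIntegrable (-(r t + 1)) x)
    (h1.stronglyMeasurableAtFilter _ _) h1.continuousAt
  exact h2.congr_of_eventuallyEq (Eventually.of_forall fun y =>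
    efield_eq_intervalIntegral hbc hb hr hf hc (by linarith) y)

lemma abs_integral_prod_le {h : ℝ × ℝ → ℝ} {R c : ℝ} (hR : 0 ≤ R)
    (hs : ∀ v, h v ≠ 0 → |v.1| ≤ R ∧ |v.2| ≤ R) (hc : ∀ v, |h v| ≤ c) :
    |∫ v, h v| ≤ c * (2 * R) ^ 2 := by
  have h1 : ∫ v in Metric.closedBall (0 : ℝ × ℝ) R, h v = ∫ v, h v :=
    setIntegral_eq_integral_of_forall_compl_eq_zero fun v hv => by
      by_contra hne
      exact notMem_closedBall_prod hv (hs v hne)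
  have h2 : volume.real (Metric.closedBall (0 : ℝ × ℝ) R) = (2 * R) ^ 2 := by
    rw [show (0 : ℝ × ℝ) = (0, 0) from rfl, ← closedBall_prod_same, Measure.volume_eq_prod,
      measureReal_prod_prod, Real.volume_real_closedBall hR]
    ring
  rw [← h1, ← h2, ← Real.norm_eq_abs]
  exact norm_setIntegral_le_of_norm_le_const (isCompact_closedBall _ _).measure_lt_top
    fun v _ => hc v

lemma abs_setIntegral_Iic_le {h : ℝ → ℝ} {R c x : ℝ} (hR : 0 ≤ R) (hc0 : 0 ≤ c)
    (hs : ∀ y, R < |y| → h y = 0) (hc : ∀ y, |h y| ≤ c) :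
    |∫ y in Iic x, h y| ≤ c * (2 * R) := by
  have h1 : ∫ y in Iic x ∩ Icc (-R) R, h y = ∫ y in Iic x, h y := by
    refine (setIntegral_eq_of_subset_of_forall_sdiff_eq_zero measurableSet_Iic inter_subset_left
      fun y hy => hs y ?_).symm
    by_contra hn
    exact hy.2 ⟨hy.1, abs_le.1 (not_lt.1 hn)⟩
  have hfin : volume (Icc (-R) R) < ⊤ := isCompact_Icc.measure_lt_top
  have h2 : volume.real (Iic x ∩ Icc (-R) R) ≤ 2 * R := by
    refine (measureReal_mono inter_subset_right hfin.ne).trans ?_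
    rw [Real.volume_real_Icc_of_le (by linarith)]
    linarith
  rw [← h1, ← Real.norm_eq_abs]
  refine (norm_setIntegral_le_of_norm_le_const
    ((measure_mono inter_subset_right).trans_lt hfin) fun y _ => hc y).trans ?_
  gcongr

lemma abs_chargeDensity_le (hr0 : ∀ t, 0 ≤ r t) (hf : IsConfined r f) {t A Bb : ℝ}
    (hA : ∀ x v₁ v₂, |f t x v₁ v₂| ≤ A) (hB : ∀ x, |b x| ≤ Bb) (x : ℝ) :
    |chargeDensity b f t x| ≤ A * (2 * r t) ^ 2 + Bb :=
  (abs_sub _ _).trans (add_le_add (abs_integral_prod_le (hr0 t) (fun _ hv => (hf _ _ _ _ hv).2)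
    fun _ => hA _ _ _) (hB x))

lemma abs_chargeDensity_sub_le (hr : Continuous r) (hr0 : ∀ t, 0 ≤ r t) (hf : IsConfined r f)
    (hg : IsConfined r g) (hfc : IsContDensity f) (hgc : IsContDensity g) {t β : ℝ}
    (h : ∀ x v₁ v₂, |f t x v₁ v₂ - g t x v₁ v₂| ≤ β) (x : ℝ) :
    |chargeDensity b f t x - chargeDensity b g t x| ≤ β * (2 * r t) ^ 2 := by
  have hi : ∀ {f}, IsConfined r f → IsContDensity f →
      Integrable fun v : ℝ × ℝ => f t x v.1 v.2 := fun hf hc =>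
    (hf.locallyCompactSupport_one hr).integrable (t, x)
      (hc.comp (by fun_prop) (by fun_prop) (by fun_prop) (by fun_prop))
  rw [chargeDensity, chargeDensity, sub_sub_sub_cancel_right,
    ← integral_sub (hi hf hfc) (hi hg hgc)]
  refine abs_integral_prod_le (hr0 t) (fun v hv => ?_) fun v => h _ _ _
  by_cases h1 : f t x v.1 v.2 = 0
  · exact (hg t x v.1 v.2 fun h2 => hv (by rw [h1, h2, sub_zero])).2
  · exact (hf _ _ _ _ h1).2

lemma abs_efield_sub_le (hbc : Continuous b) (hb : IsConfinedBackground r b)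
    (hr : Continuous r) (hr0 : ∀ t, 0 ≤ r t) (hf : IsConfined r f)
    (hg : IsConfined r g) (hfc : IsContDensity f) (hgc : IsContDensity g) {t β : ℝ}
    (h : ∀ x v₁ v₂, |f t x v₁ v₂ - g t x v₁ v₂| ≤ β) (x : ℝ) :
    |efield b f t x - efield b g t x| ≤ β * (2 * r t) ^ 3 := by
  have hβ : 0 ≤ β := (abs_nonneg _).trans (h 0 0 0)
  rw [efield, efield, ← integral_sub (integrable_chargeDensity hbc hb hr hf hfc t).integrableOn
    (integrable_chargeDensity hbc hb hr hg hgc t).integrableOn]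
  refine (abs_setIntegral_Iic_le (c := β * (2 * r t) ^ 2) (hr0 t) (by positivity)
    (fun y hy => ?_) fun y => abs_chargeDensity_sub_le hr hr0 hf hg hfc hgc h y).trans
    (le_of_eq (by ring))
  rw [chargeDensity_eq_zero hf hb hy, chargeDensity_eq_zero hg hb hy, sub_zero]

/-! ### Conservation of charge -/

/-- A `C¹` density transported by the phase-space field `(v₁, K(t, x))`, with `v₂` as a parameter. -/
structure IsTransported (K : ℝ → ℝ → ℝ) (f : ℝ → ℝ → ℝ → ℝ → ℝ) : Prop where
  contDiff : ContDiff ℝ 1 fun p : ℝ × ℝ × ℝ × ℝ => f p.1 p.2.1 p.2.2.1 p.2.2.2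
  vlasov : ∀ t x v₁ v₂, fderiv ℝ (fun p : ℝ × ℝ × ℝ × ℝ => f p.1 p.2.1 p.2.2.1 p.2.2.2)
    (t, x, v₁, v₂) (1, v₁, K t x, 0) = 0

/-- The derivative of `f` at `(t, x, v₁, v₂)` in the direction `d`. -/
def dirDeriv (f : ℝ → ℝ → ℝ → ℝ → ℝ) (d : ℝ × ℝ × ℝ × ℝ) (t x v₁ v₂ : ℝ) : ℝ :=
  fderiv ℝ (fun p : ℝ × ℝ × ℝ × ℝ => f p.1 p.2.1 p.2.2.1 p.2.2.2) (t, x, v₁, v₂) d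

variable {K : ℝ → ℝ → ℝ}

lemma IsTransported.isContDensity (h : IsTransported K f) : IsContDensity f :=
  h.contDiff.continuous

lemma IsTransported.isContDensity_dirDeriv (h : IsTransported K f) (d : ℝ × ℝ × ℝ × ℝ) :
    IsContDensity (dirDeriv f d) :=
  (h.contDiff.continuous_fderiv one_ne_zero).clm_apply continuous_const

lemma IsTransported.hasDerivAt (h : IsTransported K f) (d : ℝ × ℝ × ℝ × ℝ) (t x v₁ v₂ s : ℝ) :
    HasDerivAt (fun s => f (t + s * d.1) (x + s * d.2.1) (v₁ + s * d.2.2.1) (v₂ + s * d.2.2.2))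
      (dirDeriv f d (t + s * d.1) (x + s * d.2.1) (v₁ + s * d.2.2.1) (v₂ + s * d.2.2.2)) s := by
  have h1 : ∀ a c : ℝ, HasDerivAt (fun s : ℝ => a + s * c) c s := fun a c => by
    simpa using ((hasDerivAt_id s).mul_const c).const_add a
  have h2 := (h1 t d.1).prodMk ((h1 x d.2.1).prodMk ((h1 v₁ d.2.2.1).prodMk (h1 v₂ d.2.2.2)))
  exact (h.contDiff.differentiable one_ne_zero _).hasFDerivAt.comp_hasDerivAt s h2

lemma IsTransported.hasDerivAt_t (h : IsTransported K f) (t x v₁ v₂ : ℝ) :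
    HasDerivAt (fun s => f s x v₁ v₂) (dirDeriv f (1, 0, 0, 0) t x v₁ v₂) t := by
  simpa using h.hasDerivAt (1, 0, 0, 0) 0 x v₁ v₂ t

lemma IsTransported.hasDerivAt_x (h : IsTransported K f) (t x v₁ v₂ : ℝ) :
    HasDerivAt (fun y => f t y v₁ v₂) (dirDeriv f (0, 1, 0, 0) t x v₁ v₂) x := by
  simpa using h.hasDerivAt (0, 1, 0, 0) t 0 v₁ v₂ x

lemma IsTransported.hasDerivAt_v₁ (h : IsTransported K f) (t x v₁ v₂ : ℝ) :
    HasDerivAt (fun w => f t x w v₂) (dirDeriv f (0, 0, 1, 0) t x v₁ v₂) v₁ := by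
  simpa using h.hasDerivAt (0, 0, 1, 0) t x 0 v₂ v₁

lemma IsTransported.vlasov' (h : IsTransported K f) (t x v₁ v₂ : ℝ) :
    dirDeriv f (1, 0, 0, 0) t x v₁ v₂ + v₁ * dirDeriv f (0, 1, 0, 0) t x v₁ v₂ +
      K t x * dirDeriv f (0, 0, 1, 0) t x v₁ v₂ = 0 := by
  have h1 := h.vlasov t x v₁ v₂
  have h2 : ((1, v₁, K t x, 0) : ℝ × ℝ × ℝ × ℝ) = (1, 0, 0, 0) + v₁ • (0, 1, 0, 0) +
      K t x • (0, 0, 1, 0) := by simp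
  rw [h2, map_add, map_add, map_smul, map_smul, smul_eq_mul, smul_eq_mul] at h1
  exact h1

/-- The divergence of the current `j₁` of a transported density. -/
def divCurrent₁ (f : ℝ → ℝ → ℝ → ℝ → ℝ) (t x : ℝ) : ℝ :=
  ∫ v : ℝ × ℝ, v.1 * dirDeriv f (0, 1, 0, 0) t x v.1 v.2

lemma dirDeriv_confined (hr : Continuous r) (hf : IsConfined r f)
    (d : ℝ × ℝ × ℝ × ℝ) : IsConfined r (dirDeriv f d) := by
  intro t x v₁ v₂ hne
  by_contra hcon
  apply hne
  have hev : (fun p : ℝ × ℝ × ℝ × ℝ => f p.1 p.2.1 p.2.2.1 p.2.2.2) =ᶠ[𝓝 (t, x, v₁, v₂)]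
      fun _ => 0 := by
    have c₁ : IsClosed {p : ℝ × ℝ × ℝ × ℝ | |p.2.1| ≤ r p.1} :=
      isClosed_le (by fun_prop) (by fun_prop)
    have c₂ : IsClosed {p : ℝ × ℝ × ℝ × ℝ | |p.2.2.1| ≤ r p.1} :=
      isClosed_le (by fun_prop) (by fun_prop)
    have c₃ : IsClosed {p : ℝ × ℝ × ℝ × ℝ | |p.2.2.2| ≤ r p.1} :=
      isClosed_le (by fun_prop) (by fun_prop)
    have hclosed := c₁.inter (c₂.inter c₃)
    filter_upwards [hclosed.isOpen_compl.mem_nhds hcon] with p hp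
    by_contra hp'
    exact hp (hf _ _ _ _ hp')
  rw [dirDeriv, hev.fderiv_eq]
  simp

/-- Integrating a derivative in `v₁` over velocities gives zero: translations preserve the
integral. -/
lemma IsTransported.integral_dirDeriv_v₁ (h : IsTransported K f)
    (hf : IsConfined r f) (t x : ℝ) :
    ∫ v : ℝ × ℝ, dirDeriv f (0, 0, 1, 0) t x v.1 v.2 = 0 := by
  have hs : HasLocallyCompactSupport fun (s : ℝ) (v : ℝ × ℝ) => f t x (v.1 + s) v.2 := by
    intro s
    refine ⟨Metric.ball s 1, Metric.ball_mem_nhds s one_pos, Metric.closedBall 0 (r t + |s| + 1),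
      isCompact_closedBall _ _, fun s' hs' v hv => ?_⟩
    by_contra hne
    have h1 := hf _ _ _ _ hne
    rw [Metric.mem_ball, Real.dist_eq] at hs'
    have h3 := abs_sub_abs_le_abs_sub s' s
    have h4 : |v.1| ≤ |v.1 + s'| + |s'| := by
      have := abs_sub (v.1 + s') s'
      simpa using this
    exact notMem_closedBall_prod hv ⟨by linarith, by linarith [abs_nonneg s, h1.2.2]⟩
  have hd := hs.hasDerivAt_integral (μ := volume)
    (g' := fun s v => dirDeriv f (0, 0, 1, 0) t x (v.1 + s) v.2)
    (h.isContDensity.comp (by fun_prop) (by fun_prop) (by fun_prop) (by fun_prop))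
    ((h.isContDensity_dirDeriv _).comp (by fun_prop) (by fun_prop) (by fun_prop) (by fun_prop))
    (fun s v => by simpa using h.hasDerivAt (0, 0, 1, 0) t x v.1 v.2 s) 0
  have hconst : (fun s : ℝ => ∫ v : ℝ × ℝ, f t x (v.1 + s) v.2) =
      fun _ => ∫ v : ℝ × ℝ, f t x v.1 v.2 := by
    funext s
    have := integral_add_right_eq_self (μ := (volume : Measure (ℝ × ℝ)))
      (fun v : ℝ × ℝ => f t x v.1 v.2) (s, 0)
    simpa using this
  rw [hconst] at hd
  simpa using hd.unique (hasDerivAt_const _ _)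

lemma continuous_divCurrent₁ (h : IsTransported K f) (hr : Continuous r) (hf : IsConfined r f) :
    Continuous fun q : ℝ × ℝ => divCurrent₁ f q.1 q.2 :=
  continuous_current₁ hr (dirDeriv_confined hr hf _) (h.isContDensity_dirDeriv _)

lemma hasDerivAt_current₁ (h : IsTransported K f) (hr : Continuous r) (hf : IsConfined r f)
    (t x : ℝ) : HasDerivAt (current₁ f t) (divCurrent₁ f t x) x := by
  have hd := ((hf.locallyCompactSupport hr fun v => v.1).comp
    (φ := fun y : ℝ => (t, y)) (by fun_prop)).hasDerivAt_integral (μ := volume)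
    (g' := fun y v => v.1 * dirDeriv f (0, 1, 0, 0) t y v.1 v.2)
    (Continuous.mul (by fun_prop)
      (h.isContDensity.comp (by fun_prop) (by fun_prop) (by fun_prop) (by fun_prop)))
    (Continuous.mul (by fun_prop)
      ((h.isContDensity_dirDeriv _).comp (by fun_prop) (by fun_prop) (by fun_prop) (by fun_prop)))
    (fun y v => (h.hasDerivAt_x t y v.1 v.2).const_mul _) x
  exact hd

/-- The continuity equation `∂ₜρ + ∂ₓj₁ = 0`. -/
lemma hasDerivAt_chargeDensity (h : IsTransported K f) (hr : Continuous r) (hf : IsConfined r f)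
    (t x : ℝ) : HasDerivAt (fun s => chargeDensity b f s x) (-divCurrent₁ f t x) t := by
  have hd := ((hf.locallyCompactSupport_one hr).comp
    (φ := fun s : ℝ => (s, x)) (by fun_prop)).hasDerivAt_integral (μ := volume)
    (g' := fun s v => dirDeriv f (1, 0, 0, 0) s x v.1 v.2)
    (h.isContDensity.comp (by fun_prop) (by fun_prop) (by fun_prop) (by fun_prop))
    ((h.isContDensity_dirDeriv _).comp (by fun_prop) (by fun_prop) (by fun_prop) (by fun_prop))
    (fun s v => h.hasDerivAt_t s x v.1 v.2) t
  refine (hd.sub_const (b x)).congr_deriv ?_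
  have e : ∀ v : ℝ × ℝ, dirDeriv f (1, 0, 0, 0) t x v.1 v.2 =
      -(v.1 * dirDeriv f (0, 1, 0, 0) t x v.1 v.2) -
        K t x * dirDeriv f (0, 0, 1, 0) t x v.1 v.2 := fun v => by
    linarith [h.vlasov' t x v.1 v.2]
  have hi : ∀ (w : ℝ × ℝ → ℝ) (d : ℝ × ℝ × ℝ × ℝ), Continuous w →
      Integrable fun v : ℝ × ℝ => w v * dirDeriv f d t x v.1 v.2 := fun w d hw =>
    ((dirDeriv_confined hr hf d).locallyCompactSupport hr w).integrable (t, x)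
      (hw.mul ((h.isContDensity_dirDeriv d).comp (by fun_prop) (by fun_prop) (by fun_prop)
        (by fun_prop)))
  have h1 : Integrable fun v : ℝ × ℝ => -(v.1 * dirDeriv f (0, 1, 0, 0) t x v.1 v.2) :=
    (hi (fun v => v.1) _ continuous_fst).neg
  simp_rw [e]
  rw [integral_sub h1 (hi (fun _ => K t x) _ continuous_const), integral_neg,
    integral_const_mul, h.integral_dirDeriv_v₁ hf, mul_zero, sub_zero]
  rfl

/-- The Ampère equation `∂ₜE₁ = -j₁` for the field of a transported density. -/
lemma hasDerivAt_efield_time (hbc : Continuous b) (hb : IsConfinedBackground r b)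
    (h : IsTransported K f) (hr : Continuous r) (hf : IsConfined r f) (t x : ℝ) :
    HasDerivAt (fun s => efield b f s x) (-current₁ f t x) t := by
  set N := r t + 1
  have hρ := continuous_chargeDensity hbc hr hf h.isContDensity
  -- differentiate under the integral sign over the bounded interval between `-N` and `x`
  have hJ := continuous_divCurrent₁ h hr hf
  have hρ' : ∀ s, Continuous (chargeDensity b f s) := fun s =>
    hρ.comp (f := fun y : ℝ => (s, y)) (by fun_prop)
  have hJ' : ∀ s, Continuous (divCurrent₁ f s) := fun s =>
    hJ.comp (f := fun y : ℝ => (s, y)) (by fun_prop)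
  obtain ⟨C, hC⟩ := ((isCompact_closedBall t 1).prod
    (isCompact_uIcc (a := -N) (b := x))).exists_bound_of_continuousOn hJ.continuousOn
  have hd := (intervalIntegral.hasDerivAt_integral_of_dominated_loc_of_deriv_le
    (F := fun s y => chargeDensity b f s y) (F' := fun s y => -divCurrent₁ f s y)
    (bound := fun _ => C) (μ := volume) (a := -N) (b := x) (x₀ := t)
    (Metric.closedBall_mem_nhds t one_pos)
    (Eventually.of_forall fun s => (hρ' s).aestronglyMeasurable)
    ((hρ' t).intervalIntegrable _ _) (hJ' t).neg.aestronglyMeasurable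
    (ae_of_all _ fun y hy s hs => by
      rw [norm_neg]; exact hC (s, y) ⟨hs, uIoc_subset_uIcc hy⟩)
    (by simp) (ae_of_all _ fun y _ s _ => hasDerivAt_chargeDensity h hr hf s y)).2
  have hval : ∫ y in (-N)..x, -divCurrent₁ f t y = -current₁ f t x := by
    rw [intervalIntegral.integral_neg, intervalIntegral.integral_eq_sub_of_hasDerivAt
      (fun y _ => hasDerivAt_current₁ h hr hf t y) ((hJ' t).intervalIntegrable _ _),
      current₁_eq_zero hf (x := -N), sub_zero]
    rw [abs_neg]
    exact (lt_add_one (r t)).trans_le (le_abs_self N)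
  rw [hval] at hd
  refine hd.congr_of_eventuallyEq ?_
  filter_upwards [hr.continuousAt.eventually_lt (continuousAt_const (y := N)) (lt_add_one (r t))]
    with s hs
  exact efield_eq_intervalIntegral hbc hb hr hf h.isContDensity hs x

lemma contDiff_efield (hbc : Continuous b) (hb : IsConfinedBackground r b)
    (h : IsTransported K f) (hr : Continuous r) (hf : IsConfined r f) :
    ContDiff ℝ 1 fun q : ℝ × ℝ => efield b f q.1 q.2 :=
  contDiff_one_of_continuous_partials (Gt := fun t x => -current₁ f t x)
    (continuous_current₁ hr hf h.isContDensity).neg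
    (continuous_chargeDensity hbc hr hf h.isContDensity)
    (hasDerivAt_efield_time hbc hb h hr hf) (hasDerivAt_efield hbc hb hr hf h.isContDensity)

/-- Outside the support, the field does not change in time. -/
lemma efield_eq_initial (hbc : Continuous b) (hb : IsConfinedBackground r b)
    (h : IsTransported K f) (hr : Continuous r) (hf : IsConfined r f) {t x : ℝ} (ht : 0 ≤ t)
    (hx : ∀ s ∈ Icc 0 t, r s < |x|) : efield b f t x = efield b f 0 x := by
  have := constant_of_derivWithin_zero (f := fun s => efield b f s x) (a := 0) (b := t)
    (fun s _ => (hasDerivAt_efield_time hbc hb h hr hf s x).differentiableAt.differentiableWithinAt)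
    (fun s hs => by
      have hd := (hasDerivAt_efield_time hbc hb h hr hf s x).hasDerivWithinAt (s := Icc 0 t)
      rw [current₁_eq_zero hf (hx s ⟨hs.1, hs.2.le⟩), neg_zero] at hd
      exact hd.derivWithin (uniqueDiffOn_Icc (hs.1.trans_lt hs.2) s ⟨hs.1, hs.2.le⟩))
  exact this t ⟨ht, le_rfl⟩

lemma efield_eq_integral (hf : IsConfined r f) (hb : IsConfinedBackground r b) {t x : ℝ}
    (hx : r t < x) : efield b f t x = ∫ y, chargeDensity b f t y :=
  setIntegral_eq_integral_of_forall_compl_eq_zero fun y hy => by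
    refine chargeDensity_eq_zero hf hb ?_
    have : x < y := not_le.1 hy
    exact hx.trans (this.trans_le (le_abs_self y))

lemma efield_eq_zero_of_lt (hf : IsConfined r f) (hb : IsConfinedBackground r b) {t x : ℝ}
    (hx : x < -r t) : efield b f t x = 0 :=
  setIntegral_eq_zero_of_forall_eq_zero fun y hy => by
    refine chargeDensity_eq_zero hf hb ?_
    have : y ≤ x := hy
    linarith [neg_le_abs y]

end Confined

/-! ### A maximum principle for transport equations -/

/-- If `u ≤ 0` at time `0` and off a compact set, and `∂ₜu ≤ 0` at the spatial maxima where `u` is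
positive, then `u ≤ 0`. For a transport equation the spatial derivatives vanish at such maxima. -/
theorem nonpos_of_deriv_nonpos_at_max {E : Type*} [TopologicalSpace E] {T : ℝ} {u : ℝ → E → ℝ}
    (hc : ContinuousOn (fun q : ℝ × E => u q.1 q.2) (Icc 0 T ×ˢ univ)) {k : Set E}
    (hk : IsCompact k) (hout : ∀ t ∈ Icc 0 T, ∀ z ∉ k, u t z ≤ 0) (h0 : ∀ z, u 0 z ≤ 0)
    (hd : ∀ t ∈ Ioc 0 T, ∀ z, 0 < u t z → IsMaxOn (u t) univ z →
      ∃ d ≤ 0, HasDerivWithinAt (fun s => u s z) d (Icc 0 t) t) :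
    ∀ t ∈ Icc 0 T, ∀ z, u t z ≤ 0 := by
  intro t ht z
  by_contra! hpos
  have hT : 0 ≤ T := ht.1.trans ht.2
  set m := u t z with hm
  -- tilting by `ε s` makes the time derivative at the maximum strictly negative
  set ε := m / (2 * (T + 1)) with hε
  have hε0 : 0 < ε := by positivity
  have hεT : ε * T < m := by
    rw [hε, div_mul_eq_mul_div, div_lt_iff₀ (by positivity)]
    nlinarith
  have hzk : z ∈ k := by
    by_contra hz
    exact absurd (hout t ht z hz) (not_le.2 hpos)
  obtain ⟨⟨s, y⟩, ⟨hs, hy⟩, hmax⟩ := (isCompact_Icc.prod hk).exists_isMaxOn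
    (f := fun q : ℝ × E => u q.1 q.2 - ε * q.1) ⟨(t, z), ht, hzk⟩
    ((hc.mono (prod_mono le_rfl (subset_univ _))).sub (by fun_prop))
  have h1 : 0 < u s y - ε * s := by
    have := hmax (show (t, z) ∈ Icc 0 T ×ˢ k from ⟨ht, hzk⟩)
    have h2 : u t z - ε * t ≤ u s y - ε * s := this
    have : ε * t ≤ ε * T := by gcongr; exact ht.2
    linarith
  have hus : 0 < u s y := by
    have : 0 ≤ ε * s := mul_nonneg hε0.le hs.1
    linarith
  have hs0 : 0 < s := by
    rcases (show 0 ≤ s from hs.1).eq_or_lt with h | h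
    · rw [← h] at hus
      exact absurd (h0 y) (not_le.2 hus)
    · exact h
  obtain ⟨d, hd0, hder⟩ := hd s ⟨hs0, hs.2⟩ y hus (fun y' _ => by
    change u s y' ≤ u s y
    by_cases hy' : y' ∈ k
    · have : u s y' - ε * s ≤ u s y - ε * s := hmax (show (s, y') ∈ Icc 0 T ×ˢ k from ⟨hs, hy'⟩)
      linarith
    · exact (hout s hs y' hy').trans hus.le)
  have hmax' : IsLocalMaxOn (fun r => u r y - ε * r) (Icc 0 s) s := by
    refine IsMaxOn.localize fun r hr => ?_
    exact hmax (show (r, y) ∈ Icc 0 T ×ˢ k from ⟨⟨hr.1, hr.2.trans hs.2⟩, hy⟩)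
  have hder' : HasDerivWithinAt (fun r => u r y - ε * r) (d - ε) (Icc 0 s) s := by
    exact (hder.sub ((hasDerivWithinAt_id s _).const_mul ε)).congr_deriv (by ring)
  have hseg : segment ℝ s 0 ⊆ Icc 0 s := by
    rw [segment_eq_uIcc, uIcc_of_ge hs0.le]
  have hcone := sub_mem_posTangentConeAt_of_segment_subset hseg
  have := hmax'.hasFDerivWithinAt_nonpos hder'.hasFDerivWithinAt hcone
  simp only [ContinuousLinearMap.toSpanSingleton_apply, smul_eq_mul, zero_sub] at this
  nlinarith

lemma hasDerivAt_eq_zero_of_isExtrOn {E : Type*} {u : E → ℝ} {c : ℝ → E} {s d : ℝ}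
    (h : IsExtrOn u univ (c s)) (hd : HasDerivAt (fun r => u (c r)) d s) : d = 0 := by
  refine IsLocalExtr.hasDerivAt_eq_zero (f := fun r => u (c r)) ?_ hd
  rcases h with h | h
  · exact Or.inl (Eventually.of_forall fun r => h (mem_univ (c r)))
  · exact Or.inr (Eventually.of_forall fun r => h (mem_univ (c r)))

/-- The maximum principle in the form used for iterations: a forcing of size `C D exp (2Ct)`
produces a solution of half the size of `D exp (2Ct)`. -/
lemma abs_le_half_exp_of_deriv_le_at_extr {E : Type*} [TopologicalSpace E] {T C D : ℝ}
    {h : ℝ → E → ℝ} (hc : ContinuousOn (fun q : ℝ × E => h q.1 q.2) (Icc 0 T ×ˢ univ))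
    {k : Set E} (hk : IsCompact k) (hD : 0 ≤ D) (hout : ∀ t ∈ Icc 0 T, ∀ z ∉ k, h t z = 0)
    (h0 : ∀ z, h 0 z = 0)
    (hd : ∀ t ∈ Ioc 0 T, ∀ z, h t z ≠ 0 → IsExtrOn (h t) univ z →
      ∃ d, |d| ≤ C * (D * Real.exp (2 * C * t)) ∧
        HasDerivWithinAt (fun s => h s z) d (Icc 0 t) t) :
    ∀ t ∈ Icc 0 T, ∀ z, |h t z| ≤ D * Real.exp (2 * C * t) / 2 := by
  have hβ : ∀ t s, HasDerivWithinAt (fun t => D * Real.exp (2 * C * t) / 2)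
      (C * (D * Real.exp (2 * C * t))) s t := by
    intro t s
    have h1 : HasDerivAt (fun r : ℝ => 2 * C * r) (2 * C) t := by
      simpa using (hasDerivAt_id t).const_mul (2 * C)
    exact (((h1.exp.const_mul D).div_const 2).congr_deriv (by ring)).hasDerivWithinAt
  have key : ∀ σ : ℝ, |σ| = 1 → ∀ t ∈ Icc 0 T, ∀ z,
      σ * h t z - D * Real.exp (2 * C * t) / 2 ≤ 0 := by
    intro σ hσ
    have hσ' : ∀ a : ℝ, σ * (σ * a) = a := fun a => by
      rw [← mul_assoc, ← abs_mul_abs_self, hσ]; ring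
    refine nonpos_of_deriv_nonpos_at_max (u := fun t z => σ * h t z - D * Real.exp (2 * C * t) / 2)
      (by fun_prop) hk ?_ ?_ ?_
    · intro t ht z hz
      rw [hout t ht z hz]
      have : 0 ≤ D * Real.exp (2 * C * t) := by positivity
      linarith
    · intro z
      rw [h0]
      have : 0 ≤ D * Real.exp (2 * C * 0) := by positivity
      linarith
    · intro t ht z hz hmax
      have hne : h t z ≠ 0 := by
        intro h1
        rw [h1] at hz
        have : 0 ≤ D * Real.exp (2 * C * t) := by positivity
        linarith
      have hmax' : ∀ z', σ * h t z' ≤ σ * h t z := fun z' => by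
        have : σ * h t z' - D * Real.exp (2 * C * t) / 2 ≤
          σ * h t z - D * Real.exp (2 * C * t) / 2 := hmax (mem_univ z')
        linarith
      have hext : IsExtrOn (h t) univ z := by
        rcases (abs_eq one_pos.le).1 hσ with rfl | rfl
        · exact Or.inr fun z' _ => by simpa using hmax' z'
        · exact Or.inl fun z' _ => by simpa using hmax' z'
      obtain ⟨d, hd1, hd2⟩ := hd t ht z hne hext
      refine ⟨σ * d - C * (D * Real.exp (2 * C * t)), ?_, (hd2.const_mul σ).sub (hβ t _)⟩
      have : σ * d ≤ |d| := by
        refine (le_abs_self _).trans ?_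
        rw [abs_mul, hσ, one_mul]
      linarith
  intro t ht z
  refine abs_le.2 ⟨?_, ?_⟩
  · linarith [key (-1) (by simp) t ht z]
  · linarith [key 1 (by simp) t ht z]

/-! ### Partial derivatives on the closed half space `t ≥ 0` -/

section HalfSpace

variable {E : Type*} [NormedAddCommGroup E] [NormedSpace ℝ E] {F : ℝ × E → ℝ}

lemma hasDerivWithinAt_curve (hF : ContDiffOn ℝ 1 F (Ici 0 ×ˢ univ)) {c : ℝ → ℝ × E}
    {c' : ℝ × E} {A : Set ℝ} {s : ℝ} (hs : s ∈ A) (hA : ∀ r ∈ A, 0 ≤ (c r).1)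
    (hc : HasDerivWithinAt c c' A s) :
    HasDerivWithinAt (fun r => F (c r)) (fderivWithin ℝ F (Ici 0 ×ˢ univ) (c s) c') A s := by
  have h1 := (hF.differentiableOn one_ne_zero (c s) ⟨hA s hs, trivial⟩).hasFDerivWithinAt
  exact h1.comp_hasDerivWithinAt s hc fun r hr => ⟨hA r hr, trivial⟩

lemma hasDerivAt_space_curve (hF : ContDiffOn ℝ 1 F (Ici 0 ×ˢ univ)) {t : ℝ} (ht : 0 ≤ t)
    {c : ℝ → E} {e : E} {s : ℝ} (hc : HasDerivAt c e s) :
    HasDerivAt (fun r => F (t, c r)) (fderivWithin ℝ F (Ici 0 ×ˢ univ) (t, c s) (0, e)) s := by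
  rw [← hasDerivWithinAt_univ]
  exact hasDerivWithinAt_curve hF (c := fun r => (t, c r)) (mem_univ s) (fun _ _ => ht)
    ((hasDerivAt_const s t).prodMk hc).hasDerivWithinAt

lemma hasDerivWithinAt_time (hF : ContDiffOn ℝ 1 F (Ici 0 ×ˢ univ)) {t : ℝ} (ht : 0 ≤ t) (z : E) :
    HasDerivWithinAt (fun s => F (s, z)) (fderivWithin ℝ F (Ici 0 ×ˢ univ) (t, z) (1, 0))
      (Ici 0) t :=
  hasDerivWithinAt_curve hF (c := fun s => (s, z)) ht (fun _ h => h)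
    ((hasDerivWithinAt_id t _).prodMk (hasDerivWithinAt_const t _ z))

lemma timeDeriv_eq (hF : ContDiffOn ℝ 1 F (Ici 0 ×ˢ univ)) {t : ℝ} (ht : 0 ≤ t) (z : E) :
    timeDeriv (fun s => F (s, z)) t = fderivWithin ℝ F (Ici 0 ×ˢ univ) (t, z) (1, 0) :=
  (hasDerivWithinAt_time hF ht z).derivWithin (uniqueDiffOn_Ici 0 t ht)

lemma continuousOn_fderivWithin_halfSpace (hF : ContDiffOn ℝ 1 F (Ici 0 ×ˢ univ)) (d : ℝ × E) :
    ContinuousOn (fun p => fderivWithin ℝ F (Ici 0 ×ˢ univ) p d) (Ici 0 ×ˢ univ) :=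
  (hF.continuousOn_fderivWithin ((uniqueDiffOn_Ici 0).prod uniqueDiffOn_univ) le_rfl).clm_apply
    continuousOn_const

end HalfSpace

section Density

variable {f : ℝ → ℝ → ℝ → ℝ → ℝ}

lemma IsC1Density.hasDerivWithinAt_t (hf : IsC1Density f) {t : ℝ} (ht : 0 ≤ t) (x v₁ v₂ : ℝ) :
    HasDerivWithinAt (fun s => f s x v₁ v₂) (timeDeriv (fun s => f s x v₁ v₂) t) (Ici 0) t :=
  (hasDerivWithinAt_time hf ht (x, v₁, v₂)).differentiableWithinAt.hasDerivWithinAt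

lemma IsC1Density.hasDerivAt_x (hf : IsC1Density f) {t : ℝ} (ht : 0 ≤ t) (x v₁ v₂ : ℝ) :
    HasDerivAt (fun y => f t y v₁ v₂) (deriv (fun y => f t y v₁ v₂) x) x :=
  (hasDerivAt_space_curve hf ht (c := fun y => (y, v₁, v₂))
    ((hasDerivAt_id x).prodMk (hasDerivAt_const _ _))).differentiableAt.hasDerivAt

lemma IsC1Density.hasDerivAt_v₁_fderivWithin (hf : IsC1Density f) {t : ℝ} (ht : 0 ≤ t)
    (x v₁ v₂ : ℝ) : HasDerivAt (fun w => f t x w v₂) (fderivWithin ℝ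
      (fun p : ℝ × ℝ × ℝ × ℝ => f p.1 p.2.1 p.2.2.1 p.2.2.2) (Ici 0 ×ˢ univ) (t, x, v₁, v₂)
      (0, 0, 1, 0)) v₁ :=
  hasDerivAt_space_curve hf ht (c := fun w => (x, w, v₂))
    ((hasDerivAt_const _ _).prodMk ((hasDerivAt_id v₁).prodMk (hasDerivAt_const _ _)))

lemma IsC1Density.hasDerivAt_v₂_fderivWithin (hf : IsC1Density f) {t : ℝ} (ht : 0 ≤ t)
    (x v₁ v₂ : ℝ) : HasDerivAt (fun w => f t x v₁ w) (fderivWithin ℝ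
      (fun p : ℝ × ℝ × ℝ × ℝ => f p.1 p.2.1 p.2.2.1 p.2.2.2) (Ici 0 ×ˢ univ) (t, x, v₁, v₂)
      (0, 0, 0, 1)) v₂ :=
  hasDerivAt_space_curve hf ht (c := fun w => (x, v₁, w))
    ((hasDerivAt_const _ _).prodMk ((hasDerivAt_const _ _).prodMk (hasDerivAt_id v₂)))

lemma IsC1Density.hasDerivAt_v₁ (hf : IsC1Density f) {t : ℝ} (ht : 0 ≤ t) (x v₁ v₂ : ℝ) :
    HasDerivAt (fun w => f t x w v₂) (deriv (fun w => f t x w v₂) v₁) v₁ :=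
  (hf.hasDerivAt_v₁_fderivWithin ht x v₁ v₂).differentiableAt.hasDerivAt

lemma IsC1Density.hasDerivAt_v₂ (hf : IsC1Density f) {t : ℝ} (ht : 0 ≤ t) (x v₁ v₂ : ℝ) :
    HasDerivAt (fun w => f t x v₁ w) (deriv (fun w => f t x v₁ w) v₂) v₂ :=
  (hf.hasDerivAt_v₂_fderivWithin ht x v₁ v₂).differentiableAt.hasDerivAt

/-- The velocity derivatives are bounded on compact sets. -/
lemma IsC1Density.exists_bound_velocity_deriv (hf : IsC1Density f) (T N : ℝ) :
    ∃ C, 0 ≤ C ∧ ∀ t ∈ Icc 0 T, ∀ x ∈ Icc (-N) N, ∀ v₁ ∈ Icc (-N) N, ∀ v₂ ∈ Icc (-N) N,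
      |deriv (fun w => f t x w v₂) v₁| ≤ C ∧ |deriv (fun w => f t x v₁ w) v₂| ≤ C := by
  have hK : IsCompact (Icc 0 T ×ˢ Icc (-N) N ×ˢ Icc (-N) N ×ˢ Icc (-N) N) :=
    isCompact_Icc.prod (isCompact_Icc.prod (isCompact_Icc.prod isCompact_Icc))
  have hsub : Icc 0 T ×ˢ Icc (-N) N ×ˢ Icc (-N) N ×ˢ Icc (-N) N ⊆
      (Ici 0 ×ˢ univ : Set (ℝ × ℝ × ℝ × ℝ)) := prod_mono Icc_subset_Ici_self (subset_univ _)
  obtain ⟨C₁, h₁⟩ := hK.exists_bound_of_continuousOn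
    ((continuousOn_fderivWithin_halfSpace hf (0, 0, 1, 0)).mono hsub)
  obtain ⟨C₂, h₂⟩ := hK.exists_bound_of_continuousOn
    ((continuousOn_fderivWithin_halfSpace hf (0, 0, 0, 1)).mono hsub)
  refine ⟨max (max C₁ C₂) 0, le_max_right _ _, fun t ht x hx v₁ hv₁ v₂ hv₂ => ⟨?_, ?_⟩⟩
  · rw [(hf.hasDerivAt_v₁_fderivWithin ht.1 x v₁ v₂).deriv]
    exact (h₁ (t, x, v₁, v₂) ⟨ht, hx, hv₁, hv₂⟩).trans ((le_max_left _ _).trans (le_max_left _ _))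
  · rw [(hf.hasDerivAt_v₂_fderivWithin ht.1 x v₁ v₂).deriv]
    exact (h₂ (t, x, v₁, v₂) ⟨ht, hx, hv₁, hv₂⟩).trans ((le_max_right _ _).trans (le_max_left _ _))

end Density

/-! ### Spatial support of a solution -/

section Support

variable {b : ℝ → ℝ} {f0 : ℝ → ℝ → ℝ → ℝ} {E20 B0 : ℝ → ℝ} {f g : ℝ → ℝ → ℝ → ℝ → ℝ}
  {E₁ E₂ B F₁ F₂ G : ℝ → ℝ → ℝ}

/-- Finite speed of propagation: with velocities bounded by `R`, a vacuum interval `(a, c)` shrinks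
at speed at most `R`. The maximum principle is applied to `(x - a - Rt)(c - x - Rt) f²`. -/
lemma IsGlobalVMSolution.eq_zero_of_mem_vacuum (h : IsGlobalVMSolution b f0 E20 B0 f E₁ E₂ B)
    {T R a c : ℝ} (hR : 0 ≤ R)
    (hv : ∀ t ∈ Icc 0 T, ∀ x v₁ v₂ : ℝ, f t x v₁ v₂ ≠ 0 → |v₁| ≤ R ∧ |v₂| ≤ R)
    (hac : 2 * R * T ≤ c - a) (h0 : ∀ x, a < x → x < c → ∀ v₁ v₂, f0 x v₁ v₂ = 0)
    {t x : ℝ} (ht : t ∈ Icc 0 T) (hx1 : a + R * t < x) (hx2 : x < c - R * t) (v₁ v₂ : ℝ) :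
    f t x v₁ v₂ = 0 := by
  have hfc : ContinuousOn (fun q : ℝ × ℝ × ℝ × ℝ => f q.1 q.2.1 q.2.2.1 q.2.2.2)
      (Icc 0 T ×ˢ univ) :=
    h.regular_f.continuousOn.mono (prod_mono Icc_subset_Ici_self le_rfl)
  have hRt : ∀ s ∈ Icc 0 T, R * s ≤ R * T := fun s hs => mul_le_mul_of_nonneg_left hs.2 hR
  -- as `2RT ≤ c - a`, the two factors of the weight are never both negative
  have hsign : ∀ s ∈ Icc 0 T, ∀ y, 0 < (y - a - R * s) * (c - y - R * s) →
      0 < y - a - R * s ∧ 0 < c - y - R * s := by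
    intro s hs y hpos
    rcases pos_and_pos_or_neg_and_neg_of_mul_pos hpos with h1 | h1
    · exact h1
    · linarith [hRt s hs, h1.1, h1.2]
  have key := nonpos_of_deriv_nonpos_at_max (T := T)
    (u := fun s (z : ℝ × ℝ × ℝ) =>
      (z.1 - a - R * s) * (c - z.1 - R * s) * f s z.1 z.2.1 z.2.2 ^ 2)
    (k := Icc a c ×ˢ Icc (-R) R ×ˢ Icc (-R) R) (by fun_prop)
    (isCompact_Icc.prod (isCompact_Icc.prod isCompact_Icc)) ?_ ?_ ?_ t ht (x, v₁, v₂)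
  · have hpos : 0 < (x - a - R * t) * (c - x - R * t) := mul_pos (by linarith) (by linarith)
    by_contra hne
    have : 0 < (x - a - R * t) * (c - x - R * t) * f t x v₁ v₂ ^ 2 := by positivity
    exact absurd key (not_le.2 this)
  · rintro s hs ⟨y, w₁, w₂⟩ hz
    by_contra! hpos
    dsimp only at hpos
    have hf0 : f s y w₁ w₂ ≠ 0 := by
      intro h1
      simp [h1] at hpos
    have hw := pos_of_mul_pos_left hpos (sq_nonneg _)
    obtain ⟨p1, p2⟩ := hsign s hs y hw
    have hRs : 0 ≤ R * s := mul_nonneg hR hs.1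
    obtain ⟨q1, q2⟩ := hv s hs y w₁ w₂ hf0
    exact hz ⟨⟨by linarith, by linarith⟩, abs_le.1 q1, abs_le.1 q2⟩
  · rintro ⟨y, w₁, w₂⟩
    dsimp only
    by_contra! hpos
    have hw := pos_of_mul_pos_left hpos (sq_nonneg _)
    have hT : (0 : ℝ) ∈ Icc 0 T := ⟨le_rfl, ht.1.trans ht.2⟩
    obtain ⟨p1, p2⟩ := hsign 0 hT y hw
    rw [h.initial_f, h0 y (by linarith) (by linarith)] at hpos
    simp at hpos
  · rintro s hs ⟨y, w₁, w₂⟩ hpos hmax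
    dsimp only at hpos
    have hs' : s ∈ Icc 0 T := ⟨hs.1.le, hs.2⟩
    have hf0 : f s y w₁ w₂ ≠ 0 := by
      intro h1
      simp [h1] at hpos
    have hw := pos_of_mul_pos_left hpos (sq_nonneg _)
    obtain ⟨p1, p2⟩ := hsign s hs' y hw
    have hw₁ := abs_le.1 (hv s hs' y w₁ w₂ hf0).1
    set W := (y - a - R * s) * (c - y - R * s) with hW
    set Φ := f s y w₁ w₂
    have d1 := hasDerivAt_eq_zero_of_isExtrOn (c := fun r => (y, r, w₂)) (Or.inr hmax)
      (((h.regular_f.hasDerivAt_v₁ hs.1.le y w₁ w₂).pow 2).const_mul W)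
    have d2 := hasDerivAt_eq_zero_of_isExtrOn (c := fun r => (y, w₁, r)) (Or.inr hmax)
      (((h.regular_f.hasDerivAt_v₂ hs.1.le y w₁ w₂).pow 2).const_mul W)
    have dx1 : HasDerivAt (fun r : ℝ => r - a - R * s) 1 y :=
      ((hasDerivAt_id y).sub_const a).sub_const _
    have dx2 : HasDerivAt (fun r : ℝ => c - r - R * s) (-1) y :=
      ((hasDerivAt_id y).const_sub c).sub_const _
    have d3 := hasDerivAt_eq_zero_of_isExtrOn (c := fun r => (r, w₁, w₂)) (Or.inr hmax)
      ((dx1.mul dx2).mul ((h.regular_f.hasDerivAt_x hs.1.le y w₁ w₂).pow 2))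
    have dt1 : HasDerivWithinAt (fun r : ℝ => y - a - R * r) (-(R * 1)) (Icc 0 s) s :=
      ((hasDerivWithinAt_id s _).const_mul R).const_sub _
    have dt2 : HasDerivWithinAt (fun r : ℝ => c - y - R * r) (-(R * 1)) (Icc 0 s) s :=
      ((hasDerivWithinAt_id s _).const_mul R).const_sub _
    refine ⟨_, ?_, (dt1.mul dt2).mul (((h.regular_f.hasDerivWithinAt_t hs.1.le y w₁ w₂).mono
      Icc_subset_Ici_self).pow 2)⟩
    have hvl := h.vlasov s hs.1.le y w₁ w₂
    have e1 : deriv (fun w => f s y w w₂) w₁ = 0 := by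
      simpa [hw.ne', show f s y w₁ w₂ ≠ 0 from hf0] using d1
    have e2 : deriv (fun w => f s y w₁ w) w₂ = 0 := by
      simpa [hw.ne', show f s y w₁ w₂ ≠ 0 from hf0] using d2
    rw [e1, e2] at hvl
    simp only [Pi.mul_apply, Nat.cast_ofNat] at d3 ⊢
    norm_num at d3 ⊢
    -- the weight decreases along every velocity `|w₁| ≤ R`
    have e : (-(R * (c - y - R * s)) + -((y - a - R * s) * R)) * f s y w₁ w₂ ^ 2 +
        (y - a - R * s) * (c - y - R * s) *
          (2 * f s y w₁ w₂ * timeDeriv (fun s => f s y w₁ w₂) s) =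
        f s y w₁ w₂ ^ 2 * ((c - y - R * s) * (w₁ - R) + (y - a - R * s) * (-w₁ - R)) := by
      linear_combination (2 * ((y - a - R * s) * (c - y - R * s)) * f s y w₁ w₂) * hvl - w₁ * d3
    rw [e]
    refine mul_nonpos_of_nonneg_of_nonpos (sq_nonneg _) (add_nonpos ?_ ?_)
    · exact mul_nonpos_of_nonneg_of_nonpos p2.le (by linarith)
    · exact mul_nonpos_of_nonneg_of_nonpos p1.le (by linarith)

end Support

/-! ### Uniqueness -/

lemma IsC1cDatum.exists_support {f0 : ℝ → ℝ → ℝ → ℝ} (h : IsC1cDatum f0) :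
    ∃ R, 0 ≤ R ∧ ∀ x v₁ v₂, f0 x v₁ v₂ ≠ 0 → |x| ≤ R ∧ |v₁| ≤ R ∧ |v₂| ≤ R := by
  obtain ⟨R, hR⟩ := h.compact.isCompact.isBounded.subset_closedBall (0 : ℝ × ℝ × ℝ)
  refine ⟨max R 0, le_max_right _ _, fun x v₁ v₂ hne => ?_⟩
  have h1 := hR (subset_tsupport _ (show (x, v₁, v₂) ∈ Function.support
    (fun p : ℝ × ℝ × ℝ => f0 p.1 p.2.1 p.2.2) from hne))
  rw [mem_closedBall_zero_iff] at h1
  have h2 := norm_prod_le_iff.1 (h1.trans (le_max_left R 0))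
  exact ⟨h2.1, norm_prod_le_iff.1 h2.2⟩

section Uniqueness

variable {b : ℝ → ℝ} {f0 : ℝ → ℝ → ℝ → ℝ} {E20 B0 : ℝ → ℝ} {f g : ℝ → ℝ → ℝ → ℝ → ℝ}
  {E₁ E₂ B F₁ F₂ G : ℝ → ℝ → ℝ}

/-- The density of a solution has compact support in phase space, locally uniformly in time. -/
lemma IsGlobalVMSolution.exists_support (h : IsGlobalVMSolution b f0 E20 B0 f E₁ E₂ B)
    (hf0 : IsC1cDatum f0) (T : ℝ) : ∃ N, 0 ≤ N ∧ ∀ t ∈ Icc 0 T, ∀ x v₁ v₂,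
      f t x v₁ v₂ ≠ 0 → |x| ≤ N ∧ |v₁| ≤ N ∧ |v₂| ≤ N := by
  obtain ⟨R₀, hR₀, hs⟩ := hf0.exists_support
  obtain ⟨R', hv'⟩ := h.velocities T
  set R := max R' 0
  have hR : 0 ≤ R := le_max_right _ _
  have hv : ∀ t ∈ Icc 0 T, ∀ x v₁ v₂ : ℝ, f t x v₁ v₂ ≠ 0 → |v₁| ≤ R ∧ |v₂| ≤ R :=
    fun t ht x v₁ v₂ hne => ⟨(hv' t ht x v₁ v₂ hne).1.trans (le_max_left _ _),
      (hv' t ht x v₁ v₂ hne).2.trans (le_max_left _ _)⟩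
  refine ⟨R₀ + R * |T| + R, by positivity, fun t ht x v₁ v₂ hne => ?_⟩
  have hRT : R * t ≤ R * |T| := mul_le_mul_of_nonneg_left (ht.2.trans (le_abs_self T)) hR
  have hRT0 : 0 ≤ R * |T| := by positivity
  have hRt0 : 0 ≤ R * t := mul_nonneg hR ht.1
  refine ⟨?_, (hv t ht x v₁ v₂ hne).1.trans (by linarith), (hv t ht x v₁ v₂ hne).2.trans
    (by linarith)⟩
  have hTT : R * T ≤ R * |T| := mul_le_mul_of_nonneg_left (le_abs_self T) hR
  by_contra! hx
  apply hne
  have hvac : ∀ y, R₀ < |y| → ∀ w₁ w₂, f0 y w₁ w₂ = 0 := fun y hy w₁ w₂ => by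
    by_contra hcon
    exact absurd (hs y w₁ w₂ hcon).1 (not_le.2 hy)
  rcases lt_abs.1 hx with hx | hx
  · refine h.eq_zero_of_mem_vacuum hR hv (a := R₀) (c := x + R₀ + 2 * (R * |T|) + 1) (by linarith)
      (fun y hy _ => hvac y (hy.trans_le (le_abs_self y))) ht (by linarith) (by linarith) v₁ v₂
  · refine h.eq_zero_of_mem_vacuum hR hv (a := x - R₀ - 2 * (R * |T|) - 1) (c := -R₀) (by linarith)
      (fun y _ hy => hvac y (by linarith [neg_le_abs y])) ht (by linarith) (by linarith) v₁ v₂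

/-- A density frozen at a time `t ≥ 0` is continuous. Freezing removes the negative times, at which
nothing is known of a solution. -/
lemma IsC1Density.isContDensity_const (hf : IsC1Density f) {t : ℝ} (ht : 0 ≤ t) :
    IsContDensity fun _ => f t := by
  have h1 : ContinuousOn (fun p : ℝ × ℝ × ℝ × ℝ => f p.1 p.2.1 p.2.2.1 p.2.2.2)
    (Ici 0 ×ˢ univ) := hf.continuousOn
  exact continuousOn_univ.1 (h1.comp (f := fun p : ℝ × ℝ × ℝ × ℝ => (t, p.2)) (s := univ)
    (by fun_prop) fun p _ => ⟨ht, trivial⟩)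

lemma abs_current₂_sub_le {N : ℝ} (hN : 0 ≤ N) (hf : IsConfined (fun _ => N) f)
    (hg : IsConfined (fun _ => N) g) (hfc : IsContDensity f) (hgc : IsContDensity g) {t β : ℝ}
    (h : ∀ x v₁ v₂, |f t x v₁ v₂ - g t x v₁ v₂| ≤ β) (x : ℝ) :
    |current₂ f t x - current₂ g t x| ≤ N * β * (2 * N) ^ 2 := by
  have hβ : 0 ≤ β := (abs_nonneg _).trans (h 0 0 0)
  have hi : ∀ {f}, IsConfined (fun _ => N) f → IsContDensity f →
      Integrable fun v : ℝ × ℝ => v.2 * f t x v.1 v.2 := fun hf hc =>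
    (hf.locallyCompactSupport continuous_const fun v => v.2).integrable (t, x)
      (continuous_snd.mul (hc.comp (by fun_prop) (by fun_prop) (by fun_prop) (by fun_prop)))
  rw [current₂, current₂, ← integral_sub (hi hf hfc) (hi hg hgc)]
  have hs : ∀ v : ℝ × ℝ, v.2 * f t x v.1 v.2 - v.2 * g t x v.1 v.2 ≠ 0 → |v.1| ≤ N ∧ |v.2| ≤ N := by
    intro v hv
    by_cases h1 : f t x v.1 v.2 = 0
    · exact (hg t x v.1 v.2 fun h2 => hv (by rw [h1, h2, sub_self])).2
    · exact (hf _ _ _ _ h1).2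
  refine abs_integral_prod_le hN hs fun v => ?_
  by_cases h0 : v.2 * f t x v.1 v.2 - v.2 * g t x v.1 v.2 = 0
  · rw [h0, abs_zero]; positivity
  · rw [← mul_sub, abs_mul]
    exact mul_le_mul (hs v h0).2 (h _ _ _) (abs_nonneg _) hN

/-- Two solutions of `∂ₓE = ρ` that vanish at infinity differ by at most the difference of the
charges. -/
lemma IsGlobalVMSolution.abs_field₁_sub_le (hF : IsGlobalVMSolution b f0 E20 B0 f E₁ E₂ B)
    (hG : IsGlobalVMSolution b f0 E20 B0 g F₁ F₂ G) {t N β : ℝ} (ht : 0 ≤ t) (hN : 0 ≤ N)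
    (hf : IsConfined (fun _ => N) fun _ => f t) (hg : IsConfined (fun _ => N) fun _ => g t)
    (h : ∀ x v₁ v₂, |f t x v₁ v₂ - g t x v₁ v₂| ≤ β) {x : ℝ} (hx : |x| ≤ N) :
    |E₁ t x - F₁ t x| ≤ β * (2 * N) ^ 2 * (2 * N + 1) := by
  have hβ : 0 ≤ β := (abs_nonneg _).trans (h 0 0 0)
  have hd : ∀ y, HasDerivAt (fun y => E₁ t y - F₁ t y)
      (chargeDensity b f t y - chargeDensity b g t y) y := by
    intro y
    have h1 : DifferentiableAt ℝ (E₁ t) y := (hasDerivAt_space_curve hF.regular_E₁ ht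
      (hasDerivAt_id y)).differentiableAt
    have h2 : DifferentiableAt ℝ (F₁ t) y := (hasDerivAt_space_curve hG.regular_E₁ ht
      (hasDerivAt_id y)).differentiableAt
    rw [← hF.gauss t ht y, ← hG.gauss t ht y]
    exact h1.hasDerivAt.sub h2.hasDerivAt
  have hbd : ∀ y, |chargeDensity b f t y - chargeDensity b g t y| ≤ β * (2 * N) ^ 2 := fun y =>
    abs_chargeDensity_sub_le (f := fun _ => f t) (g := fun _ => g t) (t := t) continuous_const
      (fun _ => hN) hf hg (hF.regular_f.isContDensity_const ht)
      (hG.regular_f.isContDensity_const ht) h y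
  have hzero : ∀ y ∈ Iic (-N - 1), E₁ t y - F₁ t y = E₁ t (-N - 1) - F₁ t (-N - 1) := by
    intro y hy
    have h1 := (convex_Iic (-N - 1)).norm_image_sub_le_of_norm_hasDerivWithin_le
      (f := fun y => E₁ t y - F₁ t y) (C := 0) (fun z _ => (hd z).hasDerivWithinAt)
      (fun z hz => by
        have hz' : N < |z| := by
          have : z ≤ -N - 1 := hz
          linarith [neg_le_abs z]
        rw [chargeDensity, chargeDensity]
        have e1 : ∀ v : ℝ × ℝ, f t z v.1 v.2 = 0 := fun v =>
          IsConfined.eq_zero (t := t) hf hz'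
        have e2 : ∀ v : ℝ × ℝ, g t z v.1 v.2 = 0 := fun v =>
          IsConfined.eq_zero (t := t) hg hz'
        simp [e1, e2]) self_mem_Iic hy
    rw [zero_mul] at h1
    exact sub_eq_zero.1 (norm_le_zero_iff.1 h1)
  have hlim : Tendsto (fun y => E₁ t y - F₁ t y) atBot (𝓝 0) := by
    simpa using ((hF.decay t ht).sub (hG.decay t ht)).mono_left atBot_le_cocompact
  have hbase : E₁ t (-N - 1) - F₁ t (-N - 1) = 0 := by
    refine tendsto_nhds_unique (tendsto_const_nhds.congr' ?_) hlim
    filter_upwards [Iic_mem_atBot (-N - 1)] with y hy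
    exact (hzero y hy).symm
  have h1 := convex_univ.norm_image_sub_le_of_norm_hasDerivWithin_le
    (f := fun y => E₁ t y - F₁ t y) (fun z _ => (hd z).hasDerivWithinAt) (fun z _ => hbd z)
    (mem_univ (-N - 1)) (mem_univ x)
  rw [hbase, sub_zero, Real.norm_eq_abs, Real.norm_eq_abs] at h1
  refine h1.trans (mul_le_mul_of_nonneg_left ?_ (by positivity))
  have := abs_le.1 hx
  rw [abs_le]
  constructor <;> linarith

/-- Along light rays `∂ₜ + σ∂ₓ`, the field `E₂ + σB` is driven by `-j₂`. -/
lemma IsGlobalVMSolution.hasDerivWithinAt_lightRay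
    (hF : IsGlobalVMSolution b f0 E20 B0 f E₁ E₂ B) {σ : ℝ} (hσ : σ * σ = 1) (y : ℝ) {s t : ℝ}
    (hs : s ∈ Icc 0 t) :
    HasDerivWithinAt (fun r => E₂ r (y + σ * r) + σ * B r (y + σ * r))
      (-current₂ f s (y + σ * s)) (Icc 0 t) s := by
  have hc : HasDerivWithinAt (fun r : ℝ => (r, y + σ * r)) ((1 : ℝ), σ) (Icc 0 t) s := by
    have h1 : HasDerivAt (fun r : ℝ => y + σ * r) σ s := by
      simpa using ((hasDerivAt_id s).const_mul σ).const_add y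
    exact ((hasDerivAt_id s).prodMk h1).hasDerivWithinAt
  have hpos : ∀ r ∈ Icc 0 t, 0 ≤ ((fun r : ℝ => (r, y + σ * r)) r).1 := fun r hr => hr.1
  have d1 := hasDerivWithinAt_curve hF.regular_E₂ hs hpos hc
  have d2 := hasDerivWithinAt_curve hF.regular_B hs hpos hc
  refine (d1.add (d2.const_mul σ)).congr_deriv ?_
  have e : ((1 : ℝ), σ) = (1, 0) + σ • ((0 : ℝ), (1 : ℝ)) := by simp
  rw [e, map_add, map_add, map_smul, map_smul, ← timeDeriv_eq hF.regular_E₂ hs.1,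
    ← timeDeriv_eq hF.regular_B hs.1]
  have x1 := (hasDerivAt_space_curve hF.regular_E₂ hs.1 (hasDerivAt_id (y + σ * s))).deriv
  have x2 := (hasDerivAt_space_curve hF.regular_B hs.1 (hasDerivAt_id (y + σ * s))).deriv
  simp only [id] at x1 x2
  rw [← x1, ← x2, hF.ampere₂ s hs.1, hF.faraday s hs.1, smul_eq_mul, smul_eq_mul]
  linear_combination (deriv (fun y => B s y) (y + σ * s)) * hσ

lemma IsGlobalVMSolution.abs_lightRay_sub_le (hF : IsGlobalVMSolution b f0 E20 B0 f E₁ E₂ B)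
    (hG : IsGlobalVMSolution b f0 E20 B0 g F₁ F₂ G) {t J σ : ℝ} (hσ : σ * σ = 1) (ht : 0 ≤ t)
    (hJ : ∀ s ∈ Icc 0 t, ∀ x, |current₂ f s x - current₂ g s x| ≤ J) (x : ℝ) :
    |(E₂ t x - F₂ t x) + σ * (B t x - G t x)| ≤ J * t := by
  have h1 := (convex_Icc 0 t).norm_image_sub_le_of_norm_hasDerivWithin_le (C := J)
    (fun s hs => (hF.hasDerivWithinAt_lightRay hσ (x - σ * t) hs).sub
      (hG.hasDerivWithinAt_lightRay hσ (x - σ * t) hs))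
    (fun s hs => by
      have := hJ s hs (x - σ * t + σ * s)
      rw [abs_sub_comm] at this
      rw [Real.norm_eq_abs]
      convert this using 2
      ring) (left_mem_Icc.2 ht) (right_mem_Icc.2 ht)
  simp only [Pi.sub_apply, mul_zero, add_zero, sub_add_cancel, sub_zero, hF.initial_E₂,
    hG.initial_E₂, hF.initial_B, hG.initial_B, sub_self, Real.norm_eq_abs, abs_of_nonneg ht] at h1
  refine le_trans (le_of_eq ?_) h1
  congr 1
  ring

/-- Iteration step for uniqueness: the fields are controlled by the densities, and the densities are
controlled by the fields with a gain of a factor `1/2` in the exponentially weighted norm. -/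
lemma IsGlobalVMSolution.abs_sub_le_half (hF : IsGlobalVMSolution b f0 E20 B0 f E₁ E₂ B)
    (hG : IsGlobalVMSolution b f0 E20 B0 g F₁ F₂ G) {T N A D : ℝ} (hN : 0 ≤ N) (hA : 0 ≤ A)
    (hD : 0 ≤ D) (hT : 0 ≤ T)
    (hf : ∀ t ∈ Icc 0 T, IsConfined (fun _ => N) fun _ => f t)
    (hg : ∀ t ∈ Icc 0 T, IsConfined (fun _ => N) fun _ => g t)
    (hbd : ∀ t ∈ Icc 0 T, ∀ x ∈ Icc (-N) N, ∀ v₁ ∈ Icc (-N) N, ∀ v₂ ∈ Icc (-N) N,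
      |deriv (fun w => g t x w v₂) v₁| ≤ A ∧ |deriv (fun w => g t x v₁ w) v₂| ≤ A)
    {C : ℝ} (hC : C = A * (2 * N) ^ 2 * ((2 * N + 1) + N * T + 2 * (N * (N * T))))
    (h : ∀ t ∈ Icc 0 T, ∀ x v₁ v₂, |f t x v₁ v₂ - g t x v₁ v₂| ≤ D * Real.exp (2 * C * t)) :
    ∀ t ∈ Icc 0 T, ∀ x v₁ v₂, |f t x v₁ v₂ - g t x v₁ v₂| ≤ D * Real.exp (2 * C * t) / 2 := by
  have hC0 : 0 ≤ C := by rw [hC]; positivity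
  have key := abs_le_half_exp_of_deriv_le_at_extr (T := T) (C := C) (D := D)
    (h := fun t (z : ℝ × ℝ × ℝ) => f t z.1 z.2.1 z.2.2 - g t z.1 z.2.1 z.2.2)
    (k := Icc (-N) N ×ˢ Icc (-N) N ×ˢ Icc (-N) N) ?_
    (isCompact_Icc.prod (isCompact_Icc.prod isCompact_Icc)) hD ?_ ?_ ?_
  · exact fun t ht x v₁ v₂ => key t ht (x, v₁, v₂)
  · have h1 : ContinuousOn (fun p : ℝ × ℝ × ℝ × ℝ => f p.1 p.2.1 p.2.2.1 p.2.2.2)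
      (Ici 0 ×ˢ univ) := hF.regular_f.continuousOn
    have h2 : ContinuousOn (fun p : ℝ × ℝ × ℝ × ℝ => g p.1 p.2.1 p.2.2.1 p.2.2.2)
      (Ici 0 ×ˢ univ) := hG.regular_f.continuousOn
    exact (h1.sub h2).mono (prod_mono Icc_subset_Ici_self le_rfl)
  · rintro t ht ⟨x, v₁, v₂⟩ hz
    by_contra hne
    by_cases h1 : f t x v₁ v₂ = 0
    · obtain ⟨a1, a2, a3⟩ := hg t ht 0 x v₁ v₂ fun h2 => hne (by simp only [h1, h2, sub_self])
      exact hz ⟨abs_le.1 a1, abs_le.1 a2, abs_le.1 a3⟩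
    · obtain ⟨a1, a2, a3⟩ := hf t ht 0 x v₁ v₂ h1
      exact hz ⟨abs_le.1 a1, abs_le.1 a2, abs_le.1 a3⟩
  · rintro ⟨x, v₁, v₂⟩
    simp only [hF.initial_f, hG.initial_f, sub_self]
  · rintro t ht ⟨x, v₁, v₂⟩ hne hext
    have ht' : t ∈ Icc 0 T := ⟨ht.1.le, ht.2⟩
    have ht0 : 0 ≤ t := ht.1.le
    obtain ⟨hx, hv₁, hv₂⟩ : |x| ≤ N ∧ |v₁| ≤ N ∧ |v₂| ≤ N := by
      by_cases h1 : f t x v₁ v₂ = 0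
      · exact hg t ht' 0 x v₁ v₂ fun h2 => hne (by simp only [h1, h2, sub_self])
      · exact hf t ht' 0 x v₁ v₂ h1
    set β := D * Real.exp (2 * C * t) with hβ
    have hβ0 : 0 ≤ β := by positivity
    have dx := hasDerivAt_eq_zero_of_isExtrOn (c := fun r => (r, v₁, v₂)) hext
      ((hF.regular_f.hasDerivAt_x ht0 x v₁ v₂).sub (hG.regular_f.hasDerivAt_x ht0 x v₁ v₂))
    have d1 := hasDerivAt_eq_zero_of_isExtrOn (c := fun r => (x, r, v₂)) hext
      ((hF.regular_f.hasDerivAt_v₁ ht0 x v₁ v₂).sub (hG.regular_f.hasDerivAt_v₁ ht0 x v₁ v₂))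
    have d2 := hasDerivAt_eq_zero_of_isExtrOn (c := fun r => (x, v₁, r)) hext
      ((hF.regular_f.hasDerivAt_v₂ ht0 x v₁ v₂).sub (hG.regular_f.hasDerivAt_v₂ ht0 x v₁ v₂))
    refine ⟨_, ?_, ((hF.regular_f.hasDerivWithinAt_t ht0 x v₁ v₂).sub
      (hG.regular_f.hasDerivWithinAt_t ht0 x v₁ v₂)).mono Icc_subset_Ici_self⟩
    have b1 : |E₁ t x - F₁ t x| ≤ β * (2 * N) ^ 2 * (2 * N + 1) :=
      hF.abs_field₁_sub_le hG ht0 hN (hf t ht') (hg t ht') (h t ht') hx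
    have bj : ∀ s ∈ Icc 0 t, ∀ y, |current₂ f s y - current₂ g s y| ≤ N * β * (2 * N) ^ 2 := by
      intro s hs y
      have hs' : s ∈ Icc 0 T := ⟨hs.1, hs.2.trans ht.2⟩
      refine abs_current₂_sub_le (f := fun _ => f s) (g := fun _ => g s) (t := s) hN (hf s hs')
        (hg s hs') (hF.regular_f.isContDensity_const hs.1)
        (hG.regular_f.isContDensity_const hs.1) (fun x v₁ v₂ => (h s hs' x v₁ v₂).trans ?_) y
      rw [hβ]
      gcongr
      exact hs.2
    have bp := hF.abs_lightRay_sub_le hG (σ := 1) (by norm_num) ht0 bj x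
    have bm := hF.abs_lightRay_sub_le hG (σ := -1) (by norm_num) ht0 bj x
    set Q := N * β * (2 * N) ^ 2 * T with hQ
    have hQ0 : 0 ≤ Q := by positivity
    have hQt : N * β * (2 * N) ^ 2 * t ≤ Q := mul_le_mul_of_nonneg_left ht.2 (by positivity)
    -- `E₂` and `B` are half the sum and half the difference of the two light-ray combinations
    have bE : |E₂ t x - F₂ t x| ≤ Q := by
      rw [abs_le] at bp bm ⊢
      constructor <;> linarith [bp.1, bp.2, bm.1, bm.2]
    have bB : |B t x - G t x| ≤ Q := by
      rw [abs_le] at bp bm ⊢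
      constructor <;> linarith [bp.1, bp.2, bm.1, bm.2]
    obtain ⟨g1, g2⟩ := hbd t ht' x (abs_le.1 hx) v₁ (abs_le.1 hv₁) v₂ (abs_le.1 hv₂)
    have vF := hF.vlasov t ht0 x v₁ v₂
    have vG := hG.vlasov t ht0 x v₁ v₂
    -- at an extremum of `f - g` the phase-space gradients of `f` and `g` agree, so that only the
    -- difference of the fields remains
    have e : timeDeriv (fun s => f s x v₁ v₂) t - timeDeriv (fun s => g s x v₁ v₂) t =
        -(((E₁ t x - F₁ t x) + v₂ * (B t x - G t x)) * deriv (fun w => g t x w v₂) v₁) -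
          ((E₂ t x - F₂ t x) - v₁ * (B t x - G t x)) * deriv (fun w => g t x v₁ w) v₂ := by
      linear_combination vF - vG - v₁ * dx - (E₁ t x + v₂ * B t x) * d1 -
        (E₂ t x - v₁ * B t x) * d2
    rw [e]
    have k1 : |((E₁ t x - F₁ t x) + v₂ * (B t x - G t x)) * deriv (fun w => g t x w v₂) v₁| ≤
        (β * (2 * N) ^ 2 * (2 * N + 1) + N * Q) * A := by
      rw [abs_mul]
      refine mul_le_mul ((abs_add_le _ _).trans (add_le_add b1 ?_)) g1 (abs_nonneg _)
        (by positivity)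
      rw [abs_mul]
      exact mul_le_mul hv₂ bB (abs_nonneg _) hN
    have k2 : |((E₂ t x - F₂ t x) - v₁ * (B t x - G t x)) * deriv (fun w => g t x v₁ w) v₂| ≤
        (Q + N * Q) * A := by
      rw [abs_mul]
      refine mul_le_mul ((abs_sub _ _).trans (add_le_add bE ?_)) g2 (abs_nonneg _) (by positivity)
      rw [abs_mul]
      exact mul_le_mul hv₁ bB (abs_nonneg _) hN
    have k3 : C * β = (β * (2 * N) ^ 2 * (2 * N + 1) + N * Q) * A + (Q + N * Q) * A := by
      rw [hC, hQ]; ring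
    rw [k3]
    exact (abs_sub _ _).trans (add_le_add (by rwa [abs_neg]) k2)

/-- Uniqueness of global classical solutions of the 1.5D Vlasov–Maxwell system. -/
theorem IsGlobalVMSolution.unique (hf0 : IsC1cDatum f0)
    (hF : IsGlobalVMSolution b f0 E20 B0 f E₁ E₂ B)
    (hG : IsGlobalVMSolution b f0 E20 B0 g F₁ F₂ G) {t : ℝ} (ht : 0 ≤ t) (x : ℝ) :
    (∀ v₁ v₂, f t x v₁ v₂ = g t x v₁ v₂) ∧ E₁ t x = F₁ t x ∧ E₂ t x = F₂ t x ∧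
      B t x = G t x := by
  obtain ⟨N₁, hN₁, hs₁⟩ := hF.exists_support hf0 t
  obtain ⟨N₂, hN₂, hs₂⟩ := hG.exists_support hf0 t
  set N := N₁ + N₂ + |x|
  have hN : 0 ≤ N := by positivity
  have hx : |x| ≤ N := by simp only [N]; linarith
  have hf : ∀ s ∈ Icc 0 t, IsConfined (fun _ => N) fun _ => f s := by
    intro s hs _ y v₁ v₂ hne
    obtain ⟨a1, a2, a3⟩ := hs₁ s hs y v₁ v₂ hne
    simp only [N]
    exact ⟨by linarith [abs_nonneg x], by linarith [abs_nonneg x], by linarith [abs_nonneg x]⟩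
  have hg : ∀ s ∈ Icc 0 t, IsConfined (fun _ => N) fun _ => g s := by
    intro s hs _ y v₁ v₂ hne
    obtain ⟨a1, a2, a3⟩ := hs₂ s hs y v₁ v₂ hne
    simp only [N]
    exact ⟨by linarith [abs_nonneg x], by linarith [abs_nonneg x], by linarith [abs_nonneg x]⟩
  obtain ⟨A, hA, hbd⟩ := hG.regular_f.exists_bound_velocity_deriv t N
  set C := A * (2 * N) ^ 2 * ((2 * N + 1) + N * t + 2 * (N * (N * t))) with hC
  have hC0 : 0 ≤ C := by positivity
  have hcont : ContinuousOn (fun p : ℝ × ℝ × ℝ × ℝ => f p.1 p.2.1 p.2.2.1 p.2.2.2 -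
      g p.1 p.2.1 p.2.2.1 p.2.2.2) (Ici 0 ×ˢ univ) :=
    hF.regular_f.continuousOn.sub hG.regular_f.continuousOn
  obtain ⟨D', hD'⟩ := (isCompact_Icc (a := (0 : ℝ)) (b := t)).prod
    ((isCompact_Icc (a := -N) (b := N)).prod ((isCompact_Icc (a := -N) (b := N)).prod
      (isCompact_Icc (a := -N) (b := N)))) |>.exists_bound_of_continuousOn
    (hcont.mono (prod_mono Icc_subset_Ici_self (subset_univ _)))
  set D := max D' 0
  have hD : 0 ≤ D := le_max_right _ _
  have hiter : ∀ n : ℕ, ∀ s ∈ Icc 0 t, ∀ y v₁ v₂,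
      |f s y v₁ v₂ - g s y v₁ v₂| ≤ D / 2 ^ n * Real.exp (2 * C * s) := by
    intro n
    induction n with
    | zero =>
      intro s hs y v₁ v₂
      have h1 : (1 : ℝ) ≤ Real.exp (2 * C * s) :=
        Real.one_le_exp (mul_nonneg (by positivity) hs.1)
      rw [pow_zero, div_one]
      refine le_trans ?_ (le_mul_of_one_le_right hD h1)
      by_cases hz : |y| ≤ N ∧ |v₁| ≤ N ∧ |v₂| ≤ N
      · exact (hD' (s, y, v₁, v₂) ⟨hs, abs_le.1 hz.1, abs_le.1 hz.2.1, abs_le.1 hz.2.2⟩).trans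
          (le_max_left _ _)
      · have e1 : f s y v₁ v₂ = 0 := by
          by_contra hne
          exact hz (hf s hs 0 y v₁ v₂ hne)
        have e2 : g s y v₁ v₂ = 0 := by
          by_contra hne
          exact hz (hg s hs 0 y v₁ v₂ hne)
        rw [e1, e2, sub_self, abs_zero]
        exact hD
    | succ n ih =>
      intro s hs y v₁ v₂
      refine (hF.abs_sub_le_half hG hN hA (by positivity) ht hf hg hbd hC ih s hs y v₁ v₂).trans
        (le_of_eq ?_)
      rw [pow_succ]
      ring
  have hzero : ∀ s ∈ Icc 0 t, ∀ y v₁ v₂, |f s y v₁ v₂ - g s y v₁ v₂| ≤ 0 := by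
    intro s hs y v₁ v₂
    have hlim : Tendsto (fun n : ℕ => D / 2 ^ n * Real.exp (2 * C * s)) atTop (𝓝 0) := by
      have := ((tendsto_pow_atTop_nhds_zero_of_lt_one (r := (1 / 2 : ℝ)) (by norm_num)
        (by norm_num)).const_mul D).mul_const (Real.exp (2 * C * s))
      simpa [div_eq_mul_inv] using this
    exact ge_of_tendsto' hlim fun n => hiter n s hs y v₁ v₂
  have htt : t ∈ Icc 0 t := ⟨ht, le_rfl⟩
  have b1 := hF.abs_field₁_sub_le hG ht hN (hf t htt) (hg t htt) (hzero t htt) hx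
  have bj : ∀ s ∈ Icc 0 t, ∀ y, |current₂ f s y - current₂ g s y| ≤ 0 := by
    intro s hs y
    have := abs_current₂_sub_le (f := fun _ => f s) (g := fun _ => g s) (t := s) hN (hf s hs)
      (hg s hs) (hF.regular_f.isContDensity_const hs.1)
      (hG.regular_f.isContDensity_const hs.1) (hzero s hs) y
    rw [mul_zero, zero_mul] at this
    exact this
  have bp := hF.abs_lightRay_sub_le hG (σ := 1) (by norm_num) ht bj x
  have bm := hF.abs_lightRay_sub_le hG (σ := -1) (by norm_num) ht bj x
  rw [zero_mul, zero_mul] at b1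
  rw [zero_mul] at bp bm
  have p := abs_nonpos_iff.1 bp
  have m := abs_nonpos_iff.1 bm
  refine ⟨fun v₁ v₂ => sub_eq_zero.1 (abs_nonpos_iff.1 (hzero t htt x v₁ v₂)),
    sub_eq_zero.1 (abs_nonpos_iff.1 b1), by linarith, by linarith⟩

end Uniqueness

/-! ### Densities carried by a flow -/

/-- Regularity, support, size and Lipschitz constant of an initial datum. -/
structure IsDatumWith (R A l : ℝ) (f0 : ℝ → ℝ → ℝ → ℝ) : Prop where
  contDiff : ContDiff ℝ 1 fun p : ℝ × ℝ × ℝ => f0 p.1 p.2.1 p.2.2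
  support : ∀ x v₁ v₂, f0 x v₁ v₂ ≠ 0 → |x| ≤ R ∧ |v₁| ≤ R ∧ |v₂| ≤ R
  bound : ∀ x v₁ v₂, |f0 x v₁ v₂| ≤ A
  lipschitz : ∀ p q : ℝ × ℝ × ℝ, |f0 p.1 p.2.1 p.2.2 - f0 q.1 q.2.1 q.2.2| ≤ l * dist p q

lemma IsC1cDatum.exists_isDatumWith {f0 : ℝ → ℝ → ℝ → ℝ} (h : IsC1cDatum f0) :
    ∃ R A l, 0 ≤ R ∧ 0 ≤ A ∧ 0 ≤ l ∧ IsDatumWith R A l f0 := by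
  obtain ⟨R, hR, hs⟩ := h.exists_support
  obtain ⟨A, hA⟩ := h.compact.exists_bound_of_continuous h.contDiff.continuous
  obtain ⟨l, hl⟩ := h.contDiff.lipschitzWith_of_hasCompactSupport h.compact one_ne_zero
  refine ⟨R, A, l, hR, (norm_nonneg _).trans (hA 0), l.2, h.contDiff, hs,
    fun x v₁ v₂ => hA (x, v₁, v₂), fun p q => ?_⟩
  have := hl.dist_le_mul p q
  rwa [Real.dist_eq] at this

/-- The density obtained from `f0` by following the backward flow in `(x, v₁)`, with `v₂` a
parameter. -/
def carried (Φ : ℝ × ℝ × ℝ → ℝ × ℝ) (f0 : ℝ → ℝ → ℝ → ℝ) (t x v₁ v₂ : ℝ) : ℝ :=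
  f0 (Φ (t, x, v₁)).1 (Φ (t, x, v₁)).2 v₂

/-- A bound at time `t` for the phase-space support of a datum supported in the cube of half-width
`R`, under a force bounded by `M`. -/
def radius (R M t : ℝ) : ℝ := R + (R + M) * |t| + 2 * M * t ^ 2

lemma continuous_radius (R M : ℝ) : Continuous (radius R M) := by
  unfold radius
  fun_prop

lemma radius_nonneg {R M : ℝ} (hR : 0 ≤ R) (hM : 0 ≤ M) (t : ℝ) : 0 ≤ radius R M t := by
  unfold radius
  positivity

lemma radius_mono {R M : ℝ} (hR : 0 ≤ R) (hM : 0 ≤ M) {s t : ℝ} (h : |s| ≤ |t|) :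
    radius R M s ≤ radius R M t := by
  have h2 : s ^ 2 ≤ t ^ 2 := sq_le_sq.2 h
  unfold radius
  gcongr

lemma le_radius {R M : ℝ} (hR : 0 ≤ R) (hM : 0 ≤ M) (t : ℝ) : R ≤ radius R M t := by
  have : 0 ≤ (R + M) * |t| + 2 * M * t ^ 2 := by positivity
  unfold radius
  linarith

section Carried

variable {R A l M : ℝ} {f0 : ℝ → ℝ → ℝ → ℝ} {K : ℝ → ℝ → ℝ} {L : ℝ → ℝ} {Φ : ℝ × ℝ × ℝ → ℝ × ℝ}

lemma carried_zero (hΦ : IsBackwardFlow K M L Φ) (x v₁ v₂ : ℝ) :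
    carried Φ f0 0 x v₁ v₂ = f0 x v₁ v₂ := by
  simp [carried, hΦ.zero]

lemma IsDatumWith.isTransported_carried (h : IsDatumWith R A l f0) (hΦ : IsBackwardFlow K M L Φ) :
    IsTransported K (carried Φ f0) := by
  have hin : ContDiff ℝ 1 fun p : ℝ × ℝ × ℝ × ℝ =>
      ((Φ (p.1, p.2.1, p.2.2.1)).1, (Φ (p.1, p.2.1, p.2.2.1)).2, p.2.2.2) := by
    have h1 : ContDiff ℝ 1 fun p : ℝ × ℝ × ℝ × ℝ => Φ (p.1, p.2.1, p.2.2.1) :=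
      hΦ.contDiff.comp (by fun_prop)
    exact h1.fst.prodMk (h1.snd.prodMk (by fun_prop))
  have hcd : ContDiff ℝ 1 fun p : ℝ × ℝ × ℝ × ℝ => carried Φ f0 p.1 p.2.1 p.2.2.1 p.2.2.2 :=
    h.contDiff.comp hin
  refine ⟨hcd, fun t x v₁ v₂ => ?_⟩
  have hΦd := (hΦ.contDiff.differentiable one_ne_zero (t, x, v₁)).hasFDerivAt
  have hline : HasDerivAt (fun s : ℝ => ((t + s, x + s * v₁, v₁ + s * K t x) : ℝ × ℝ × ℝ))
      (1, v₁, K t x) 0 :=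
    ((hasDerivAt_id (0 : ℝ)).const_add t).prodMk
      ((((hasDerivAt_id (0 : ℝ)).mul_const v₁).const_add x).congr_deriv (one_mul _) |>.prodMk
        ((((hasDerivAt_id (0 : ℝ)).mul_const (K t x)).const_add v₁).congr_deriv (one_mul _)))
  have h0 : HasDerivAt (fun s : ℝ => Φ (t + s, x + s * v₁, v₁ + s * K t x)) 0 0 := by
    have := HasFDerivAt.comp_hasDerivAt (f := fun s : ℝ =>
      ((t + s, x + s * v₁, v₁ + s * K t x) : ℝ × ℝ × ℝ)) (l := Φ)
      (l' := fderiv ℝ Φ (t, x, v₁)) 0 (by simpa using hΦd) hline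
    rwa [hΦ.transport] at this
  have h1 : HasDerivAt (fun s : ℝ => carried Φ f0 (t + s) (x + s * v₁) (v₁ + s * K t x) v₂) 0 0 := by
    have h2 := (hasDerivAt_fst_comp h0).prodMk ((hasDerivAt_snd_comp h0).prodMk
      (hasDerivAt_const (0 : ℝ) v₂))
    have h3 := (h.contDiff.differentiable one_ne_zero _).hasFDerivAt.comp_hasDerivAt (0 : ℝ) h2
    refine h3.congr_deriv ?_
    exact map_zero _
  have hline' : HasDerivAt (fun s : ℝ =>
      ((t + s, x + s * v₁, v₁ + s * K t x, v₂) : ℝ × ℝ × ℝ × ℝ)) (1, v₁, K t x, 0) 0 :=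
    ((hasDerivAt_id (0 : ℝ)).const_add t).prodMk
      ((((hasDerivAt_id (0 : ℝ)).mul_const v₁).const_add x).congr_deriv (one_mul _) |>.prodMk
        ((((hasDerivAt_id (0 : ℝ)).mul_const (K t x)).const_add v₁).congr_deriv (one_mul _) |>.prodMk
          (hasDerivAt_const _ _)))
  have h4 := HasFDerivAt.comp_hasDerivAt (f := fun s : ℝ =>
      ((t + s, x + s * v₁, v₁ + s * K t x, v₂) : ℝ × ℝ × ℝ × ℝ))
      (l := fun p : ℝ × ℝ × ℝ × ℝ => carried Φ f0 p.1 p.2.1 p.2.2.1 p.2.2.2)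
      (l' := fderiv ℝ (fun p : ℝ × ℝ × ℝ × ℝ => carried Φ f0 p.1 p.2.1 p.2.2.1 p.2.2.2)
        (t, x, v₁, v₂)) 0
      (by simpa using (hcd.differentiable one_ne_zero (t, x, v₁, v₂)).hasFDerivAt) hline'
  exact h4.unique h1

lemma IsDatumWith.isConfined_carried (h : IsDatumWith R A l f0) (hR : 0 ≤ R) (hM : 0 ≤ M)
    (hΦ : IsBackwardFlow K M L Φ) : IsConfined (radius R M) (carried Φ f0) := by
  intro t x v₁ v₂ hne
  obtain ⟨h1, h2, h3⟩ := h.support _ _ _ hne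
  have hv := hΦ.velocity t x v₁
  have hx := hΦ.position t x v₁
  have e1 : |v₁| ≤ R + M * |t| := by
    have := abs_sub_abs_le_abs_sub v₁ (Φ (t, x, v₁)).2
    rw [abs_sub_comm] at this
    linarith
  have e2 : (|v₁| + M * |t|) * |t| ≤ (R + M * |t| + M * |t|) * |t| := by gcongr
  have e3 : |x| ≤ R + (R + M * |t| + M * |t|) * |t| := by
    have := abs_sub_abs_le_abs_sub x (Φ (t, x, v₁)).1
    rw [abs_sub_comm] at this
    linarith
  have hsq : |t| * |t| = t ^ 2 := by rw [abs_mul_abs_self, sq]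
  have hMt : 0 ≤ M * |t| := by positivity
  have hRt : 0 ≤ R * |t| := by positivity
  have hMt2 : 0 ≤ M * t ^ 2 := by positivity
  have hMtt : M * |t| * |t| = M * t ^ 2 := by rw [mul_assoc, hsq]
  unfold radius
  refine ⟨?_, ?_, ?_⟩
  · linear_combination e3 + 2 * hMtt + hMt
  · linear_combination e1 + hRt + 2 * hMt2
  · linear_combination h3 + hRt + hMt + 2 * hMt2

/-- The velocity derivative of a carried density is bounded in terms of the Lipschitz constants of
the datum and of the force only. -/
lemma IsDatumWith.abs_dirDeriv_carried_le (h : IsDatumWith R A l f0) (hl : 0 ≤ l)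
    (hΦ : IsBackwardFlow K M L Φ) {T Λ : ℝ} (hΛ : ∀ t ∈ Icc 0 T, 1 + L t ≤ Λ) (hΛ0 : 0 ≤ Λ) {t : ℝ}
    (ht : t ∈ Icc 0 T) (x v₁ v₂ : ℝ) :
    |dirDeriv (carried Φ f0) (0, 0, 1, 0) t x v₁ v₂| ≤ l * Real.exp (Λ * T) := by
  have hd := (h.isTransported_carried hΦ).hasDerivAt_v₁ t x v₁ v₂
  refine hd.le_of_lip' (by positivity) (Eventually.of_forall fun w => ?_)
  have h1 := hΦ.lipschitz T Λ hΛ t ht (x, w) (x, v₁)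
  have h2 := h.lipschitz ((Φ (t, x, w)).1, (Φ (t, x, w)).2, v₂)
    ((Φ (t, x, v₁)).1, (Φ (t, x, v₁)).2, v₂)
  have h3 : dist (((Φ (t, x, w)).1, (Φ (t, x, w)).2, v₂) : ℝ × ℝ × ℝ)
      ((Φ (t, x, v₁)).1, (Φ (t, x, v₁)).2, v₂) = dist (Φ (t, x, w)) (Φ (t, x, v₁)) := by
    simp [Prod.dist_eq]
  have h4 : dist ((x, w) : ℝ × ℝ) (x, v₁) = ‖w - v₁‖ := by
    simp [Prod.dist_eq, Real.dist_eq]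
  rw [h3] at h2
  rw [h4] at h1
  rw [Real.norm_eq_abs]
  refine h2.trans ?_
  rw [mul_assoc]
  refine mul_le_mul_of_nonneg_left (h1.trans ?_) hl
  rw [mul_comm]
  gcongr
  exact ht.2

end Carried

/-! ### The self-consistent field with a cutoff -/

/-- A `C¹` cutoff `φ` of the field strength, bounded by `M` and with derivative `φ'` bounded by
`l`. -/
structure IsCutoff (φ φ' : ℝ → ℝ) (M l : ℝ) : Prop where
  hasDerivAt : ∀ s, HasDerivAt φ (φ' s) s
  cont' : Continuous φ'
  bound : ∀ s, |φ s| ≤ M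
  bound' : ∀ s, |φ' s| ≤ l

lemma IsCutoff.lipschitz {φ φ' : ℝ → ℝ} {M l : ℝ} (h : IsCutoff φ φ' M l) (a c : ℝ) :
    |φ a - φ c| ≤ l * |a - c| :=
  convex_univ.norm_image_sub_le_of_norm_hasDerivWithin_le
    (fun x _ => (h.hasDerivAt x).hasDerivWithinAt) (fun x _ => h.bound' x) (mem_univ c) (mem_univ a)

/-- There are cutoffs that leave any given range of field strengths unchanged. -/
lemma exists_cutoff (m : ℝ) : ∃ (φ φ' : ℝ → ℝ) (M l : ℝ), IsCutoff φ φ' M l ∧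
    ∀ s, |s| ≤ m → φ s = s := by
  let χ : ContDiffBump (0 : ℝ) := ⟨|m| + 1, |m| + 2, by positivity, by linarith⟩
  have hφ : ContDiff ℝ 1 fun s => s * χ s := contDiff_id.mul χ.contDiff
  have hs : HasCompactSupport fun s => s * χ s := χ.hasCompactSupport.mul_left
  obtain ⟨M, hM⟩ := hs.exists_bound_of_continuous hφ.continuous
  obtain ⟨l, hl⟩ := hs.deriv.exists_bound_of_continuous (hφ.continuous_deriv le_rfl)
  refine ⟨fun s => s * χ s, deriv fun s => s * χ s, M, l,
    ⟨fun s => (hφ.differentiable one_ne_zero s).hasDerivAt, hφ.continuous_deriv le_rfl, hM, hl⟩,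
    fun s hs => ?_⟩
  have h1 : χ s = 1 := χ.one_of_mem_closedBall (by
    rw [mem_closedBall_zero_iff, Real.norm_eq_abs]
    exact hs.trans ((le_abs_self m).trans (by simp [χ])))
  simp [h1]

/-- Confined continuous densities of size at most `A`. -/
structure IsAdmissible (R M A : ℝ) (f : ℝ → ℝ → ℝ → ℝ → ℝ) : Prop where
  confined : IsConfined (radius R M) f
  cont : IsContDensity f
  bound : ∀ t x v₁ v₂, |f t x v₁ v₂| ≤ A

/-- The field of `f`, cut off by `φ`, and frozen at its initial value for negative times. -/
def force (φ b : ℝ → ℝ) (f : ℝ → ℝ → ℝ → ℝ → ℝ) (t x : ℝ) : ℝ := φ (efield b f (max t 0) x)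

lemma force_congr {φ b : ℝ → ℝ} {f g : ℝ → ℝ → ℝ → ℝ → ℝ} (h : ∀ t ≥ 0, f t = g t) :
    force φ b f = force φ b g := by
  funext t x
  have := h (max t 0) (le_max_right _ _)
  simp only [force, efield, chargeDensity, this]

/-- Hypotheses on the data of the self-consistent problem. -/
structure IsVPData (R A l M lφ Bb : ℝ) (b φ φ' : ℝ → ℝ) (f0 : ℝ → ℝ → ℝ → ℝ) : Prop where
  R_nonneg : 0 ≤ R
  l_nonneg : 0 ≤ l
  datum : IsDatumWith R A l f0
  cutoff : IsCutoff φ φ' M lφ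
  b_cont : Continuous b
  b_support : ∀ y, b y ≠ 0 → |y| ≤ R
  b_bound : ∀ y, |b y| ≤ Bb

section Iteration

variable {R A l M lφ Bb : ℝ} {b φ φ' : ℝ → ℝ} {f0 : ℝ → ℝ → ℝ → ℝ}

/-- A bound at time `t` for `∂ₓ` of the force of an admissible density. -/
def forceLip (R M A lφ Bb t : ℝ) : ℝ := lφ * (A * (2 * radius R M (max t 0)) ^ 2 + Bb)

namespace IsVPData

lemma M_nonneg (h : IsVPData R A l M lφ Bb b φ φ' f0) : 0 ≤ M :=
  (abs_nonneg _).trans (h.cutoff.bound 0)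

lemma lφ_nonneg (h : IsVPData R A l M lφ Bb b φ φ' f0) : 0 ≤ lφ :=
  (abs_nonneg _).trans (h.cutoff.bound' 0)

lemma A_nonneg (h : IsVPData R A l M lφ Bb b φ φ' f0) : 0 ≤ A :=
  (abs_nonneg _).trans (h.datum.bound 0 0 0)

lemma background (h : IsVPData R A l M lφ Bb b φ φ' f0) : IsConfinedBackground (radius R M) b :=
  fun t y hy => (h.b_support y hy).trans (le_radius h.R_nonneg h.M_nonneg t)

lemma isForce (h : IsVPData R A l M lφ Bb b φ φ' f0) {f : ℝ → ℝ → ℝ → ℝ → ℝ}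
    (hf : IsAdmissible R M A f) :
    IsForce (force φ b f)
      (fun t x => φ' (efield b f (max t 0) x) * chargeDensity b f (max t 0) x) M
      (forceLip R M A lφ Bb) := by
  have hr := continuous_radius R M
  have hE : Continuous fun q : ℝ × ℝ => efield b f (max q.1 0) q.2 :=
    (continuous_efield h.b_cont h.background hr hf.confined hf.cont).comp
      (f := fun q : ℝ × ℝ => (max q.1 0, q.2)) (by fun_prop)
  have hρ : Continuous fun q : ℝ × ℝ => chargeDensity b f (max q.1 0) q.2 :=
    (continuous_chargeDensity h.b_cont hr hf.confined hf.cont).comp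
      (f := fun q : ℝ × ℝ => (max q.1 0, q.2)) (by fun_prop)
  have hφ : Continuous φ := continuous_iff_continuousAt.2 fun s => (h.cutoff.hasDerivAt s).continuousAt
  refine ⟨hφ.comp hE, (h.cutoff.cont'.comp hE).mul hρ, fun t x => ?_, fun t x => h.cutoff.bound _,
    fun t x => ?_, ?_⟩
  · exact (h.cutoff.hasDerivAt _).comp x
      (hasDerivAt_efield h.b_cont h.background hr hf.confined hf.cont _ x)
  · rw [abs_mul]
    exact mul_le_mul (h.cutoff.bound' _) (abs_chargeDensity_le (radius_nonneg h.R_nonneg h.M_nonneg)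
      hf.confined (hf.bound _) h.b_bound x) (abs_nonneg _) h.lφ_nonneg
  · unfold forceLip
    have : Continuous fun t : ℝ => radius R M (max t 0) := hr.comp (by fun_prop)
    fun_prop

/-- `g` is carried from the datum by the flow of the force of `f`. -/
def Step (R A M lφ Bb : ℝ) (b φ : ℝ → ℝ) (f0 : ℝ → ℝ → ℝ → ℝ) (f g : ℝ → ℝ → ℝ → ℝ → ℝ) : Prop :=
  ∃ Φ, IsBackwardFlow (force φ b f) M (forceLip R M A lφ Bb) Φ ∧ g = carried Φ f0

lemma exists_step (h : IsVPData R A l M lφ Bb b φ φ' f0) {f : ℝ → ℝ → ℝ → ℝ → ℝ}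
    (hf : IsAdmissible R M A f) :
    ∃ g, IsAdmissible R M A g ∧ Step R A M lφ Bb b φ f0 f g := by
  obtain ⟨Φ, hΦ⟩ := (h.isForce hf).exists_backwardFlow
  exact ⟨carried Φ f0, ⟨h.datum.isConfined_carried h.R_nonneg h.M_nonneg hΦ,
    (h.datum.isTransported_carried hΦ).isContDensity, fun t x v₁ v₂ => h.datum.bound _ _ _⟩,
    Φ, hΦ, rfl⟩

/-- On `[0, T]`, in the norm with weight `exp (-2Ct)`, a step halves distances. -/
def StepContracts (R A M lφ Bb : ℝ) (b φ : ℝ → ℝ) (f0 : ℝ → ℝ → ℝ → ℝ) (T C : ℝ) : Prop :=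
  ∀ f₁ f₂ g₁ g₂ : ℝ → ℝ → ℝ → ℝ → ℝ, IsAdmissible R M A f₁ → IsAdmissible R M A f₂ →
    Step R A M lφ Bb b φ f0 f₁ g₁ → Step R A M lφ Bb b φ f0 f₂ g₂ → ∀ D, 0 ≤ D →
    (∀ t ∈ Icc 0 T, ∀ x v₁ v₂, |f₁ t x v₁ v₂ - f₂ t x v₁ v₂| ≤ D * Real.exp (2 * C * t)) →
    ∀ t ∈ Icc 0 T, ∀ x v₁ v₂, |g₁ t x v₁ v₂ - g₂ t x v₁ v₂| ≤ D * Real.exp (2 * C * t) / 2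

/-- The forces of two densities differ by at most a multiple of the densities, and the maximum
principle turns the forcing into a gain. -/
lemma step_contracts (h : IsVPData R A l M lφ Bb b φ φ' f0) {T : ℝ} (hT : 0 ≤ T) :
    ∃ C, 0 ≤ C ∧ StepContracts R A M lφ Bb b φ f0 T C := by
  have hR := h.R_nonneg
  have hM := h.M_nonneg
  have hA := h.A_nonneg
  have hlφ := h.lφ_nonneg
  have hl := h.l_nonneg
  have hBb : 0 ≤ Bb := (abs_nonneg _).trans (h.b_bound 0)
  have hr := continuous_radius R M
  have hr0 := radius_nonneg hR hM
  have hrT : ∀ t ∈ Icc 0 T, radius R M t ≤ radius R M T := fun t ht =>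
    radius_mono hR hM (by rw [abs_of_nonneg ht.1, abs_of_nonneg hT]; exact ht.2)
  have hrT0 := hr0 T
  set Λ := 1 + lφ * (A * (2 * radius R M T) ^ 2 + Bb) with hΛdef
  have hΛ0 : 0 ≤ Λ := by positivity
  have hΛ : ∀ t ∈ Icc 0 T, 1 + forceLip R M A lφ Bb t ≤ Λ := by
    intro t ht
    have h1 := hrT t ht
    have h2 := hr0 t
    rw [forceLip, max_eq_left ht.1, hΛdef]
    gcongr
  set C := lφ * (2 * radius R M T) ^ 3 * (l * Real.exp (Λ * T)) with hC
  have hC0 : 0 ≤ C := by positivity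
  refine ⟨C, hC0, ?_⟩
  rintro f₁ f₂ g₁ g₂ hf₁ hf₂ ⟨Φ₁, hΦ₁, rfl⟩ ⟨Φ₂, hΦ₂, rfl⟩ D hD hclose
  have t₁ := h.datum.isTransported_carried hΦ₁
  have t₂ := h.datum.isTransported_carried hΦ₂
  have c₁ := h.datum.isConfined_carried hR hM hΦ₁
  have c₂ := h.datum.isConfined_carried hR hM hΦ₂
  have hsupp : ∀ t ∈ Icc 0 T, ∀ x v₁ v₂,
      carried Φ₁ f0 t x v₁ v₂ - carried Φ₂ f0 t x v₁ v₂ ≠ 0 →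
      |x| ≤ radius R M T ∧ |v₁| ≤ radius R M T ∧ |v₂| ≤ radius R M T := by
    intro t ht x v₁ v₂ hne
    obtain ⟨a1, a2, a3⟩ : |x| ≤ radius R M t ∧ |v₁| ≤ radius R M t ∧ |v₂| ≤ radius R M t := by
      by_cases h1 : carried Φ₁ f0 t x v₁ v₂ = 0
      · exact c₂ _ _ _ _ fun h2 => hne (by rw [h1, h2, sub_self])
      · exact c₁ _ _ _ _ h1
    exact ⟨a1.trans (hrT t ht), a2.trans (hrT t ht), a3.trans (hrT t ht)⟩
  set N := radius R M T
  have key := abs_le_half_exp_of_deriv_le_at_extr (T := T) (C := C) (D := D)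
    (h := fun t (z : ℝ × ℝ × ℝ) => carried Φ₁ f0 t z.1 z.2.1 z.2.2 -
      carried Φ₂ f0 t z.1 z.2.1 z.2.2)
    (k := Icc (-N) N ×ˢ Icc (-N) N ×ˢ Icc (-N) N)
    (t₁.isContDensity.sub t₂.isContDensity).continuousOn
    (isCompact_Icc.prod (isCompact_Icc.prod isCompact_Icc)) hD ?_ ?_ ?_
  · exact fun t ht x v₁ v₂ => key t ht (x, v₁, v₂)
  · rintro t ht ⟨x, v₁, v₂⟩ hz
    by_contra hne
    obtain ⟨a1, a2, a3⟩ := hsupp t ht x v₁ v₂ hne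
    exact hz ⟨abs_le.1 a1, abs_le.1 a2, abs_le.1 a3⟩
  · rintro ⟨x, v₁, v₂⟩
    simp only [carried_zero hΦ₁, carried_zero hΦ₂, sub_self]
  · rintro t ht ⟨x, v₁, v₂⟩ - hext
    have ht' : t ∈ Icc 0 T := ⟨ht.1.le, ht.2⟩
    set β := D * Real.exp (2 * C * t)
    have hβ : 0 ≤ β := by positivity
    have dx := hasDerivAt_eq_zero_of_isExtrOn (c := fun r => (r, v₁, v₂)) hext
      ((t₁.hasDerivAt_x t x v₁ v₂).sub (t₂.hasDerivAt_x t x v₁ v₂))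
    have d1 := hasDerivAt_eq_zero_of_isExtrOn (c := fun r => (x, r, v₂)) hext
      ((t₁.hasDerivAt_v₁ t x v₁ v₂).sub (t₂.hasDerivAt_v₁ t x v₁ v₂))
    refine ⟨_, ?_, ((t₁.hasDerivAt_t t x v₁ v₂).sub (t₂.hasDerivAt_t t x v₁ v₂)).hasDerivWithinAt⟩
    -- at an extremum of the difference the gradients in `(x, v₁)` agree
    have e : dirDeriv (carried Φ₁ f0) (1, 0, 0, 0) t x v₁ v₂ -
        dirDeriv (carried Φ₂ f0) (1, 0, 0, 0) t x v₁ v₂ =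
        -((force φ b f₁ t x - force φ b f₂ t x) *
          dirDeriv (carried Φ₂ f0) (0, 0, 1, 0) t x v₁ v₂) := by
      linear_combination t₁.vlasov' t x v₁ v₂ - t₂.vlasov' t x v₁ v₂ - v₁ * dx -
        force φ b f₁ t x * d1
    rw [e, abs_neg, abs_mul]
    have k1 : |force φ b f₁ t x - force φ b f₂ t x| ≤ lφ * (β * (2 * N) ^ 3) := by
      rw [force, force, max_eq_left ht'.1]
      refine (h.cutoff.lipschitz _ _).trans (mul_le_mul_of_nonneg_left ?_ hlφ)
      refine (abs_efield_sub_le h.b_cont h.background hr hr0 hf₁.confined hf₂.confined hf₁.cont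
        hf₂.cont (hclose t ht') x).trans ?_
      have := hr0 t
      have := hrT t ht'
      gcongr
    have k2 := h.datum.abs_dirDeriv_carried_le hl hΦ₂ hΛ hΛ0 ht' x v₁ v₂
    refine (mul_le_mul k1 k2 (abs_nonneg _) (by positivity)).trans (le_of_eq ?_)
    rw [hC]
    ring

/-- The iteration has a fixed point: a density carried by the flow of its own (cut off) field. -/
theorem exists_selfConsistent (h : IsVPData R A l M lφ Bb b φ φ' f0) :
    ∃ f Φ, IsBackwardFlow (force φ b f) M (forceLip R M A lφ Bb) Φ ∧ f = carried Φ f0 := by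
  have hR := h.R_nonneg
  have hM := h.M_nonneg
  let Adm := {f : ℝ → ℝ → ℝ → ℝ → ℝ // IsAdmissible R M A f}
  choose S hSa hS using fun f : Adm => h.exists_step f.2
  have hstart : IsAdmissible R M A fun _ => f0 := by
    refine ⟨fun t x v₁ v₂ hne => ?_, h.datum.contDiff.continuous.comp continuous_snd,
      fun _ => h.datum.bound⟩
    obtain ⟨a1, a2, a3⟩ := h.datum.support _ _ _ hne
    have := le_radius hR hM t
    exact ⟨a1.trans this, a2.trans this, a3.trans this⟩
  let u : ℕ → Adm := fun n => Nat.rec ⟨fun _ => f0, hstart⟩ (fun _ f => ⟨S f, hSa f⟩) n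
  have hgeo : ∀ T, 0 ≤ T → ∃ C, 0 ≤ C ∧ StepContracts R A M lφ Bb b φ f0 T C ∧
      ∀ n, ∀ t ∈ Icc 0 T, ∀ x v₁ v₂, dist ((u n).1 t x v₁ v₂) ((u (n + 1)).1 t x v₁ v₂) ≤
        2 * A * Real.exp (2 * C * T) * (1 / 2) ^ n := by
    intro T hT
    obtain ⟨C, hC, hcon⟩ := h.step_contracts hT
    refine ⟨C, hC, hcon, ?_⟩
    have hA := h.A_nonneg
    have key : ∀ n : ℕ, ∀ t ∈ Icc 0 T, ∀ x v₁ v₂,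
        |(u n).1 t x v₁ v₂ - (u (n + 1)).1 t x v₁ v₂| ≤
          2 * A * (1 / 2) ^ n * Real.exp (2 * C * t) := by
      intro n
      induction n with
      | zero =>
        intro t ht x v₁ v₂
        have h1 : (1 : ℝ) ≤ Real.exp (2 * C * t) :=
          Real.one_le_exp (mul_nonneg (by positivity) ht.1)
        have h2 := abs_sub ((u 0).1 t x v₁ v₂) ((u (0 + 1)).1 t x v₁ v₂)
        have h3 := (u 0).2.bound t x v₁ v₂
        have h4 := (u (0 + 1)).2.bound t x v₁ v₂
        refine le_trans (b := 2 * A * (1 / 2) ^ 0) (by rw [pow_zero, mul_one]; linarith) ?_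
        exact le_mul_of_one_le_right (by positivity) h1
      | succ n ih =>
        intro t ht x v₁ v₂
        refine (hcon _ _ _ _ (u n).2 (u (n + 1)).2 (hS (u n)) (hS (u (n + 1))) _ (by positivity) ih
          t ht x v₁ v₂).trans (le_of_eq ?_)
        rw [pow_succ]
        ring
    intro n t ht x v₁ v₂
    rw [Real.dist_eq]
    refine (key n t ht x v₁ v₂).trans ?_
    rw [mul_right_comm]
    gcongr
    exact ht.2
  obtain ⟨G, hGc, hG⟩ := exists_continuous_limit_of_geometric
    (u := fun n (p : ℝ × ℝ × ℝ × ℝ) => (u n).1 (max p.1 0) p.2.1 p.2.2.1 p.2.2.2)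
    (fun n => (u n).2.cont.comp (by fun_prop) (by fun_prop) (by fun_prop) (by fun_prop)) (by
      intro p
      obtain ⟨C, -, -, hd⟩ := hgeo (|p.1| + 1) (by positivity)
      refine ⟨{q | q.1 < |p.1| + 1}, (isOpen_lt continuous_fst continuous_const).mem_nhds
        (show p.1 < |p.1| + 1 by linarith [le_abs_self p.1]),
        2 * A * Real.exp (2 * C * (|p.1| + 1)), fun q hq n => ?_⟩
      exact hd n _ ⟨le_max_right _ _, max_le (le_of_lt hq) (by positivity)⟩ _ _ _)
  have hGa : IsAdmissible R M A fun t x v₁ v₂ => G (t, x, v₁, v₂) := by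
    refine ⟨fun t x v₁ v₂ hne => ?_, hGc, fun t x v₁ v₂ => ?_⟩
    · obtain ⟨n, hn⟩ := ((hG (t, x, v₁, v₂)).eventually_ne hne).exists
      obtain ⟨a1, a2, a3⟩ := (u n).2.confined _ _ _ _ hn
      have : radius R M (max t 0) ≤ radius R M t := radius_mono hR hM (by
        rw [abs_of_nonneg (le_max_right _ _)]
        exact max_le (le_abs_self t) (abs_nonneg t))
      exact ⟨a1.trans this, a2.trans this, a3.trans this⟩
    · exact le_of_tendsto' ((hG (t, x, v₁, v₂)).abs) fun n => (u n).2.bound _ _ _ _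
  let g : Adm := ⟨fun t x v₁ v₂ => G (t, x, v₁, v₂), hGa⟩
  have hfix : ∀ t ≥ 0, g.1 t = S g t := by
    intro t ht
    obtain ⟨C, hC, hcon, hd⟩ := hgeo t ht
    set D := 2 * A * Real.exp (2 * C * t)
    have hlim : Tendsto (fun n : ℕ => D * (1 / 2 : ℝ) ^ n / (1 - 1 / 2)) atTop (𝓝 0) := by
      have := ((tendsto_pow_atTop_nhds_zero_of_lt_one (r := (1 / 2 : ℝ)) (by norm_num)
        (by norm_num)).const_mul D).div_const (1 - 1 / 2)
      simpa using this
    have hA := h.A_nonneg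
    have hclose : ∀ n, ∀ s ∈ Icc 0 t, ∀ x v₁ v₂, |(u n).1 s x v₁ v₂ - g.1 s x v₁ v₂| ≤
        D * (1 / 2 : ℝ) ^ n / (1 - 1 / 2) * Real.exp (2 * C * s) := by
      intro n s hs x v₁ v₂
      have h1 : (1 : ℝ) ≤ Real.exp (2 * C * s) :=
        Real.one_le_exp (mul_nonneg (by positivity) hs.1)
      have h2 := hG (s, x, v₁, v₂)
      simp only [max_eq_left hs.1] at h2
      have h3 := dist_le_of_le_geometric_of_tendsto (1 / 2) D (by norm_num)
        (fun n => hd n s hs x v₁ v₂) h2 n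
      rw [Real.dist_eq] at h3
      exact h3.trans (le_mul_of_one_le_right ((abs_nonneg _).trans h3) h1)
    funext x v₁ v₂
    have h1 : Tendsto (fun n => (u (n + 1)).1 t x v₁ v₂) atTop (𝓝 (g.1 t x v₁ v₂)) := by
      have := (hG (t, x, v₁, v₂)).comp (tendsto_add_atTop_nat 1)
      simp only [max_eq_left (show (0 : ℝ) ≤ t from ht)] at this
      exact this
    refine tendsto_nhds_unique h1 ?_
    rw [tendsto_iff_norm_sub_tendsto_zero]
    refine squeeze_zero (fun _ => norm_nonneg _) (fun n => hcon _ _ _ _ (u n).2 g.2 (hS (u n)) (hS g)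
      _ ?_ (hclose n) t ⟨ht, le_rfl⟩ x v₁ v₂) ?_
    · have : (0 : ℝ) ≤ 1 - 1 / 2 := by norm_num
      positivity
    · simpa using (hlim.mul_const (Real.exp (2 * C * t))).div_const 2
  obtain ⟨Φ, hΦ, hΦ'⟩ := hS g
  -- `g` and `S g` agree only for `t ≥ 0`, which suffices since `force` ignores negative times
  refine ⟨S g, Φ, ?_, hΦ'⟩
  rwa [← force_congr hfix]

end IsVPData

end Iteration

/-! ### Removing the cutoff -/

/-- The total charge of an initial datum, without background. -/
def totalMass (F0 : ℝ → ℝ → ℝ → ℝ) : ℝ := ∫ y, ∫ v : ℝ × ℝ, F0 y v.1 v.2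

/-- Conservation of mass bounds the field of a density by the mass of any nonnegative density that
dominates it and is carried by the same flow. -/
lemma abs_efield_le_of_dominated {r : ℝ → ℝ} {b : ℝ → ℝ} {f F : ℝ → ℝ → ℝ → ℝ → ℝ}
    {K : ℝ → ℝ → ℝ} (hr : Continuous r) (hbc : Continuous b) (hb : IsConfinedBackground r b)
    (hf : IsConfined r f) (hfc : IsContDensity f) (hF : IsConfined r F) (hFt : IsTransported K F)
    (hdom : ∀ t x v₁ v₂, |f t x v₁ v₂| ≤ F t x v₁ v₂) {t : ℝ} (ht : 0 ≤ t) (x : ℝ) :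
    |efield b f t x| ≤ totalMass (F 0) + ∫ y, |b y| := by
  have hb0 : IsConfinedBackground r (0 : ℝ → ℝ) := fun _ _ h => absurd rfl h
  have hFc := hFt.isContDensity
  have hi : ∀ {f}, IsConfined r f → IsContDensity f → ∀ y,
      Integrable fun v : ℝ × ℝ => f t y v.1 v.2 := fun hf hc y =>
    (hf.locallyCompactSupport_one hr).integrable (t, y)
      (hc.comp (by fun_prop) (by fun_prop) (by fun_prop) (by fun_prop))
  have hbi : Integrable b := by
    refine hbc.integrable_of_hasCompactSupport (HasCompactSupport.intro
      (isCompact_Icc (a := -r 0) (b := r 0)) fun y hy => ?_)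
    by_contra hne
    exact hy (abs_le.1 (hb 0 y hne))
  have hρF : Integrable (chargeDensity 0 F t) :=
    integrable_chargeDensity continuous_zero hb0 hr hF hFc t
  have hρf := integrable_chargeDensity hbc hb hr hf hfc t
  have hpt : ∀ y, |chargeDensity b f t y| ≤ chargeDensity 0 F t y + |b y| := by
    intro y
    have h1 : |∫ v : ℝ × ℝ, f t y v.1 v.2| ≤ ∫ v : ℝ × ℝ, F t y v.1 v.2 := by
      rw [← Real.norm_eq_abs]
      exact norm_integral_le_of_norm_le (hi hF hFc y) (ae_of_all _ fun v => hdom t y v.1 v.2)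
    have h2 : chargeDensity 0 F t y = ∫ v : ℝ × ℝ, F t y v.1 v.2 := by simp [chargeDensity]
    rw [h2]
    exact (abs_sub _ _).trans (by gcongr)
  -- the mass of `F` is read off at a point to the right of all supports up to time `t`
  obtain ⟨N, hN⟩ := (isCompact_Icc (a := (0 : ℝ)) (b := t)).exists_bound_of_continuousOn
    hr.continuousOn
  have hN' : ∀ s ∈ Icc 0 t, r s < |N| + 1 := fun s hs =>
    ((le_abs_self _).trans (hN s hs)).trans_lt (by linarith [le_abs_self N])
  have hpos : (0 : ℝ) ≤ |N| + 1 := by positivity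
  have hmass : ∫ y, chargeDensity 0 F t y = totalMass (F 0) := by
    rw [← efield_eq_integral hF hb0 (hN' t ⟨ht, le_rfl⟩),
      efield_eq_initial (b := (0 : ℝ → ℝ)) continuous_zero hb0 hFt hr hF ht (x := |N| + 1)
        (by rwa [abs_of_nonneg hpos]), efield_eq_integral hF hb0 (hN' 0 ⟨le_rfl, ht⟩)]
    simp [totalMass, chargeDensity]
  calc |efield b f t x| ≤ ∫ y in Iic x, |chargeDensity b f t y| :=
        norm_integral_le_integral_norm (μ := volume.restrict (Iic x)) (chargeDensity b f t)
    _ ≤ ∫ y, |chargeDensity b f t y| :=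
        setIntegral_le_integral hρf.abs (ae_of_all _ fun y => abs_nonneg _)
    _ ≤ ∫ y, (chargeDensity 0 F t y + |b y|) := integral_mono hρf.abs (hρF.add hbi.abs) hpt
    _ = totalMass (F 0) + ∫ y, |b y| := by rw [integral_add hρF hbi.abs, hmass]

/-- A compactly supported datum is dominated by a multiple of a bump function. -/
lemma IsDatumWith.exists_dominating {R A l : ℝ} {f0 : ℝ → ℝ → ℝ → ℝ} (h : IsDatumWith R A l f0)
    (hR : 0 ≤ R) : ∃ F0 R' A' l', R ≤ R' ∧ IsDatumWith R' A' l' F0 ∧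
      ∀ x v₁ v₂, |f0 x v₁ v₂| ≤ F0 x v₁ v₂ := by
  have hA : 0 ≤ A := (abs_nonneg _).trans (h.bound 0 0 0)
  let χ : ContDiffBump (0 : ℝ × ℝ × ℝ) := ⟨R + 1, R + 2, by positivity, by linarith⟩
  have hcd : ContDiff ℝ 1 fun p : ℝ × ℝ × ℝ => A * χ p := contDiff_const.mul χ.contDiff
  have hs : HasCompactSupport fun p : ℝ × ℝ × ℝ => A * χ p := χ.hasCompactSupport.mul_left
  have hdat : IsC1cDatum fun x v₁ v₂ => A * χ (x, v₁, v₂) := ⟨hcd, hs⟩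
  obtain ⟨R', A', l', -, -, -, hF⟩ := hdat.exists_isDatumWith
  refine ⟨fun x v₁ v₂ => A * χ (x, v₁, v₂), max R R', A', l', le_max_left _ _,
    ⟨hF.contDiff, fun x v₁ v₂ hne => ?_, hF.bound, hF.lipschitz⟩, fun x v₁ v₂ => ?_⟩
  · obtain ⟨a1, a2, a3⟩ := hF.support _ _ _ hne
    have := le_max_right R R'
    exact ⟨a1.trans this, a2.trans this, a3.trans this⟩
  · by_cases hne : f0 x v₁ v₂ = 0
    · rw [hne, abs_zero]
      exact mul_nonneg hA χ.nonneg
    · obtain ⟨a1, a2, a3⟩ := h.support _ _ _ hne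
      have h1 : χ (x, v₁, v₂) = 1 := χ.one_of_mem_closedBall (by
        rw [mem_closedBall_zero_iff]
        have : ‖((x, v₁, v₂) : ℝ × ℝ × ℝ)‖ ≤ R := norm_prod_le_iff.2 ⟨a1, norm_prod_le_iff.2 ⟨a2, a3⟩⟩
        exact this.trans (by simp [χ]))
      dsimp only
      rw [h1, mul_one]
      exact h.bound x v₁ v₂

/-- Global existence for the one-dimensional Vlasov–Poisson system with parameter `v₂`: there is a
density carried by the flow of its own field. -/
theorem exists_vlasovPoisson {b : ℝ → ℝ} (hb : Continuous b) (hbc : HasCompactSupport b)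
    {f0 : ℝ → ℝ → ℝ → ℝ} (hf0 : IsC1cDatum f0) :
    ∃ (R M : ℝ) (K : ℝ → ℝ → ℝ) (L : ℝ → ℝ) (Φ : ℝ × ℝ × ℝ → ℝ × ℝ), 0 ≤ R ∧ 0 ≤ M ∧
      IsBackwardFlow K M L Φ ∧ IsConfinedBackground (radius R M) b ∧
      IsTransported K (carried Φ f0) ∧ IsConfined (radius R M) (carried Φ f0) ∧
      ∀ t ≥ 0, ∀ x, K t x = efield b (carried Φ f0) t x := by
  obtain ⟨R₀, A, l, hR₀, -, hl, hd⟩ := hf0.exists_isDatumWith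
  obtain ⟨F0, R₁, A₁, l₁, hR₁, hF, hdom⟩ := hd.exists_dominating hR₀
  obtain ⟨Rb, hRb⟩ := hbc.isCompact.isBounded.subset_closedBall (0 : ℝ)
  obtain ⟨Bb, hBb⟩ := hbc.exists_bound_of_continuous hb
  set R := max R₁ Rb
  have hR : 0 ≤ R := (hR₀.trans hR₁).trans (le_max_left _ _)
  obtain ⟨φ, φ', M, lφ, hφ, hid⟩ := exists_cutoff (totalMass F0 + ∫ y, |b y|)
  have hdata : IsVPData R A l M lφ Bb b φ φ' f0 := by
    refine ⟨hR, hl, ⟨hd.contDiff, fun x v₁ v₂ hne => ?_, hd.bound, hd.lipschitz⟩, hφ, hb,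
      fun y hy => ?_, hBb⟩
    · obtain ⟨a1, a2, a3⟩ := hd.support _ _ _ hne
      have : R₀ ≤ R := hR₁.trans (le_max_left _ _)
      exact ⟨a1.trans this, a2.trans this, a3.trans this⟩
    · have h1 := hRb (subset_tsupport b hy)
      rw [mem_closedBall_zero_iff] at h1
      exact h1.trans (le_max_right _ _)
  have hF' : IsDatumWith R A₁ l₁ F0 := by
    refine ⟨hF.contDiff, fun x v₁ v₂ hne => ?_, hF.bound, hF.lipschitz⟩
    obtain ⟨a1, a2, a3⟩ := hF.support _ _ _ hne
    have : R₁ ≤ R := le_max_left _ _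
    exact ⟨a1.trans this, a2.trans this, a3.trans this⟩
  have hM := hdata.M_nonneg
  obtain ⟨f, Φ, hΦ, rfl⟩ := hdata.exists_selfConsistent
  have hft := hdata.datum.isTransported_carried hΦ
  have hfc := hdata.datum.isConfined_carried hR hM hΦ
  refine ⟨R, M, _, _, Φ, hR, hM, hΦ, hdata.background, hft, hfc, fun t ht x => ?_⟩
  rw [force, max_eq_left ht]
  apply hid
  have h0 : totalMass F0 = totalMass (carried Φ F0 0) := by
    simp only [totalMass, carried_zero hΦ]
  rw [h0]
  exact abs_efield_le_of_dominated (continuous_radius R M) hb hdata.background hfc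
    hft.isContDensity (hF'.isConfined_carried hR hM hΦ) (hF'.isTransported_carried hΦ)
    (fun t x v₁ v₂ => hdom _ _ _) ht x

/-! ### The Vlasov–Poisson solution as a Vlasov–Maxwell solution -/

/-- An even density has no transverse current, by the reflection `v₂ ↦ -v₂`. -/
lemma current₂_eq_zero_of_even {f : ℝ → ℝ → ℝ → ℝ → ℝ} {t x : ℝ}
    (h : ∀ v₁ v₂, f t x v₁ v₂ = f t x v₁ (-v₂)) : current₂ f t x = 0 := by
  have h1 : MeasurePreserving (Prod.map id Neg.neg : ℝ × ℝ → ℝ × ℝ) volume volume :=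
    (MeasurePreserving.id volume).prod (Measure.measurePreserving_neg volume)
  have h2 : MeasurableEmbedding (Prod.map id Neg.neg : ℝ × ℝ → ℝ × ℝ) :=
    ((MeasurableEquiv.refl ℝ).prodCongr (MeasurableEquiv.neg ℝ)).measurableEmbedding
  have h3 := h1.integral_comp h2 fun v : ℝ × ℝ => v.2 * f t x v.1 v.2
  have h4 : ∀ v : ℝ × ℝ, (Prod.map id Neg.neg v).2 * f t x (Prod.map id Neg.neg v).1
      (Prod.map id Neg.neg v).2 = -(v.2 * f t x v.1 v.2) := fun v => by
    simp only [Prod.map_snd, Prod.map_fst, id, ← h v.1 v.2]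
    ring
  simp_rw [h4] at h3
  rw [integral_neg] at h3
  unfold current₂
  linarith

lemma IsNeutral.integral_chargeDensity_eq_zero {b : ℝ → ℝ} {f0 : ℝ → ℝ → ℝ → ℝ}
    (h : IsNeutral b f0) (hb : Continuous b) (hbc : HasCompactSupport b) (hf0 : IsC1cDatum f0)
    {f : ℝ → ℝ → ℝ → ℝ → ℝ} (hf : f 0 = f0) : ∫ y, chargeDensity b f 0 y = 0 := by
  have h1 : Integrable fun p : ℝ × ℝ × ℝ => f0 p.1 p.2.1 p.2.2 :=
    hf0.contDiff.continuous.integrable_of_hasCompactSupport hf0.compact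
  have h2 : Integrable b := hb.integrable_of_hasCompactSupport hbc
  have h3 : ∫ p : ℝ × ℝ × ℝ, f0 p.1 p.2.1 p.2.2 = ∫ y, ∫ v : ℝ × ℝ, f0 y v.1 v.2 :=
    integral_prod _ h1
  unfold chargeDensity
  rw [hf, integral_sub h1.integral_prod_left h2, ← h3, h, sub_self]

/-- By conservation of charge and neutrality, the field vanishes outside the support. -/
lemma tendsto_efield_cocompact {r : ℝ → ℝ} {b : ℝ → ℝ} {f : ℝ → ℝ → ℝ → ℝ → ℝ}
    {K : ℝ → ℝ → ℝ} (hr : Continuous r) (hbc : Continuous b) (hb : IsConfinedBackground r b)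
    (hf : IsConfined r f) (hft : IsTransported K f) (h0 : ∫ y, chargeDensity b f 0 y = 0) {t : ℝ}
    (ht : 0 ≤ t) : Tendsto (efield b f t) (cocompact ℝ) (𝓝 0) := by
  obtain ⟨N, hN⟩ := (isCompact_Icc (a := (0 : ℝ)) (b := t)).exists_bound_of_continuousOn
    hr.continuousOn
  refine tendsto_const_nhds.congr' ?_
  filter_upwards [(isCompact_Icc (a := -N) (b := N)).compl_mem_cocompact] with x hx
  have hxN : N < |x| := by
    by_contra hcon
    exact hx (abs_le.1 (not_lt.1 hcon))
  have hs : ∀ s ∈ Icc 0 t, r s < |x| := fun s hs =>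
    ((le_abs_self _).trans (hN s hs)).trans_lt hxN
  rcases le_total 0 x with h | h
  · rw [abs_of_nonneg h] at hs
    rw [efield_eq_initial hbc hb hft hr hf ht (by rwa [abs_of_nonneg h]),
      efield_eq_integral hf hb (hs 0 ⟨le_rfl, ht⟩), h0]
  · rw [abs_of_nonpos h] at hs
    rw [efield_eq_zero_of_lt hf hb (by linarith [hs t ⟨ht, le_rfl⟩])]

lemma IsTransported.vlasov_partial {K : ℝ → ℝ → ℝ} {f : ℝ → ℝ → ℝ → ℝ → ℝ}
    (h : IsTransported K f) {t : ℝ} (ht : 0 ≤ t) (x v₁ v₂ : ℝ) :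
    timeDeriv (fun s => f s x v₁ v₂) t + v₁ * deriv (fun y => f t y v₁ v₂) x +
      K t x * deriv (fun w => f t x w v₂) v₁ = 0 := by
  have h1 : timeDeriv (fun s => f s x v₁ v₂) t = dirDeriv f (1, 0, 0, 0) t x v₁ v₂ :=
    (h.hasDerivAt_t t x v₁ v₂).hasDerivWithinAt.derivWithin (uniqueDiffOn_Ici 0 t ht)
  rw [h1, (h.hasDerivAt_x t x v₁ v₂).deriv, (h.hasDerivAt_v₁ t x v₁ v₂).deriv]
  exact h.vlasov' t x v₁ v₂

end OneAndHalfVM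

end

theorem mainTheorem3
    (b : ℝ → ℝ) (hb : ContDiff ℝ 1 b) (hbc : HasCompactSupport b)
    (f0 : ℝ → ℝ → ℝ → ℝ) (hf0 : OneAndHalfVM.IsC1cDatum f0)
    (hneutral : OneAndHalfVM.IsNeutral b f0)
    (heven : ∀ x v₁ v₂ : ℝ, f0 x v₁ v₂ = f0 x v₁ (-v₂))
    (E20 B0 : ℝ → ℝ) (hE20 : ∀ x : ℝ, E20 x = 0) (hB0 : ∀ x : ℝ, B0 x = 0) :
    ∃ (f : ℝ → ℝ → ℝ → ℝ → ℝ) (E₁ E₂ B : ℝ → ℝ → ℝ),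
      OneAndHalfVM.IsGlobalVMSolution b f0 E20 B0 f E₁ E₂ B ∧
      (∀ t ≥ 0, ∀ x v₁ v₂ : ℝ, f t x v₁ v₂ = f t x v₁ (-v₂)) ∧
      (∀ t ≥ 0, ∀ x : ℝ, E₂ t x = 0 ∧ B t x = 0) ∧
      OneAndHalfVM.SatisfiesVlasovPoisson b f E₁ ∧
      (∀ (g : ℝ → ℝ → ℝ → ℝ → ℝ) (F₁ F₂ G : ℝ → ℝ → ℝ),
        OneAndHalfVM.IsGlobalVMSolution b f0 E20 B0 g F₁ F₂ G →
        ∀ t ≥ 0, ∀ x : ℝ,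
          (∀ v₁ v₂ : ℝ, g t x v₁ v₂ = f t x v₁ v₂) ∧
          F₁ t x = E₁ t x ∧ F₂ t x = E₂ t x ∧ G t x = B t x) := by
  open OneAndHalfVM in
  obtain ⟨R, M, K, L, Φ, hR, hM, hΦ, hback, hft, hfc, hK⟩ :=
    exists_vlasovPoisson hb.continuous hbc hf0
  have hr := continuous_radius R M
  have hE := contDiff_efield hb.continuous hback hft hr hfc
  have heven' : ∀ t x v₁ v₂ : ℝ, carried Φ f0 t x v₁ v₂ = carried Φ f0 t x v₁ (-v₂) :=
    fun t x v₁ v₂ => heven _ _ _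
  have hVP : SatisfiesVlasovPoisson b (carried Φ f0) (efield b (carried Φ f0)) := by
    refine ⟨fun v₂ t ht x v₁ => ?_, fun t _ x => ?_, fun t ht x => ?_⟩
    · rw [← hK t ht x]
      exact hft.vlasov_partial ht x v₁ v₂
    · exact (hasDerivAt_efield hb.continuous hback hr hfc hft.isContDensity t x).deriv
    · exact (hasDerivAt_efield_time hb.continuous hback hft hr hfc t x).hasDerivWithinAt.derivWithin
        (uniqueDiffOn_Ici 0 t ht)
  have hsol : IsGlobalVMSolution b f0 E20 B0 (carried Φ f0) (efield b (carried Φ f0))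
      (fun _ _ => 0) (fun _ _ => 0) :=
    { regular_f := hft.contDiff.contDiffOn
      regular_E₁ := hE.contDiffOn
      regular_E₂ := contDiffOn_const
      regular_B := contDiffOn_const
      velocities := fun T => ⟨radius R M T, fun t ht x v₁ v₂ hne => by
        have h1 : radius R M t ≤ radius R M T := radius_mono hR hM (by
          rw [abs_of_nonneg ht.1, abs_of_nonneg (ht.1.trans ht.2)]
          exact ht.2)
        obtain ⟨-, a2, a3⟩ := hfc t x v₁ v₂ hne
        exact ⟨a2.trans h1, a3.trans h1⟩⟩
      vlasov := fun t ht x v₁ v₂ => by simpa using hVP.vlasov v₂ t ht x v₁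
      gauss := hVP.gauss
      ampere₁ := hVP.ampere
      ampere₂ := fun t _ x => by
        simp [timeDeriv, current₂_eq_zero_of_even (heven' t x)]
      faraday := fun t _ x => by simp [timeDeriv]
      decay := fun t ht => tendsto_efield_cocompact hr hb.continuous hback hfc hft
        (hneutral.integral_chargeDensity_eq_zero hb.continuous hbc hf0
          (by funext x v₁ v₂; exact carried_zero hΦ x v₁ v₂)) ht
      initial_f := carried_zero hΦ
      initial_E₂ := fun x => (hE20 x).symm
      initial_B := fun x => (hB0 x).symm }
  exact ⟨carried Φ f0, efield b (carried Φ f0), fun _ _ => 0, fun _ _ => 0, hsol,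
    fun t _ => heven' t, fun _ _ _ => ⟨rfl, rfl⟩, hVP,
    fun g F₁ F₂ G hG t ht x => hG.unique hf0 hsol ht x⟩
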